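/- Let $X$ be the simplicial complex on the 15 vertices $V=\{(14)(23),(13)(24),(12)(34)\}\sqcup(\{1,2,3,4\}\times\{1,2,3\})$, where the first three vertices are the elements $\nu\ne e$ of the Klein group $V_4\subset S_4$, whose simplices are the subsets of the sets $\{\nu,(1,b_1),(2,b_2),(3,b_3),(4,b_4)\}$ with $b_{\nu(a)}\neq b_a$ for $a=1,2,3,4$. The group $S_4\times S_3$ acts on $X$ by $(\theta,\varkappa)\cdot\nu=\theta\nu\theta^{-1}$ and $(\theta,\varkappa)\cdot(a,b)=(\theta(a),\varkappa(b))$. Let $c$ be coordinatewise complex conjugation on $\mathbb C^3$, let $\widehat U(3)$ be the group of $\mathbb R$-linear automorphisms of $\mathbb C^3$ generated by $U(3)$ and $c$, let $D=\{\lambda E:|\lambda|=1\}$, and let $P\widehat U(3)=\widehat U(3)/D$, which acts on $\mathbb{CP}^2$. Put $\omega=e^{2\pi i/3}$, and let $B_j\subset\mathbb{CP}^2$ be the set of points $(z_1:z_2:z_3)$ with $|z_j|\ge|z_k|$ for all $k$. **(a)** There are homomorphisms $\rho:S_4\to O(3,\mathbb R)$ and $\eta:S_3\to\widehat U(3)$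 with $$\rho((12))=\begin{pmatrix}0&1&0\\1&0&0\\0&0&1\end{pmatrix},\quad \rho((23))=\begin{pmatrix}1&0&0\\0&0&1\\0&1&0\end{pmatrix},\quad \rho((34))=\begin{pmatrix}0&-1&0\\-1&0&0\\0&0&1\end{pmatrix},$$ $\eta((12))=c$ and $\eta((123))=\mathrm{diag}(1,\omega,\omega^2)$. Putting $\hat\rho(\theta)=\rho(\theta)$ for even $\theta$ and $\hat\rho(\theta)=\rho(\theta)c$ for odd $\theta$ gives a homomorphism $\hat\rho:S_4\to\widehat U(3)$. For all $\theta\in S_4$ and $\varkappa\in S_3$ the commutator $\hat\rho(\theta)\eta(\varkappa)\hat\rho(\theta)^{-1}\eta(\varkappa)^{-1}$ lies in $D$, and $R(\theta,\varkappa)=[\hat\rho(\theta)\eta(\varkappa)]$ is a well-defined injective homomorphism $R:S_4\times S_3\to P\widehat U(3)$. Every $R(h)$ acts on $\mathbb{CP}^2$ by an isometry of the Fubini–Study metric (it preserves both the Riemannian metric and the distance function). **(b)** The action above identifies $S_4\times S_3$ with the full automorphism group $\mathrm{Sym}(X)$, and there is a homeomorphism $f:|X|\to\mathbb{CP}^2$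 such that $f(h\cdot p)=R(h)f(p)$ for all $h\in S_4\times S_3=\mathrm{Sym}(X)$ and $p\in|X|$, and such that $f$ is given on the simplices $\Delta_1=\{(12)(34),(1,3),(2,1),(3,2),(4,3)\}$ and $\Delta_2=\{(12)(34),(1,3),(2,1),(3,1),(4,3)\}$, in the barycentric coordinates $\xi_0,\dots,\xi_4$ taken in this order of the vertices, by $$\Bigl(\tfrac{s}{3}\bigl(\sin\tfrac{\pi\alpha}{2s}+i\sin\tfrac{\pi\beta}{2s}\bigr):\bigl(\tfrac{1-\xi_0}{2}-\tfrac s6\bigr)e^{\frac{i\pi\gamma}{6(1-\xi_0)}}:\bigl(\tfrac{1+\xi_0}{2}-\tfrac s6\bigr)e^{-\frac{i\pi\gamma}{6(1-\xi_0)}}\Bigr),\qquad s=|\alpha|+|\beta|,\quad \alpha=\xi_4-\xi_1,$$ with $\beta=\xi_2+\xi_3$, $\gamma=\xi_2-\xi_3$ on $\Delta_1$ and $\beta=\xi_2-\xi_3$, $\gamma=\xi_2+\xi_3$ on $\Delta_2$ (the first coordinate is $0$ if $s=0$, and the point is $(0:0:1)$ if $\xi_0=1$). Since every four-dimensional simplex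 of $X$ lies in the orbit of $\Delta_1$ or of $\Delta_2$, this determines $f$. **(c)** This $f$ takes the vertices $(14)(23)$, $(13)(24)$, $(12)(34)$ to $(1:0:0)$, $(0:1:0)$, $(0:0:1)$, and the vertices $(1,b),(2,b),(3,b),(4,b)$ to $(-1:\omega^b:\omega^{2b})$, $(1:-\omega^b:\omega^{2b})$, $(1:\omega^b:-\omega^{2b})$, $(1:\omega^b:\omega^{2b})$. **(d)** This $f$ is piecewise smooth: there is a finite rectilinear subdivision of $|X|$ such that $f$ is smooth and immersive on each of its open simplices. **(e)** Under $f$, $X$ is an equilibrium triangulation of $\mathbb{CP}^2$: the disks $B_j$, the solid tori $\Pi_j=\bigcap_{k\ne j}B_k$ and the torus $T=B_1\cap B_2\cap B_3$ are images of subcomplexes of $X$. Explicitly, with $\nu_1=(14)(23)$, $\nu_2=(13)(24)$, $\nu_3=(12)(34)$, these are the subcomplexes of all $\sigma\in X$ such that $\sigma\cup\{\nu_k\}\in X$ for, respectively, $k=j$; all $k\ne j$; all $k$. -/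

import Mathlib

open scoped LinearAlgebra.Projectivization ContDiff ComplexConjugate

noncomputable section

namespace CPTwo

/-! ### Simplicial complexes, realizations, automorphisms -/

section Complexes

variable {V : Type*} [Fintype V] [DecidableEq V]

/-- The geometric realization `|K|`, in barycentric coordinates (a subspace of `ℝ^V`). -/
def realization (K : PreAbstractSimplicialComplex V) : Set (V → ℝ) :=
  {p | (∀ v, 0 ≤ p v) ∧ ∑ v, p v = 1 ∧ ∃ σ ∈ K.faces, ∀ v, p v ≠ 0 → v ∈ σ}

/-- The automorphism group of a simplicial complex on the vertex set `V`. -/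
def Sym (K : PreAbstractSimplicialComplex V) : Subgroup (Equiv.Perm V) where
  carrier := {g | ∀ σ : Finset V, σ.image g ∈ K.faces ↔ σ ∈ K.faces}
  one_mem' := by intro σ; simp
  mul_mem' := by
    intro g h hg hh σ
    have : σ.image (g * h) = (σ.image h).image g := by
      rw [Finset.image_image]; rfl
    rw [this, hg, hh]
  inv_mem' := by
    intro g hg σ
    have := hg (σ.image (g⁻¹ : Equiv.Perm V))
    rw [← this, Finset.image_image]
    simp [Function.comp_def]

/-- The self-map of `|K|` induced by an automorphism, linear on every simplex: the
barycentric coordinate of the image at `g v` is that of the given point at `v`. -/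
def realize {K : PreAbstractSimplicialComplex V} (g : Sym K) (p : realization K) :
    realization K :=
  ⟨fun v => p.1 ((g : Equiv.Perm V).symm v), by
    obtain ⟨p, h0, h1, σ, hσ, hp⟩ := p
    refine ⟨fun v => h0 _, ?_, σ.image g.1, (g.2 σ).2 hσ, fun v hv => ?_⟩
    · exact (Equiv.sum_comp (g : Equiv.Perm V).symm p).trans h1
    · exact Finset.mem_image.2 ⟨_, hp _ hv, by simp⟩⟩

end Complexes

/-! ### The complex `X` -/

/-- The three non-identity elements of the Klein four group `V₄ ⊂ S₄`, in the order
`(14)(23), (13)(24), (12)(34)`; the set `{1, 2, 3, 4}` is modelled by `Fin 4 = {0, 1, 2, 3}`. -/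
def kleinElt : Fin 3 → Equiv.Perm (Fin 4) :=
  ![Equiv.swap 0 3 * Equiv.swap 1 2, Equiv.swap 0 2 * Equiv.swap 1 3,
    Equiv.swap 0 1 * Equiv.swap 2 3]

/-- `V₄ \ {e}`. -/
abbrev Klein : Type := {ν : Equiv.Perm (Fin 4) // ∃ j, kleinElt j = ν}

/-- The elements `(14)(23), (13)(24), (12)(34)` of `V₄ \ {e}`. -/
def klein (j : Fin 3) : Klein := ⟨kleinElt j, j, rfl⟩

/-- The 15 vertices `(V₄ \ {e}) ⊔ ({1, 2, 3, 4} × {1, 2, 3})`; `Fin 3` models `{1, 2, 3}`,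
an element `b : Fin 3` standing for the number `b + 1`. -/
abbrev Vertex : Type := Klein ⊕ (Fin 4 × Fin 3)

/-- The set `{ν, (1, b₁), (2, b₂), (3, b₃), (4, b₄)}`. -/
def facet (ν : Klein) (b : Fin 4 → Fin 3) : Finset Vertex :=
  insert (Sum.inl ν) (Finset.univ.image fun a => Sum.inr (a, b a))

/-- The simplicial complex `X`. (As usual in Mathlib, the empty simplex is not listed.) -/
def X : PreAbstractSimplicialComplex Vertex where
  faces := {σ | σ.Nonempty ∧
    ∃ (ν : Klein) (b : Fin 4 → Fin 3), (∀ a, b (ν.1 a) ≠ b a) ∧ σ ⊆ facet ν b}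
  isRelLowerSet_faces := by
    rintro σ ⟨h, ν, b, hb, hσ⟩
    exact ⟨h, fun τ hτ hne => ⟨hne, ν, b, hb, hτ.trans hσ⟩⟩

theorem kleinElt_conj : ∀ (θ : Equiv.Perm (Fin 4)) (j : Fin 3),
    ∃ k, kleinElt k = θ * kleinElt j * θ⁻¹ := by
  decide

/-- The action of `S₄ × S₃` on the vertices:
`(θ, ϰ) · ν = θ ν θ⁻¹` and `(θ, ϰ) · (a, b) = (θ a, ϰ b)`. -/
def vertexAct (h : Equiv.Perm (Fin 4) × Equiv.Perm (Fin 3)) : Vertex → Vertex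
  | Sum.inl ν => Sum.inl ⟨h.1 * ν.1 * h.1⁻¹, by
      obtain ⟨_, j, rfl⟩ := ν; exact kleinElt_conj h.1 j⟩
  | Sum.inr (a, b) => Sum.inr (h.1 a, h.2 b)

/-- The subcomplex of all `σ ∈ X` such that `σ ∪ {ν_j} ∈ X` for all `j ∈ J`, where
`ν₁ = (14)(23)`, `ν₂ = (13)(24)`, `ν₃ = (12)(34)` (indexed by `Fin 3 = {0, 1, 2}`). -/
def commonStar (J : Finset (Fin 3)) : PreAbstractSimplicialComplex Vertex where
  faces := {σ | σ ∈ X.faces ∧ ∀ j ∈ J, insert (Sum.inl (klein j)) σ ∈ X.faces}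
  isRelLowerSet_faces := by
    rintro σ ⟨h, hJ⟩
    refine ⟨h.1, fun τ hτ hne => ⟨(X.isRelLowerSet_faces h).2 hτ hne, fun j hj => ?_⟩⟩
    exact (X.isRelLowerSet_faces (hJ j hj)).2 (Finset.insert_subset_insert _ hτ)
      (Finset.insert_nonempty _ _)

/-! ### The complex projective plane and its subsets `B_j`, `Π_j`, `T` -/

/-- `ℂ³` with its standard Hermitian structure. -/
abbrev C3 : Type := EuclideanSpace ℂ (Fin 3)

/-- The complex projective plane. -/
abbrev CP2 : Type := ℙ ℂ C3

/-- The quotient topology on `CP²`. -/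
instance instTopologicalSpaceCP2 : TopologicalSpace CP2 :=
  inferInstanceAs (TopologicalSpace (Quotient (projectivizationSetoid ℂ C3)))

/-- The disk `B_j = {|z_j| ≥ |z_k| for all k}`. -/
def disk (j : Fin 3) : Set CP2 :=
  {x | ∃ (z : C3) (hz : z ≠ 0), x = Projectivization.mk ℂ z hz ∧ ∀ k, ‖z k‖ ≤ ‖z j‖}

/-- The solid torus `Π_j`, the intersection of the two disks `B_k`, `k ≠ j`. -/
def solidTorus (j : Fin 3) : Set CP2 := ⋂ k ∈ ({j}ᶜ : Set (Fin 3)), disk k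

/-- The torus `T = B₁ ∩ B₂ ∩ B₃`. -/
def torus : Set CP2 := ⋂ k, disk k

/-- The image under `f` of the part `|L|` of `|K|`, for a subcomplex `L` of `K`. -/
def imageOf {V : Type*} [Fintype V] {K : PreAbstractSimplicialComplex V}
    (f : realization K → CP2) (L : PreAbstractSimplicialComplex V) : Set CP2 :=
  f '' {p | p.1 ∈ realization L}

/-- The triangulation `f : |K| → CP²` is equilibrium: the disks `B_j`, the solid tori `Π_j` and
the torus `T` are (the images of) subcomplexes of it. -/
def IsEquilibrium {V : Type*} [Fintype V] (K : PreAbstractSimplicialComplex V)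
    (f : realization K → CP2) : Prop :=
  (∀ j, ∃ L ≤ K, imageOf f L = disk j) ∧ (∀ j, ∃ L ≤ K, imageOf f L = solidTorus j) ∧
    ∃ L ≤ K, imageOf f L = torus

/-! ### Piecewise smoothness -/

/-- `f : |K| → CP²` is smooth and immersive on the open simplex with vertex set `s`: near the open
simplex it is `p ↦ [F p]` for a smooth map `F` to `ℂ³ \ {0}`, and its differential kills
no nonzero vector tangent to the simplex (the tangent space of `CP²` at `[z]` is `ℂ³ / ℂ z`). -/
def SmoothOnOpenSimplex {V : Type*} [Fintype V] {K : PreAbstractSimplicialComplex V}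
    (f : realization K → CP2) (s : Finset (V → ℝ)) : Prop :=
  ∃ (U : Set (V → ℝ)) (F : (V → ℝ) → C3),
    IsOpen U ∧ intrinsicInterior ℝ (convexHull ℝ (s : Set (V → ℝ))) ⊆ U ∧ ContDiffOn ℝ ∞ F U ∧
      ∀ p : realization K, p.1 ∈ intrinsicInterior ℝ (convexHull ℝ (s : Set (V → ℝ))) →
        (∃ hp : F p.1 ≠ 0, f p = Projectivization.mk ℂ (F p.1) hp) ∧
        ∀ u ∈ vectorSpan ℝ (s : Set (V → ℝ)), u ≠ 0 →
          fderiv ℝ F p.1 u ∉ Submodule.span ℂ {F p.1}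

/-- `f : |K| → CP²` is piecewise smooth: for some finite rectilinear subdivision of `|K|`, the map
`f` is smooth and immersive on every open simplex of the subdivision. -/
def IsPiecewiseSmooth {V : Type*} [Fintype V] (K : PreAbstractSimplicialComplex V)
    (f : realization K → CP2) : Prop :=
  ∃ S : Geometry.SimplicialComplex ℝ (V → ℝ),
    S.faces.Finite ∧ S.space = realization K ∧
      (∀ s ∈ S.faces, ∃ σ ∈ K.faces, ∀ p ∈ s, ∀ v, p v ≠ 0 → v ∈ σ) ∧
      ∀ s ∈ S.faces, SmoothOnOpenSimplex f s

/-! ### The groups `Û(3)`, `D`, `PÛ(3)` -/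

/-- Coordinatewise complex conjugation `c`, as an `ℝ`-linear automorphism of `ℂ³`. -/
def conjEquiv : C3 ≃ₗ[ℝ] C3 where
  toFun z := WithLp.toLp 2 fun i => conj (z i)
  invFun z := WithLp.toLp 2 fun i => conj (z i)
  map_add' z w := by ext i; simp
  map_smul' r z := by ext i; simp
  left_inv z := by ext i; simp
  right_inv z := by ext i; simp

/-- The group `Û(3)` of `ℝ`-linear automorphisms of `ℂ³` generated by `U(3)` and `c`. -/
def Uhat : Subgroup (C3 ≃ₗ[ℝ] C3) :=
  Subgroup.closure
    ({g | ∃ A ∈ Matrix.unitaryGroup (Fin 3) ℂ, ∀ z, g z = A.toEuclideanLin z} ∪ {conjEquiv})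

/-- Every element of `Û(3)` is `ℂ`-linear or `ℂ`-antilinear. -/
theorem Uhat_semilinear (g : C3 ≃ₗ[ℝ] C3) (hg : g ∈ Uhat) :
    (∀ (t : ℂ) z, g (t • z) = t • g z) ∨ (∀ (t : ℂ) z, g (t • z) = conj t • g z) := by
  induction hg using Subgroup.closure_induction with
  | mem x hx =>
    rcases hx with ⟨A, -, hA⟩ | hx
    · left; intro t z; rw [hA, hA, map_smul]
    · right
      intro t z
      rw [Set.mem_singleton_iff.1 hx]
      ext i
      simp [conjEquiv]
  | one => left; intro t z; rfl
  | mul x y _ _ hx hy =>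
    rcases hx with hx | hx <;> rcases hy with hy | hy
    · left; intro t z; rw [LinearEquiv.mul_apply, hy, hx]; rfl
    · right; intro t z; rw [LinearEquiv.mul_apply, hy, hx]; rfl
    · right; intro t z; rw [LinearEquiv.mul_apply, hy, hx]; rfl
    · left; intro t z; rw [LinearEquiv.mul_apply, hy, hx, Complex.conj_conj]; rfl
  | inv x _ hx =>
    rcases hx with hx | hx
    · left; intro t z
      apply x.injective
      rw [hx]
      simp only [← LinearEquiv.mul_apply, mul_inv_cancel, LinearEquiv.coe_one, id_eq]
    · right; intro t z
      apply x.injective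
      rw [hx, Complex.conj_conj]
      simp only [← LinearEquiv.mul_apply, mul_inv_cancel, LinearEquiv.coe_one, id_eq]

/-- The subgroup `D = {λ E : |λ| = 1}` of `Û(3)`. -/
def scalars : Subgroup Uhat where
  carrier := {g | ∃ t : ℂ, ‖t‖ = 1 ∧ ∀ z, g.1 z = t • z}
  one_mem' := ⟨1, by simp, fun z => by simp⟩
  mul_mem' := by
    rintro g h ⟨t, ht, hg⟩ ⟨s, hs, hh⟩
    refine ⟨t * s, by simp [ht, hs], fun z => ?_⟩
    change g.1 (h.1 z) = _
    rw [hh, hg, smul_smul]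
  inv_mem' := by
    rintro g ⟨t, ht, hg⟩
    have h0 : t ≠ 0 := by rintro rfl; simp at ht
    refine ⟨t⁻¹, by simp [ht], fun z => ?_⟩
    apply g.1.injective
    rw [hg (t⁻¹ • z), smul_inv_smul₀ h0]
    change (g.1 * g.1⁻¹) z = z
    simp

/-- `D` is normal in `Û(3)`. -/
instance scalars_normal : scalars.Normal where
  conj_mem := by
    rintro d ⟨t, ht, hd⟩ g
    have hgg : ∀ z, g.1 (g.1⁻¹ z) = z := fun z => by
      change (g.1 * g.1⁻¹) z = z
      simp
    rcases Uhat_semilinear g.1 g.2 with h | h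
    · refine ⟨t, ht, fun z => ?_⟩
      change g.1 (d.1 (g.1⁻¹ z)) = _
      rw [hd, h, hgg]
    · refine ⟨conj t, by simpa using ht, fun z => ?_⟩
      change g.1 (d.1 (g.1⁻¹ z)) = _
      rw [hd, h, hgg]

/-- The group `PÛ(3) = Û(3) / D`. -/
abbrev PUhat : Type := Uhat ⧸ scalars

/-- The map `[z] ↦ [g z]` of `CP²` for `g ∈ Û(3)`. -/
def projMap (g : Uhat) : CP2 → CP2 :=
  Projectivization.lift
    (fun z => Projectivization.mk ℂ (g.1 z.1) ((map_ne_zero_iff g.1 g.1.injective).2 z.2)) (by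
      rintro ⟨z, hz⟩ ⟨w, hw⟩ t (rfl : z = t • w)
      have ht : t ≠ 0 := by rintro rfl; simp at hz
      rw [Projectivization.mk_eq_mk_iff']
      rcases Uhat_semilinear g.1 g.2 with h | h
      · exact ⟨t, (h t w).symm⟩
      · exact ⟨conj t, (h t w).symm⟩)

theorem projMap_mk (g : Uhat) (z : C3) (hz : z ≠ 0) :
    projMap g (Projectivization.mk ℂ z hz) =
      Projectivization.mk ℂ (g.1 z) ((map_ne_zero_iff g.1 g.1.injective).2 hz) := rfl

/-- `Û(3)` acts on `CP²`. -/
def uhatAct : Uhat →* Equiv.Perm CP2 :=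
  MonoidHom.toHomPerm
    { toFun := projMap
      map_one' := by
        funext x
        induction x using Projectivization.ind with
        | h z hz => rfl
      map_mul' := by
        intro g h
        funext x
        induction x using Projectivization.ind with
        | h z hz => rfl }

/-- The action of `PÛ(3)` on `CP²`. -/
def act : PUhat →* Equiv.Perm CP2 :=
  QuotientGroup.lift scalars uhatAct (by
    rintro g ⟨t, ht, hg⟩
    ext x : 1
    induction x using Projectivization.ind with
    | h z hz =>
      change Projectivization.mk ℂ (g.1 z) _ = Projectivization.mk ℂ z hz
      rw [Projectivization.mk_eq_mk_iff']
      exact ⟨t, (hg z).symm⟩)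

/-! ### The Fubini–Study metric -/

/-- The distance function of the Fubini–Study metric,
`d([z], [w]) = arccos (|⟨z, w⟩| / (|z| |w|))`. -/
def fubiniStudyDist (x y : CP2) : ℝ :=
  Real.arccos (‖inner ℂ x.rep y.rep‖ / (‖x.rep‖ * ‖y.rep‖))

/-- The Fubini–Study Riemannian metric, as a quadratic form: the squared length of the tangent
vector of `CP²` at `[z]` represented by `u ∈ ℂ³` (tangent vectors at `[z]` being classes
in `ℂ³ / ℂ z`, in the trivialization given by the representative `z`). -/
def fubiniStudyForm (z u : C3) : ℝ :=
  (‖z‖ ^ 2 * ‖u‖ ^ 2 - ‖inner ℂ z u‖ ^ 2) / ‖z‖ ^ 4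

/-- The distance does not depend on the representatives. -/
theorem fubiniStudyDist_mk (z w : C3) (hz : z ≠ 0) (hw : w ≠ 0) :
    fubiniStudyDist (Projectivization.mk ℂ z hz) (Projectivization.mk ℂ w hw) =
      Real.arccos (‖inner ℂ z w‖ / (‖z‖ * ‖w‖)) := by
  obtain ⟨a, ha⟩ := Projectivization.exists_smul_eq_mk_rep ℂ z hz
  obtain ⟨b, hb⟩ := Projectivization.exists_smul_eq_mk_rep ℂ w hw
  have ha' : (a : ℂ) • z = (Projectivization.mk ℂ z hz).rep := ha
  have hb' : (b : ℂ) • w = (Projectivization.mk ℂ w hw).rep := hb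
  have na : ‖(a : ℂ)‖ ≠ 0 := norm_ne_zero_iff.2 a.ne_zero
  have nb : ‖(b : ℂ)‖ ≠ 0 := norm_ne_zero_iff.2 b.ne_zero
  have nz : ‖z‖ ≠ 0 := norm_ne_zero_iff.2 hz
  have nw : ‖w‖ ≠ 0 := norm_ne_zero_iff.2 hw
  unfold fubiniStudyDist
  rw [← ha', ← hb', inner_smul_left, inner_smul_right, norm_smul, norm_smul, norm_mul, norm_mul,
    RCLike.norm_conj]
  congr 1
  field_simp

/-- A bijection of `CP²` preserving the Fubini–Study distance. -/
structure IsFubiniStudyIsometry (F : CP2 → CP2) : Prop where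
  bijective : Function.Bijective F
  dist_eq : ∀ x y, fubiniStudyDist (F x) (F y) = fubiniStudyDist x y

/-! ### The points `v_s` and the explicit formulas -/

/-- `ω = exp (2πi/3)`. -/
def omega : ℂ := Complex.exp (2 * Real.pi * Complex.I / 3)

/-- `diag(1, ω, ω²)`. -/
def omegaDiag : Matrix (Fin 3) (Fin 3) ℂ := Matrix.diagonal ![1, omega, omega ^ 2]

/-- Homogeneous coordinates of `v_{(a, b)}`: with `b` standing for the number `n = b + 1`, these are
`(1 : ω^n : ω^{2n})` with the sign of the `a`-th coordinate changed if `a ≠ 4`. -/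
def torusPoint (a : Fin 4) (b : Fin 3) : C3 :=
  !₂[(if a = 0 then -1 else 1), (if a = 1 then -1 else 1) * omega ^ (b.val + 1),
    (if a = 2 then -1 else 1) * omega ^ (2 * (b.val + 1))]

/-- The vertices `(12)(34), (1, 3), (2, 1), (3, 2), (4, 3)` of `Δ₁`. -/
def delta₁ : Fin 5 → Vertex :=
  ![Sum.inl (klein 2), Sum.inr (0, 2), Sum.inr (1, 0), Sum.inr (2, 1), Sum.inr (3, 2)]

/-- The vertices `(12)(34), (1, 3), (2, 1), (3, 1), (4, 3)` of `Δ₂`. -/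
def delta₂ : Fin 5 → Vertex :=
  ![Sum.inl (klein 2), Sum.inr (0, 2), Sum.inr (1, 0), Sum.inr (2, 0), Sum.inr (3, 2)]

/-- The common shape of the two explicit formulas. With `s = |α| + |β|`, the homogeneous
coordinates are `s/3 (sin (πα/2s) + i sin (πβ/2s))`,
`((1 - x)/2 - s/6) exp (iπγ/6(1 - x))`, `((1 + x)/2 - s/6) exp (-iπγ/6(1 - x))`.
A quotient with denominator `0` is `0`; it then either multiplies `0` or sits in a phase factor
that does not matter, since the other two coordinates vanish. -/
def chart (x α β γ : ℝ) : C3 :=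
  !₂[(((|α| + |β|) / 3 : ℝ) : ℂ) *
        ((Real.sin (Real.pi * α / (2 * (|α| + |β|))) : ℂ) +
          Complex.I * (Real.sin (Real.pi * β / (2 * (|α| + |β|))) : ℂ)),
    (((1 - x) / 2 - (|α| + |β|) / 6 : ℝ) : ℂ) *
        Complex.exp (Complex.I * ((Real.pi * γ / (6 * (1 - x)) : ℝ) : ℂ)),
    (((1 + x) / 2 - (|α| + |β|) / 6 : ℝ) : ℂ) *
        Complex.exp (-(Complex.I * ((Real.pi * γ / (6 * (1 - x)) : ℝ) : ℂ)))]

/-- Homogeneous coordinates of `f` on `Δ₁`, in the barycentric coordinates `ξ₀, …, ξ₄`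
(note that `|ξ₂ + ξ₃| = ξ₂ + ξ₃`). -/
def formula₁ (ξ : Fin 5 → ℝ) : C3 := chart (ξ 0) (ξ 4 - ξ 1) (ξ 2 + ξ 3) (ξ 2 - ξ 3)

/-- Homogeneous coordinates of `f` on `Δ₂`, in the barycentric coordinates `ζ₀, …, ζ₄`. -/
def formula₂ (ζ : Fin 5 → ℝ) : C3 := chart (ζ 0) (ζ 4 - ζ 1) (ζ 2 - ζ 3) (ζ 2 + ζ 3)

end CPTwo

end

open scoped LinearAlgebra.Projectivization ContDiff ComplexConjugate

noncomputable section

namespace CPTwo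

/-! ### Semilinear unitary maps -/

/-! Normalise homogeneous coordinates by `∑ ‖z_i‖ = 1`. The region where `z₀` is smallest fibres
over part of the moment triangle, and `model` parametrises it. The parameters `x`, `y` (one of them
zero) are the weights of the vertices `(13)(24)`, `(12)(34)`. The number `diamond α β / 3` is the
small coordinate, and `γ` fixes the relative phase of the other two. On the part of `|X|` called the
window, `α`, `β`, `γ` are linear in the barycentric coordinates and determine them, so the formulas
on `Δ₁` and `Δ₂` are both restrictions of the single map `windowMap`. The map `f` is the equivariant
extension of `windowMap`.

Everything about this extension rests on `compatible`: for `p`, `q` in the window and any `h`, one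
has `h p = q` if and only if `R h` takes the image of `p` to that of `q`. One implication makes `f`
well defined, the other makes it injective.

For `h` fixing `(14)(23)`, `compatible` is an explicit computation. Modulo the elements that
preserve the window, such an `h` is a power of `gT`. This element has order 6, turns `(α, β)` by a
right angle and increases `γ` by `1 - x - y`, and six such steps make one full turn of the relative
phase (`compatible_of_shift`). For the other `h`, compare absolute values. By
`Window.norm_windowMap` they are equivariant piecewise linear functions `level j` of the point, so
both sides of the equivalence force two of them to tie. Then `p` lies over a triangle of the torus
joined with one Klein vertex. There `gRot` permutes the coordinates cyclically
(`Admissible.act_gRot`), and the question is reduced to the stabilizer.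

Surjectivity (`reached`) holds because the translates by `gT` cover all phases. Continuity and
compactness then give the homeomorphism, since `CP²` is Hausdorff. The star of the `j`-th Klein
vertex is the set where `level j` is largest, which gives the equilibrium property. Faithfulness of
`R` follows from injectivity of `f`.

The formulas fail to be smooth only through `|α|` and `|β|`, whose kinks are cut out by equating
coordinates with the same label. Bisecting every edge `{(a, n), (a', n)}` makes them linear, and
`branch_immersive` recovers all the linear parameters from the differential of the map to `CP²`.
That `S₄ × S₃` is all of `Sym X` is read off from non-edges and missing triangles
(`Sym_eq_vertexPerm`). -/

/-- The group `S₄ × S₃`. -/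
abbrev G : Type := Equiv.Perm (Fin 4) × Equiv.Perm (Fin 3)

/-- The identity for `b = 1`, complex conjugation for `b = -1`. -/
def conjPow (b : ℤˣ) : ℂ →+* ℂ := if b = 1 then RingHom.id ℂ else starRingEnd ℂ

theorem conjPow_one (w : ℂ) : conjPow 1 w = w := by simp [conjPow]

theorem conjPow_neg_one (w : ℂ) : conjPow (-1) w = conj w := by
  simp [conjPow, show ((-1 : ℤˣ) = 1) ↔ False by decide]

theorem conjPow_mul (b c : ℤˣ) (w : ℂ) : conjPow (b * c) w = conjPow b (conjPow c w) := by
  rcases Int.units_eq_one_or b with rfl | rfl <;> rcases Int.units_eq_one_or c with rfl | rfl <;>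
    simp [conjPow_one, conjPow_neg_one]

theorem norm_conjPow (b : ℤˣ) (w : ℂ) : ‖conjPow b w‖ = ‖w‖ := by
  rcases Int.units_eq_one_or b with rfl | rfl <;> simp [conjPow_one, conjPow_neg_one]

theorem conjPow_ofReal (b : ℤˣ) (r : ℝ) : conjPow b (r : ℂ) = r := by
  rcases Int.units_eq_one_or b with rfl | rfl <;> simp [conjPow_one, conjPow_neg_one]

/-- A unitary matrix as an `ℝ`-linear automorphism of `ℂ³`. -/
def unitEquiv (A : Matrix.unitaryGroup (Fin 3) ℂ) : C3 ≃ₗ[ℝ] C3 :=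
  LinearEquiv.restrictScalars ℝ (LinearEquiv.ofLinearMap A.1.toEuclideanLin (star A.1).toEuclideanLin
    (by
      have := Matrix.mem_unitaryGroup_iff.1 A.2
      ext z : 1
      simp [Matrix.toLpLin_apply, Matrix.mulVec_mulVec, this])
    (by
      have := Matrix.mem_unitaryGroup_iff'.1 A.2
      ext z : 1
      simp [Matrix.toLpLin_apply, Matrix.mulVec_mulVec, this]))

theorem unitEquiv_apply (A : Matrix.unitaryGroup (Fin 3) ℂ) (z : C3) :
    unitEquiv A z = A.1.toEuclideanLin z := rfl

/-- The element `z ↦ A z` or `z ↦ A (c z)` of `Û(3)`. -/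
def semi (A : Matrix.unitaryGroup (Fin 3) ℂ) (b : ℤˣ) : Uhat :=
  ⟨unitEquiv A * (if b = 1 then 1 else conjEquiv), by
    refine mul_mem (Subgroup.subset_closure (Or.inl ⟨A.1, A.2, fun z => rfl⟩)) ?_
    split_ifs
    · exact one_mem _
    · exact Subgroup.subset_closure (Or.inr rfl)⟩

theorem semi_apply' (A : Matrix.unitaryGroup (Fin 3) ℂ) (b : ℤˣ) (z : C3) :
    (semi A b).1 z = A.1.toEuclideanLin (if b = 1 then z else conjEquiv z) := by
  change unitEquiv A ((if b = 1 then 1 else conjEquiv : C3 ≃ₗ[ℝ] C3) z) = _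
  rw [unitEquiv_apply]
  split_ifs <;> rfl

theorem semi_apply (A : Matrix.unitaryGroup (Fin 3) ℂ) (b : ℤˣ) (z : C3) (i : Fin 3) :
    (semi A b).1 z i = ∑ j, A.1 i j * conjPow b (z j) := by
  rw [semi_apply']
  rcases Int.units_eq_one_or b with rfl | rfl
  · simp [conjPow_one, Matrix.toLpLin_apply, Matrix.mulVec, dotProduct]
  · simp [conjPow_neg_one, Matrix.toLpLin_apply, Matrix.mulVec, dotProduct, conjEquiv,
      show ((-1 : ℤˣ) = 1) ↔ False by decide]

theorem Uhat_ext {g h : Uhat} (H : ∀ z i, g.1 z i = h.1 z i) : g = h :=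
  Subtype.ext (LinearEquiv.ext fun z => by ext i; exact H z i)

/-- Moving a conjugation to the right past `B` conjugates the entries of `B`. The homomorphism laws
of `rhoHat` and `eta` are both instances. -/
theorem semi_mul (A B C : Matrix.unitaryGroup (Fin 3) ℂ) (b c : ℤˣ)
    (h : C.1 = A.1 * B.1.map (conjPow b)) : semi A b * semi B c = semi C (b * c) := by
  apply Uhat_ext
  intro z i
  change (semi A b).1 ((semi B c).1 z) i = _
  simp only [semi_apply, h, Matrix.mul_apply, Matrix.map_apply, conjPow_mul, map_sum, map_mul,
    Finset.mul_sum, Finset.sum_mul]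
  rw [Finset.sum_comm]
  simp only [mul_assoc]

/-! ### The representation `ρ` -/

/-- The vertices of a regular tetrahedron. -/
def tet : Fin 4 → Fin 3 → ℤ :=
  ![![-1, 1, 1], ![1, -1, 1], ![1, 1, -1], ![-1, -1, -1]]

/-- Four times the entries of the matrix of `ρ θ`. -/
def rhoFn (θ : Equiv.Perm (Fin 4)) (i j : Fin 3) : ℤ := ∑ a, tet (θ a) i * tet a j

/-- Four times the matrix of `ρ θ`. -/
def rhoInt (θ : Equiv.Perm (Fin 4)) : Matrix (Fin 3) (Fin 3) ℤ := Matrix.of (rhoFn θ)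

theorem sum_tet (j : Fin 3) : ∑ a, tet a j = 0 := by revert j; decide

theorem tet_dot (a b : Fin 4) : ∑ j, tet a j * tet b j = (if a = b then 4 else 0) - 1 := by
  revert a b; decide

/-- The scalar products of the tetrahedron vertices are `4δ - 1`, and the `-1` contributes the sum
of all vertices, which vanishes. Thus `rhoInt θ / 4` is the linear map that permutes the vertices by
`θ`, whence multiplicativity. -/
theorem rhoInt_tet (θ : Equiv.Perm (Fin 4)) (a : Fin 4) (i : Fin 3) :
    ∑ j, rhoInt θ i j * tet a j = 4 * tet (θ a) i := by
  have h : ∑ b, tet (θ b) i = 0 := (Equiv.sum_comp θ fun b => tet b i).trans (sum_tet i)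
  calc ∑ j, rhoInt θ i j * tet a j = ∑ b, tet (θ b) i * ∑ j, tet b j * tet a j := by
        simp only [rhoInt, rhoFn, Matrix.of_apply, Finset.sum_mul, Finset.mul_sum]
        rw [Finset.sum_comm]
        simp only [mul_assoc]
    _ = _ := by
        simp only [tet_dot, mul_sub, Finset.sum_sub_distrib, mul_one, h]
        simp [mul_comm]

theorem rhoInt_mul (θ τ : Equiv.Perm (Fin 4)) :
    rhoInt θ * rhoInt τ = 4 • rhoInt (θ * τ) := by
  ext i j
  calc (rhoInt θ * rhoInt τ) i j = ∑ a, (∑ k, rhoInt θ i k * tet (τ a) k) * tet a j := by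
        simp only [Matrix.mul_apply, Finset.sum_mul]
        rw [Finset.sum_comm]
        simp only [rhoInt, Matrix.of_apply, mul_assoc, ← Finset.mul_sum]
        rfl
    _ = _ := by
        simp only [rhoInt_tet]
        simp [rhoInt, rhoFn, Finset.mul_sum, mul_assoc]

theorem rhoInt_transpose (θ : Equiv.Perm (Fin 4)) : (rhoInt θ).transpose = rhoInt θ⁻¹ := by
  ext i j
  simp only [Matrix.transpose_apply, rhoInt, rhoFn, Matrix.of_apply]
  rw [← Equiv.sum_comp θ fun a => tet (θ⁻¹ a) i * tet a j]
  simp [mul_comm]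

theorem rhoInt_one : rhoInt 1 = 4 • (1 : Matrix (Fin 3) (Fin 3) ℤ) := by
  decide

/-- The matrix of `ρ θ`. -/
def rhoMat (θ : Equiv.Perm (Fin 4)) : Matrix (Fin 3) (Fin 3) ℝ :=
  Matrix.of fun i j => (rhoInt θ i j : ℝ) / 4

theorem rhoMat_mul (θ τ : Equiv.Perm (Fin 4)) : rhoMat θ * rhoMat τ = rhoMat (θ * τ) := by
  ext i j
  have h := congr_fun (congr_fun (rhoInt_mul θ τ) i) j
  have h' : ((∑ k, rhoInt θ i k * rhoInt τ k j : ℤ) : ℝ) = ((4 • rhoInt (θ * τ)) i j : ℤ) := by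
    rw [← h, Matrix.mul_apply]
  simp only [Matrix.mul_apply, rhoMat, Matrix.of_apply]
  simp only [Matrix.smul_apply, nsmul_eq_mul] at h'
  push_cast at h'
  have : ∑ k, (rhoInt θ i k : ℝ) / 4 * ((rhoInt τ k j : ℝ) / 4)
      = (∑ k, (rhoInt θ i k : ℝ) * (rhoInt τ k j : ℝ)) / 16 := by
    rw [Finset.sum_div]
    exact Finset.sum_congr rfl fun k _ => by ring
  rw [this, h']
  ring

theorem rhoMat_one : rhoMat 1 = 1 := by
  ext i j
  simp only [rhoMat, rhoInt_one, Matrix.of_apply, Matrix.smul_apply, Matrix.one_apply]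
  split_ifs <;> simp

theorem rhoMat_transpose (θ : Equiv.Perm (Fin 4)) : (rhoMat θ).transpose = rhoMat θ⁻¹ := by
  ext i j
  simp only [rhoMat, Matrix.transpose_apply, Matrix.of_apply, ← rhoInt_transpose]

/-- The representation `ρ : S₄ → O(3, ℝ)`. -/
def rho : Equiv.Perm (Fin 4) →* Matrix.orthogonalGroup (Fin 3) ℝ where
  toFun θ := ⟨rhoMat θ, by
    rw [Matrix.mem_orthogonalGroup_iff, rhoMat_transpose, rhoMat_mul, mul_inv_cancel,
      rhoMat_one]⟩
  map_one' := Subtype.ext rhoMat_one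
  map_mul' θ τ := Subtype.ext (rhoMat_mul θ τ).symm

/-- The matrix of `ρ θ` as a complex unitary matrix. -/
def rhoC (θ : Equiv.Perm (Fin 4)) : Matrix.unitaryGroup (Fin 3) ℂ :=
  ⟨(rhoMat θ).map Complex.ofReal, by
    rw [Matrix.mem_unitaryGroup_iff]
    have h : star ((rhoMat θ).map Complex.ofReal) = (rhoMat θ⁻¹).map Complex.ofReal := by
      rw [← rhoMat_transpose]
      ext i j
      simp [Matrix.star_apply]
    have h2 := Matrix.map_mul (L := rhoMat θ) (M := rhoMat θ⁻¹) (f := Complex.ofRealHom)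
    rw [rhoMat_mul, mul_inv_cancel, rhoMat_one] at h2
    rw [h]
    refine h2.symm.trans ?_
    simp⟩

/-- The homomorphism `ρhat : S₄ → Û(3)`. -/
def rhoHat : Equiv.Perm (Fin 4) →* Uhat :=
  MonoidHom.mk' (fun θ => semi (rhoC θ) (Equiv.Perm.sign θ)) (by
    intro θ τ
    rw [map_mul]
    symm
    apply semi_mul
    simp only [rhoC]
    ext i j
    have := congr_arg (fun M => (M i j : ℂ))
      (Matrix.map_mul (L := rhoMat θ) (M := rhoMat τ) (f := Complex.ofRealHom))
    rw [rhoMat_mul] at this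
    refine this.trans ?_
    simp [Matrix.mul_apply, conjPow_ofReal])

theorem rhoHat_apply (θ : Equiv.Perm (Fin 4)) (z : C3) (i : Fin 3) :
    (rhoHat θ).1 z i = ∑ j, ((rhoMat θ i j : ℝ) : ℂ) * conjPow (Equiv.Perm.sign θ) (z j) :=
  semi_apply _ _ _ _

/-! ### The representation `η` -/

theorem omega_pow_three : omega ^ 3 = 1 := by
  rw [omega, ← Complex.exp_nat_mul, Complex.exp_eq_one_iff]
  exact ⟨1, by push_cast; ring⟩

theorem norm_omega : ‖omega‖ = 1 := by
  rw [omega, show (2 * Real.pi * Complex.I / 3 : ℂ) = ((2 * Real.pi / 3 : ℝ) : ℂ) * Complex.I by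
    push_cast; ring]
  exact Complex.norm_exp_ofReal_mul_I _

theorem omega_pow_eq {m n : ℕ} (h : m % 3 = n % 3) : omega ^ m = omega ^ n := by
  rw [pow_eq_pow_mod m omega_pow_three, pow_eq_pow_mod n omega_pow_three, h]

theorem conj_omega : conj omega = omega ^ 2 := by
  have h : conj omega * omega = 1 := by
    rw [mul_comm, Complex.mul_conj, Complex.normSq_eq_norm_sq, norm_omega]; simp
  calc conj omega = conj omega * omega ^ 3 := by rw [omega_pow_three, mul_one]
    _ = (conj omega * omega) * omega ^ 2 := by ring
    _ = _ := by rw [h, one_mul]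

theorem conjPow_omega (b : ℤˣ) : conjPow b omega = omega ^ (if b = 1 then 1 else 2) := by
  rcases Int.units_eq_one_or b with rfl | rfl
  · simp [conjPow_one]
  · simp [conjPow_neg_one, conj_omega, show ((-1 : ℤˣ) = 1) ↔ False by decide]

/-- The diagonal matrix `diag(1, ω, ω²) ^ t`. -/
def etaMat (t : ℕ) : Matrix.unitaryGroup (Fin 3) ℂ :=
  ⟨Matrix.diagonal fun j : Fin 3 => omega ^ (t * j.val), by
    rw [Matrix.mem_unitaryGroup_iff, Matrix.star_eq_conjTranspose, Matrix.diagonal_conjTranspose,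
      Matrix.diagonal_mul_diagonal, ← Matrix.diagonal_one]
    congr 1
    ext j
    have h : omega * conj omega = 1 := by
      rw [Complex.mul_conj, Complex.normSq_eq_norm_sq, norm_omega]
      simp
    simp [← mul_pow, h]⟩

/-- The homomorphism `η : S₃ → Û(3)`. -/
def eta : Equiv.Perm (Fin 3) →* Uhat :=
  -- `S₃` acts on the labels modulo 3 by `n ↦ ±n + t`, with the sign of the permutation. The index
  -- `2` stands for the label `3 ≡ 0`, so its image is the translation part `t`.
  MonoidHom.mk' (fun ϰ => semi (etaMat ((ϰ 2).val + 1)) (Equiv.Perm.sign ϰ)) (by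
    intro ϰ μ
    rw [map_mul]
    symm
    apply semi_mul
    simp only [etaMat]
    rw [Matrix.diagonal_map (map_zero _), Matrix.diagonal_mul_diagonal]
    congr 1
    ext j
    simp only [map_pow, conjPow_omega, ← pow_mul, ← pow_add]
    apply omega_pow_eq
    revert ϰ μ j
    decide)

theorem eta_apply (ϰ : Equiv.Perm (Fin 3)) (z : C3) (i : Fin 3) :
    (eta ϰ).1 z i = omega ^ (((ϰ 2).val + 1) * i.val) * conjPow (Equiv.Perm.sign ϰ) (z i) := by
  refine (semi_apply _ _ _ _).trans ?_
  simp [etaMat, Matrix.diagonal_apply]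

/-! ### The homomorphism `R` -/

theorem rhoHat_apply_of {θ : Equiv.Perm (Fin 4)} {i k : Fin 3} {s : ℤ}
    (h : ∀ j, rhoFn θ i j = if j = k then 4 * s else 0) (z : C3) :
    (rhoHat θ).1 z i = s * conjPow (Equiv.Perm.sign θ) (z k) := by
  rw [rhoHat_apply, Finset.sum_eq_single k]
  · simp [rhoMat, rhoInt, h k]
  · intro j _ hj
    simp [rhoMat, rhoInt, h j, hj]
  · simp

theorem norm_omega_pow (n : ℕ) : ‖omega ^ n‖ = 1 := by rw [norm_pow, norm_omega, one_pow]

theorem mem_scalars_of_comm {a b : Uhat} (t : ℂ) (ht : ‖t‖ = 1)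
    (h : ∀ z i, a.1 (b.1 z) i = t * b.1 (a.1 z) i) : a * b * a⁻¹ * b⁻¹ ∈ scalars := by
  refine ⟨t, ht, fun z => ?_⟩
  obtain ⟨y, rfl⟩ := b.1.surjective z
  obtain ⟨x, rfl⟩ := a.1.surjective y
  change a.1 (b.1 (a.1⁻¹ (b.1⁻¹ (b.1 (a.1 x))))) = _
  have h1 : ∀ (g : C3 ≃ₗ[ℝ] C3) w, g⁻¹ (g w) = w := fun g w => g.symm_apply_apply w
  rw [h1, h1]
  ext i
  exact h x i

theorem commute_mk_iff (a b : Uhat) :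
    Commute (QuotientGroup.mk a : PUhat) (QuotientGroup.mk b) ↔ a * b * a⁻¹ * b⁻¹ ∈ scalars := by
  rw [commute_iff_eq, ← QuotientGroup.mk_mul, ← QuotientGroup.mk_mul, eq_comm, QuotientGroup.eq]
  constructor
  · intro h
    have := scalars_normal.conj_mem _ h (b * a)
    simpa [mul_assoc] using this
  · intro h
    have := scalars_normal.conj_mem _ h (b * a)⁻¹
    simpa [mul_assoc] using this

theorem comm_swap (i : Fin 3) (ϰ : Equiv.Perm (Fin 3)) :
    rhoHat (Equiv.swap i.castSucc i.succ) * eta ϰ * (rhoHat (Equiv.swap i.castSucc i.succ))⁻¹ *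
      (eta ϰ)⁻¹ ∈ scalars := by
  have hs : Equiv.Perm.sign (Equiv.swap i.castSucc i.succ) = -1 :=
    Equiv.Perm.sign_swap (by revert i; decide)
  set θ := Equiv.swap i.castSucc i.succ with hθ
  -- A transposition acts by a signed permutation matrix followed by conjugation. Conjugation
  -- doubles the exponents of `omega`, hence the factor 2. The commutator is the scalar `omega ^ (e
  -- * t)` with `t = ϰ 2 + 1`.
  obtain ⟨π, s, e, h, he⟩ : ∃ (π : Fin 3 → Fin 3) (s : Fin 3 → ℤ) (e : ℕ),
      (∀ k j, rhoFn θ k j = if j = π k then 4 * s k else 0) ∧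
      ∀ (k : Fin 3) (b : Fin 3),
        (2 * ((b.val + 1) * (π k).val)) % 3 = (e * (b.val + 1) + (b.val + 1) * k.val) % 3 := by
    fin_cases i
    · exact ⟨Equiv.swap 0 1, fun _ => 1, 2, show ∀ k j : Fin 3, rhoFn (Equiv.swap 0 1) k j =
        if j = Equiv.swap 0 1 k then 4 * 1 else 0 by decide, by decide⟩
    · exact ⟨Equiv.swap 1 2, fun _ => 1, 0, show ∀ k j : Fin 3, rhoFn (Equiv.swap 1 2) k j =
        if j = Equiv.swap 1 2 k then 4 * 1 else 0 by decide, by decide⟩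
    · exact ⟨Equiv.swap 0 1, fun k => if k = 2 then 1 else -1, 2,
        show ∀ k j : Fin 3, rhoFn (Equiv.swap 2 3) k j =
          if j = Equiv.swap 0 1 k then 4 * (if k = 2 then 1 else -1) else 0 by decide, by decide⟩
  refine mem_scalars_of_comm (omega ^ (e * ((ϰ 2).val + 1))) (norm_omega_pow _) fun z k => ?_
  rw [rhoHat_apply_of (h k), eta_apply, eta_apply, rhoHat_apply_of (h k), hs]
  simp only [map_mul, map_pow, map_intCast, ← conjPow_mul, conjPow_omega, mul_comm (-1 : ℤˣ)]
  rw [if_neg (by decide), ← pow_mul, omega_pow_eq (he k (ϰ 2)), pow_add]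
  ring

/-- Phrased as commutation in the quotient by `D`, the condition is closed under products in `θ`, so
adjacent transpositions suffice. -/
theorem comm_mem_scalars (θ : Equiv.Perm (Fin 4)) (ϰ : Equiv.Perm (Fin 3)) :
    rhoHat θ * eta ϰ * (rhoHat θ)⁻¹ * (eta ϰ)⁻¹ ∈ scalars := by
  rw [← commute_mk_iff]
  have h : θ ∈ Submonoid.closure
      (Set.range fun i : Fin 3 => Equiv.swap i.castSucc i.succ) := by
    rw [Equiv.Perm.mclosure_swap_castSucc_succ]; trivial
  induction h using Submonoid.closure_induction with
  | mem x hx =>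
    obtain ⟨i, rfl⟩ := hx
    exact (commute_mk_iff _ _).2 (comm_swap i ϰ)
  | one => rw [map_one]; exact Commute.one_left _
  | mul x y _ _ hx hy =>
    rw [map_mul, QuotientGroup.mk_mul]
    exact hx.mul_left hy

/-- The homomorphism `R : S₄ × S₃ → PÛ(3)`. -/
def RHom : G →* PUhat :=
  MonoidHom.noncommCoprod ((QuotientGroup.mk' scalars).comp rhoHat)
    ((QuotientGroup.mk' scalars).comp eta)
    fun θ ϰ => (commute_mk_iff _ _).2 (comm_mem_scalars θ ϰ)

theorem RHom_apply (θ : Equiv.Perm (Fin 4)) (ϰ : Equiv.Perm (Fin 3)) :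
    RHom (θ, ϰ) = QuotientGroup.mk (rhoHat θ * eta ϰ) := rfl

/-- The element `ρhat θ ∘ η ϰ` of `Û(3)`. -/
def lift (h : G) : Uhat := rhoHat h.1 * eta h.2

theorem act_RHom_mk (h : G) (z : C3) (hz : z ≠ 0) :
    act (RHom h) (Projectivization.mk ℂ z hz) =
      Projectivization.mk ℂ ((lift h).1 z) ((map_ne_zero_iff _ (lift h).1.injective).2 hz) := rfl

theorem lift_apply_of {h : G} {i k : Fin 3} {s : ℤ}
    (H : ∀ j, rhoFn h.1 i j = if j = k then 4 * s else 0) (z : C3) :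
    (lift h).1 z i = s * conjPow (Equiv.Perm.sign h.1)
      (omega ^ (((h.2 2).val + 1) * k.val) * conjPow (Equiv.Perm.sign h.2) (z k)) := by
  change (rhoHat h.1).1 ((eta h.2).1 z) i = _
  rw [rhoHat_apply_of H, eta_apply]

/-! ### Isometries -/

theorem norm_inner_Uhat (g : C3 ≃ₗ[ℝ] C3) (hg : g ∈ Uhat) (z w : C3) :
    ‖inner ℂ (g z) (g w)‖ = ‖inner ℂ z w‖ := by
  induction hg using Subgroup.closure_induction generalizing z w with
  | mem x hx =>
    rcases hx with ⟨A, hA, h⟩ | hx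
    · have e : inner ℂ (x z) (x w) = inner ℂ z w := by
        rw [h, h, ← LinearMap.adjoint_inner_right, ← Matrix.toEuclideanLin_conjTranspose_eq_adjoint,
          ← Matrix.star_eq_conjTranspose]
        have := Matrix.mem_unitaryGroup_iff'.1 hA
        simp [Matrix.toLpLin_apply, Matrix.mulVec_mulVec, this]
      rw [e]
    · rw [Set.mem_singleton_iff.1 hx, ← RCLike.norm_conj (inner ℂ z w)]
      congr 1
      simp [PiLp.inner_apply, conjEquiv]
  | one => rfl
  | mul x y _ _ hx hy => exact (hx _ _).trans (hy _ _)
  | inv x _ hx =>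
    have h1 : ∀ w, x (x⁻¹ w) = w := fun w => x.apply_symm_apply w
    have h2 := hx (x⁻¹ z) (x⁻¹ w)
    rw [h1, h1] at h2
    exact h2.symm

theorem norm_Uhat (g : C3 ≃ₗ[ℝ] C3) (hg : g ∈ Uhat) (z : C3) : ‖g z‖ = ‖z‖ := by
  have h := norm_inner_Uhat g hg z z
  rw [inner_self_eq_norm_sq_to_K, inner_self_eq_norm_sq_to_K] at h
  simp only [norm_pow, RCLike.norm_ofReal, abs_norm] at h
  exact (sq_eq_sq₀ (norm_nonneg _) (norm_nonneg _)).1 h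

theorem isFubiniStudyIsometry_act (x : PUhat) : IsFubiniStudyIsometry (act x) := by
  refine ⟨(act x).bijective, fun p q => ?_⟩
  obtain ⟨g, rfl⟩ := QuotientGroup.mk_surjective x
  induction p using Projectivization.ind with
  | h z hz =>
    induction q using Projectivization.ind with
    | h w hw =>
      have h1 : ∀ z hz, act (QuotientGroup.mk g) (Projectivization.mk ℂ z hz) =
        Projectivization.mk ℂ (g.1 z) ((map_ne_zero_iff g.1 g.1.injective).2 hz) := fun _ _ => rfl
      rw [h1, h1, fubiniStudyDist_mk, fubiniStudyDist_mk, norm_inner_Uhat g.1 g.2,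
        norm_Uhat g.1 g.2, norm_Uhat g.1 g.2]

theorem fubiniStudyForm_Uhat (g : Uhat) (z u : C3) :
    fubiniStudyForm (g.1 z) (g.1 u) = fubiniStudyForm z u := by
  simp only [fubiniStudyForm, norm_inner_Uhat g.1 g.2, norm_Uhat g.1 g.2]

/-! ### Faces of `X` -/

theorem klein_surjective (ν : Klein) : ∃ j, ν = klein j := by
  obtain ⟨_, j, rfl⟩ := ν
  exact ⟨j, rfl⟩

theorem kleinElt_injective : Function.Injective kleinElt := by decide

theorem klein_injective : Function.Injective klein := fun _ _ h =>
  kleinElt_injective (congr_arg Subtype.val h)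

theorem inl_mem_facet {ν ν' : Klein} {b : Fin 4 → Fin 3} :
    (Sum.inl ν' : Vertex) ∈ facet ν b ↔ ν' = ν := by
  simp [facet]

theorem inr_mem_facet {ν : Klein} {b : Fin 4 → Fin 3} {a : Fin 4} {n : Fin 3} :
    (Sum.inr (a, n) : Vertex) ∈ facet ν b ↔ b a = n := by
  simp [facet]

theorem pair_mem_faces {v w : Vertex} : {v, w} ∈ X.faces ↔
    ∃ (ν : Klein) (b : Fin 4 → Fin 3), (∀ a, b (ν.1 a) ≠ b a) ∧ v ∈ facet ν b ∧ w ∈ facet ν b := by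
  simp [X, Finset.insert_subset_iff]

theorem triple_mem_faces {u v w : Vertex} : {u, v, w} ∈ X.faces ↔
    ∃ (ν : Klein) (b : Fin 4 → Fin 3), (∀ a, b (ν.1 a) ≠ b a) ∧
      u ∈ facet ν b ∧ v ∈ facet ν b ∧ w ∈ facet ν b := by
  simp [X, Finset.insert_subset_iff]

theorem exists_labels : ∀ (j : Fin 3) (a a' : Fin 4) (n n' : Fin 3), a ≠ a' →
    ¬ (a' = kleinElt j a ∧ n = n') → ∃ b₀ b₁ b₂ b₃ : Fin 3,
      (∀ c, ![b₀, b₁, b₂, b₃] (kleinElt j c) ≠ ![b₀, b₁, b₂, b₃] c) ∧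
        ![b₀, b₁, b₂, b₃] a = n ∧ ![b₀, b₁, b₂, b₃] a' = n' := by
  decide +kernel

theorem kleinElt_ne : ∀ (j : Fin 3) (a : Fin 4), kleinElt j a ≠ a := by decide

theorem inl_inr_inr_mem_faces {ν : Klein} {a a' : Fin 4} {n n' : Fin 3} :
    {Sum.inl ν, Sum.inr (a, n), Sum.inr (a', n')} ∈ X.faces ↔
      (a = a' → n = n') ∧ ¬ (a' = ν.1 a ∧ n = n') := by
  rw [triple_mem_faces]
  simp only [inl_mem_facet, inr_mem_facet]
  constructor
  · rintro ⟨ν', b, hb, rfl, rfl, rfl⟩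
    refine ⟨fun h => by rw [h], ?_⟩
    rintro ⟨rfl, h⟩
    exact hb a h.symm
  · rintro ⟨h, h'⟩
    obtain ⟨j, rfl⟩ := klein_surjective ν
    by_cases haa : a = a'
    · subst haa
      obtain rfl := h rfl
      obtain ⟨b₀, b₁, b₂, b₃, hb, h1, -⟩ := exists_labels j a (kleinElt j a) n (n + 1)
        (kleinElt_ne j a).symm (by simp)
      exact ⟨_, _, hb, rfl, h1, h1⟩
    · obtain ⟨b₀, b₁, b₂, b₃, hb, h1, h2⟩ := exists_labels j a a' n n' haa h'
      exact ⟨_, _, hb, rfl, h1, h2⟩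

theorem inl_inr_mem_faces (ν : Klein) (a : Fin 4) (n : Fin 3) :
    {Sum.inl ν, Sum.inr (a, n)} ∈ X.faces := by
  have := (inl_inr_inr_mem_faces (ν := ν) (a := a) (a' := a) (n := n) (n' := n)).2
    ⟨fun _ => rfl, fun h => by
      obtain ⟨j, rfl⟩ := klein_surjective ν
      exact kleinElt_ne j a h.1.symm⟩
  simpa using this

theorem inl_inl_mem_faces {ν ν' : Klein} : {Sum.inl ν, Sum.inl ν'} ∈ X.faces ↔ ν = ν' := by
  constructor
  · rw [pair_mem_faces]
    simp only [inl_mem_facet]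
    rintro ⟨_, b, hb, rfl, rfl⟩
    rfl
  · rintro rfl
    have := (X.isRelLowerSet_faces (inl_inr_mem_faces ν 0 0)).2
      (Finset.singleton_subset_iff.2 (Finset.mem_insert_self _ _)) (Finset.singleton_nonempty _)
    simpa using this

theorem inr_inr_mem_faces {a a' : Fin 4} {n n' : Fin 3} :
    {Sum.inr (a, n), Sum.inr (a', n')} ∈ X.faces ↔ (a = a' → n = n') := by
  constructor
  · rw [pair_mem_faces]
    simp only [inr_mem_facet]
    rintro ⟨_, b, hb, rfl, rfl⟩ h
    rw [h]
  · intro h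
    obtain ⟨j, hj⟩ : ∃ j, a' ≠ kleinElt j a := by clear h; revert a a'; decide
    refine (X.isRelLowerSet_faces ((inl_inr_inr_mem_faces (ν := klein j)).2
      ⟨h, fun h' => hj h'.1⟩)).2 (Finset.subset_insert _ _) (Finset.insert_nonempty _ _)

/-- Each Klein element pairs off the four indices, so it interchanges two of any three, and these
two must carry different labels. -/
theorem inr_inr_inr_notMem_faces {a a' a'' : Fin 4} (n : Fin 3) (h : a ≠ a') (h' : a ≠ a'')
    (h'' : a' ≠ a'') : {Sum.inr (a, n), Sum.inr (a', n), Sum.inr (a'', n)} ∉ X.faces := by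
  rw [triple_mem_faces]
  simp only [inr_mem_facet]
  rintro ⟨ν, b, hb, h1, h2, h3⟩
  obtain ⟨j, rfl⟩ := klein_surjective ν
  have key : ∀ (j : Fin 3) (a a' a'' : Fin 4), a ≠ a' → a ≠ a'' → a' ≠ a'' →
    a' = kleinElt j a ∨ a'' = kleinElt j a ∨ a'' = kleinElt j a' := by decide
  rcases key j a a' a'' h h' h'' with e | e | e
  · exact hb a (by rw [h1, ← h2, e]; rfl)
  · exact hb a (by rw [h1, ← h3, e]; rfl)
  · exact hb a' (by rw [h2, ← h3, e]; rfl)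

/-! ### The automorphism group of `X` -/

theorem vertexAct_one (v : Vertex) : vertexAct 1 v = v := by
  rcases v with ν | ⟨a, n⟩ <;> simp [vertexAct]

theorem vertexAct_mul (h k : G) (v : Vertex) :
    vertexAct (h * k) v = vertexAct h (vertexAct k v) := by
  rcases v with ν | ⟨a, n⟩ <;> simp [vertexAct, mul_assoc]

/-- The action of `S₄ × S₃` on the vertices. -/
def vertexPerm : G →* Equiv.Perm Vertex :=
  MonoidHom.toHomPerm
    { toFun := vertexAct
      map_one' := funext vertexAct_one
      map_mul' := fun h k => funext (vertexAct_mul h k) }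

theorem vertexPerm_apply (h : G) (v : Vertex) : vertexPerm h v = vertexAct h v := rfl

theorem image_facet (h : G) (ν : Klein) (b : Fin 4 → Fin 3) (hb : ∀ a, b (ν.1 a) ≠ b a) :
    ∃ ν' b', (∀ a, b' (ν'.1 a) ≠ b' a) ∧ (facet ν b).image (vertexPerm h) = facet ν' b' := by
  refine ⟨⟨h.1 * ν.1 * h.1⁻¹, ?_⟩, fun a => h.2 (b (h.1⁻¹ a)), fun a => ?_, ?_⟩
  · obtain ⟨_, j, rfl⟩ := ν
    exact kleinElt_conj h.1 j
  · simpa using hb (h.1⁻¹ a)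
  · ext v
    simp only [Finset.mem_image]
    constructor
    · rintro ⟨ν' | ⟨a, n⟩, hv, rfl⟩
      · rw [inl_mem_facet] at hv
        subst hv
        exact inl_mem_facet.2 rfl
      · rw [inr_mem_facet] at hv
        subst hv
        exact inr_mem_facet.2 (by simp)
    · rcases v with ν' | ⟨a, n⟩
      · rw [inl_mem_facet]
        rintro rfl
        exact ⟨Sum.inl ν, inl_mem_facet.2 rfl, rfl⟩
      · rw [inr_mem_facet]
        rintro rfl
        exact ⟨Sum.inr (h.1⁻¹ a, b (h.1⁻¹ a)), inr_mem_facet.2 rfl, by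
          simp [vertexPerm_apply, vertexAct]⟩

theorem image_mem_faces (h : G) {σ : Finset Vertex} (hσ : σ ∈ X.faces) :
    σ.image (vertexPerm h) ∈ X.faces := by
  obtain ⟨hne, ν, b, hb, hs⟩ := hσ
  obtain ⟨ν', b', hb', e⟩ := image_facet h ν b hb
  exact ⟨hne.image _, ν', b', hb', e ▸ Finset.image_subset_image hs⟩

theorem vertexPerm_mem_Sym (h : G) : vertexPerm h ∈ Sym X := by
  intro σ
  refine ⟨fun H => ?_, image_mem_faces h⟩
  have := image_mem_faces h⁻¹ H
  rw [Finset.image_image, map_inv] at this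
  simpa [Function.comp_def] using this

theorem Sym_pair {g : Equiv.Perm Vertex} (hg : g ∈ Sym X) (v w : Vertex) :
    {g v, g w} ∈ X.faces ↔ {v, w} ∈ X.faces := by
  rw [← hg {v, w}, Finset.image_insert, Finset.image_singleton]

theorem Sym_triple {g : Equiv.Perm Vertex} (hg : g ∈ Sym X) (u v w : Vertex) :
    {g u, g v, g w} ∈ X.faces ↔ {u, v, w} ∈ X.faces := by
  rw [← hg {u, v, w}, Finset.image_insert, Finset.image_insert, Finset.image_singleton]

/-- The three other vertices with label `n` are adjacent to `(a, n)`, and any two of them form a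
missing triangle with it. A missing triangle at a Klein vertex whose edges are all present has the
shape `{ν, (c, m), (ν c, m)}`. There the second vertex determines the third, so two distinct
vertices would have the same image. -/
theorem Sym_symm_inr {g : Equiv.Perm Vertex} (hg : g ∈ Sym X) (ν : Klein) (p : Fin 4 × Fin 3) :
    g (Sum.inr p) ≠ Sum.inl ν := by
  intro h
  obtain ⟨a, n⟩ := p
  obtain ⟨a₁, a₂, a₃, h1, h2, h3, h12, h13, h23⟩ : ∃ a₁ a₂ a₃ : Fin 4, a ≠ a₁ ∧ a ≠ a₂ ∧ a ≠ a₃ ∧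
    a₁ ≠ a₂ ∧ a₁ ≠ a₃ ∧ a₂ ≠ a₃ := by clear h; revert a; decide
  have key : ∀ c, a ≠ c → ∃ q, g (Sum.inr (c, n)) = Sum.inr q := by
    intro c hc
    rcases e : g (Sum.inr (c, n)) with ν' | q
    · have := (Sym_pair hg (Sum.inr (a, n)) (Sum.inr (c, n))).2
        (inr_inr_mem_faces.2 fun h => absurd h hc)
      rw [h, e, inl_inl_mem_faces] at this
      subst this
      have := g.injective (h.trans e.symm)
      simp [hc] at this
    · exact ⟨q, rfl⟩
  obtain ⟨⟨c₁, m₁⟩, e1⟩ := key a₁ h1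
  obtain ⟨⟨c₂, m₂⟩, e2⟩ := key a₂ h2
  obtain ⟨⟨c₃, m₃⟩, e3⟩ := key a₃ h3
  have t : ∀ x y c m c' m', a ≠ x → a ≠ y → x ≠ y → g (Sum.inr (x, n)) = Sum.inr (c, m) →
      g (Sum.inr (y, n)) = Sum.inr (c', m') → c' = ν.1 c ∧ m = m' := by
    intro x y c m c' m' hx hy hxy ex ey
    have t1 := mt (Sym_triple hg _ _ _).1 (inr_inr_inr_notMem_faces n hx hy hxy)
    have t2 := (Sym_pair hg (Sum.inr (x, n)) (Sum.inr (y, n))).2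
      (inr_inr_mem_faces.2 fun h => absurd h hxy)
    rw [h, ex, ey, inl_inr_inr_mem_faces] at t1
    rw [ex, ey, inr_inr_mem_faces] at t2
    by_contra hcon
    exact t1 ⟨t2, hcon⟩
  have t2 := t a₁ a₂ c₁ m₁ c₂ m₂ h1 h2 h12 e1 e2
  have t3 := t a₁ a₃ c₁ m₁ c₃ m₃ h1 h3 h13 e1 e3
  have : g (Sum.inr (a₂, n)) = g (Sum.inr (a₃, n)) := by
    rw [e2, e3, t2.1, t3.1, ← t2.2, ← t3.2]
  simpa [h23] using g.injective this

theorem exists_kleinElt : ∀ a a' : Fin 4, a ≠ a' → ∃ j, kleinElt j a = a' := by decide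

/-- Non-edges among the vertices `(a, n)` preserve equality of first entries. The missing triangles
`{ν, (a, n), (ν a, n)}` preserve equality of labels, and they also force the action on the Klein
vertices to be conjugation. -/
theorem Sym_eq_vertexPerm {g : Equiv.Perm Vertex} (hg : g ∈ Sym X) : ∃ h, vertexPerm h = g := by
  have hr : ∀ p, ∃ q, g (Sum.inr p) = Sum.inr q := by
    intro p
    rcases e : g (Sum.inr p) with ν' | q
    · exact absurd e (Sym_symm_inr hg ν' p)
    · exact ⟨q, rfl⟩
  have hl : ∀ ν, ∃ ν', g (Sum.inl ν) = Sum.inl ν' := by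
    intro ν
    rcases e : g (Sum.inl ν) with ν' | q
    · exact ⟨ν', rfl⟩
    · refine absurd ?_ (Sym_symm_inr (inv_mem hg) ν q)
      rw [← e]
      exact g.symm_apply_apply _
  choose r hr using hr
  choose l hl using hl
  have h1 : ∀ a n, (r (a, n)).1 = (r (a, 0)).1 := by
    intro a n
    by_contra hne
    have := (Sym_pair hg (Sum.inr (a, n)) (Sum.inr (a, 0))).1
      (by rw [hr, hr]; exact inr_inr_mem_faces.2 fun h => absurd h hne)
    rw [inr_inr_mem_faces] at this
    rw [this rfl] at hne
    exact hne rfl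
  have h2 : ∀ ν a n, (r (ν.1 a, n)).1 = (l ν).1 (r (a, n)).1 ∧ (r (a, n)).2 = (r (ν.1 a, n)).2 := by
    intro ν a n
    have hν : a ≠ ν.1 a := by
      obtain ⟨j, rfl⟩ := klein_surjective ν
      exact (kleinElt_ne j a).symm
    have t1 := mt (Sym_triple hg (Sum.inl ν) (Sum.inr (a, n)) (Sum.inr (ν.1 a, n))).1
      (by rw [inl_inr_inr_mem_faces]; simp)
    have t2 := (Sym_pair hg (Sum.inr (a, n)) (Sum.inr (ν.1 a, n))).2
      (inr_inr_mem_faces.2 fun h => absurd h hν)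
    rw [hl, hr, hr] at t1
    rw [hr, hr] at t2
    have t1' := mt inl_inr_inr_mem_faces.2 t1
    have t2' := inr_inr_mem_faces.1 t2
    by_contra hcon
    exact t1' ⟨t2', hcon⟩
  have h3 : ∀ a n, (r (a, n)).2 = (r (0, n)).2 := by
    intro a n
    by_cases ha : a = 0
    · rw [ha]
    · obtain ⟨j, hj⟩ := exists_kleinElt a 0 ha
      rw [(h2 (klein j) a n).2]
      congr 3
  have h4 : ∀ a n, r (a, n) = ((r (a, 0)).1, (r (0, n)).2) := fun a n =>
    Prod.ext (h1 a n) (h3 a n)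
  have rinj : Function.Injective r := fun p q h => by
    have := g.injective ((hr p).trans ((congr_arg Sum.inr h).trans (hr q).symm))
    simpa using this
  have i1 : Function.Injective fun a => (r (a, 0)).1 := fun a a' h => by
    have := rinj (a₁ := (a, 0)) (a₂ := (a', 0)) (by
      rw [h4 a, h4 a']
      exact Prod.ext h rfl)
    exact congr_arg Prod.fst this
  have i2 : Function.Injective fun n => (r (0, n)).2 := fun n n' h => by
    have := rinj (a₁ := (0, n)) (a₂ := (0, n')) (by
      rw [h4 0 n, h4 0 n']
      exact Prod.ext rfl h)
    exact congr_arg Prod.snd this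
  refine ⟨(Equiv.ofBijective _ (Finite.injective_iff_bijective.1 i1),
    Equiv.ofBijective _ (Finite.injective_iff_bijective.1 i2)), Equiv.ext fun v => ?_⟩
  rcases v with ν | ⟨a, n⟩
  · rw [hl, vertexPerm_apply, vertexAct, Sum.inl.injEq]
    apply Subtype.ext
    change _ * _ * _⁻¹ = _
    rw [mul_inv_eq_iff_eq_mul]
    ext1 a
    exact (h2 ν a 0).1
  · rw [hr, vertexPerm_apply, h4 a n]
    rfl

theorem vertexPerm_injective : Function.Injective vertexPerm := by
  rw [injective_iff_map_eq_one]
  rintro ⟨θ, ϰ⟩ h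
  have H : ∀ a n, (Sum.inr (θ a, ϰ n) : Vertex) = Sum.inr (a, n) := fun a n =>
    Equiv.ext_iff.1 h (Sum.inr (a, n))
  refine Prod.ext (Equiv.ext fun a => ?_) (Equiv.ext fun n => ?_)
  · exact congr_arg Prod.fst (Sum.inr.inj (H a 0))
  · exact congr_arg Prod.snd (Sum.inr.inj (H 0 n))

/-- The identification of `S₄ × S₃` with the automorphism group of `X`. -/
def symEquiv : G ≃* Sym X :=
  MulEquiv.ofBijective (vertexPerm.codRestrict (Sym X) vertexPerm_mem_Sym)
    ⟨fun h k e => vertexPerm_injective (congr_arg Subtype.val e), fun g => by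
      obtain ⟨h, e⟩ := Sym_eq_vertexPerm g.2
      exact ⟨h, Subtype.ext e⟩⟩

/-! ### Polar coordinates for the `ℓ¹` norm -/

/-- The homeomorphism `ℝ² → ℂ` that turns the `ℓ¹` norm into the Euclidean one and is linear in the
angle on every side of the `ℓ¹` sphere. -/
def diamond (α β : ℝ) : ℂ :=
  ((|α| + |β| : ℝ) : ℂ) * ((Real.sin (Real.pi * α / (2 * (|α| + |β|))) : ℂ) +
    Complex.I * (Real.sin (Real.pi * β / (2 * (|α| + |β|))) : ℂ))

theorem diamond_re (α β : ℝ) :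
    (diamond α β).re = (|α| + |β|) * Real.sin (Real.pi * α / (2 * (|α| + |β|))) := by
  rw [diamond, Complex.re_ofReal_mul]
  simp only [Complex.add_re, Complex.ofReal_re, Complex.mul_re, Complex.I_re, Complex.I_im,
    Complex.ofReal_im, zero_mul, mul_zero, sub_zero, add_zero]

theorem diamond_im (α β : ℝ) :
    (diamond α β).im = (|α| + |β|) * Real.sin (Real.pi * β / (2 * (|α| + |β|))) := by
  rw [diamond, Complex.im_ofReal_mul]
  simp only [Complex.add_im, Complex.ofReal_re, Complex.mul_im, Complex.I_re, Complex.I_im,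
    Complex.ofReal_im, zero_mul, one_mul, zero_add]

theorem diamond_rot (α β : ℝ) : diamond (-β) α = Complex.I * diamond α β := by
  apply Complex.ext
  · rw [diamond_re, Complex.I_mul_re, diamond_im, abs_neg, add_comm |β| |α|, mul_neg, neg_div,
      Real.sin_neg, mul_neg]
  · rw [diamond_im, Complex.I_mul_im, diamond_re, abs_neg, add_comm |β| |α|]

theorem diamond_conj (α β : ℝ) : diamond α (-β) = conj (diamond α β) := by
  apply Complex.ext
  · rw [diamond_re, Complex.conj_re, diamond_re, abs_neg]
  · rw [diamond_im, Complex.conj_im, diamond_im, abs_neg, mul_neg, neg_div, Real.sin_neg, mul_neg]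

theorem diamond_neg (α β : ℝ) : diamond (-α) (-β) = -diamond α β := by
  rw [diamond_rot (-β) α, diamond_rot α β, ← mul_assoc, Complex.I_mul_I, neg_one_mul]

theorem diamond_zero : diamond 0 0 = 0 := by simp [diamond]

theorem abs_add_abs_pos {α β : ℝ} (h : ¬ (α = 0 ∧ β = 0)) : 0 < |α| + |β| := by
  by_cases ha : α = 0
  · have hb : β ≠ 0 := fun hb => h ⟨ha, hb⟩
    have := abs_pos.2 hb
    have := abs_nonneg α
    linarith
  · have := abs_pos.2 ha
    have := abs_nonneg β
    linarith

theorem diamond_of_nonneg {α β : ℝ} (hα : 0 ≤ α) (hβ : 0 ≤ β) :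
    diamond α β =
      ((α + β : ℝ) : ℂ) * Complex.exp (((Real.pi * β / (2 * (α + β)) : ℝ) : ℂ) * Complex.I) := by
  by_cases h : α = 0 ∧ β = 0
  · simp [h.1, h.2, diamond_zero]
  have hs := abs_add_abs_pos h
  rw [abs_of_nonneg hα, abs_of_nonneg hβ] at hs
  have e : Real.pi * α / (2 * (α + β)) = Real.pi / 2 - Real.pi * β / (2 * (α + β)) := by
    field_simp
    ring
  rw [Complex.exp_mul_I, ← Complex.ofReal_cos, ← Complex.ofReal_sin, diamond, abs_of_nonneg hα,
    abs_of_nonneg hβ, e, Real.sin_pi_div_two_sub]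
  ring

theorem norm_diamond_of_nonneg {α β : ℝ} (hα : 0 ≤ α) (hβ : 0 ≤ β) : ‖diamond α β‖ = α + β := by
  rw [diamond_of_nonneg hα hβ, norm_mul, Complex.norm_exp_ofReal_mul_I, mul_one, Complex.norm_real,
    Real.norm_eq_abs, abs_of_nonneg (add_nonneg hα hβ)]

/-- Reflections reduce this to the first quadrant, where the two angles are complementary and
`diamond` is a polar form. -/
theorem norm_diamond (α β : ℝ) : ‖diamond α β‖ = |α| + |β| := by
  have h1 : ∀ α β, ‖diamond α (-β)‖ = ‖diamond α β‖ := fun α β => by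
    rw [diamond_conj, RCLike.norm_conj]
  have h2 : ∀ α β, ‖diamond (-α) β‖ = ‖diamond α β‖ := fun α β => by
    rw [← h1, diamond_neg, norm_neg]
  rw [← norm_diamond_of_nonneg (abs_nonneg α) (abs_nonneg β)]
  rcases abs_choice α with ha | ha <;> rcases abs_choice β with hb | hb <;>
    rw [ha, hb] <;> simp only [h1, h2]

/-- The norm recovers `|α| + |β|`. The arguments of both sines then lie in `[-π/2, π/2]`, where the
sine is injective. -/
theorem diamond_injective {α β α' β' : ℝ} (h : diamond α β = diamond α' β') :
    α = α' ∧ β = β' := by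
  have hs : |α| + |β| = |α'| + |β'| := by rw [← norm_diamond, h, norm_diamond]
  by_cases h0 : α = 0 ∧ β = 0
  · by_cases h0' : α' = 0 ∧ β' = 0
    · rw [h0.1, h0.2, h0'.1, h0'.2]; simp
    · have := abs_add_abs_pos h0'
      rw [← hs, h0.1, h0.2] at this
      simp at this
  have hp := abs_add_abs_pos h0
  have key : ∀ x, |x| ≤ |α| + |β| → Real.pi * x / (2 * (|α| + |β|)) ∈
      Set.Icc (-(Real.pi / 2)) (Real.pi / 2) := by
    intro x hx
    rw [abs_le] at hx
    have e : Real.pi * x / (2 * (|α| + |β|)) = Real.pi / 2 * (x / (|α| + |β|)) := by field_simp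
    have h1 : x / (|α| + |β|) ≤ 1 := by rw [div_le_one hp]; exact hx.2
    have h2 : -1 ≤ x / (|α| + |β|) := by rw [le_div_iff₀ hp]; linarith [hx.1]
    have hpi := Real.pi_pos
    rw [e]
    constructor <;> nlinarith
  have fin : ∀ x y, |x| ≤ |α| + |β| → |y| ≤ |α| + |β| →
      Real.sin (Real.pi * x / (2 * (|α| + |β|))) = Real.sin (Real.pi * y / (2 * (|α| + |β|))) →
      x = y := by
    intro x y hx hy hxy
    have := Real.injOn_sin (key x hx) (key y hy) hxy
    have hpi := Real.pi_pos.ne'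
    field_simp at this
    exact this
  have hre := congr_arg Complex.re h
  have him := congr_arg Complex.im h
  rw [diamond_re, diamond_re, ← hs] at hre
  rw [diamond_im, diamond_im, ← hs] at him
  refine ⟨fin _ _ ?_ ?_ (mul_left_cancel₀ hp.ne' hre), fin _ _ ?_ ?_ (mul_left_cancel₀ hp.ne' him)⟩
  · linarith [abs_nonneg β]
  · linarith [abs_nonneg β']
  · linarith [abs_nonneg α]
  · linarith [abs_nonneg α']

theorem exists_diamond_eq (w : ℂ) : ∃ α β, diamond α β = w := by
  have h1 : ∀ w : ℂ, 0 ≤ w.re → 0 ≤ w.im → ∃ α β, diamond α β = w := by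
    intro w hr hi
    have ha0 : 0 ≤ w.arg := Complex.arg_nonneg_iff.2 hi
    have ha1 : w.arg ≤ Real.pi / 2 := (Complex.abs_arg_le_pi_div_two_iff.2 hr).trans' (le_abs_self _)
    have hpi := Real.pi_pos
    have hn := norm_nonneg w
    have hb0 : 0 ≤ ‖w‖ * (2 / Real.pi * w.arg) := by positivity
    have hb1 : 2 / Real.pi * w.arg ≤ 1 := by
      rw [div_mul_eq_mul_div, div_le_one hpi]; linarith
    refine ⟨‖w‖ * (1 - 2 / Real.pi * w.arg), ‖w‖ * (2 / Real.pi * w.arg), ?_⟩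
    rw [diamond_of_nonneg (mul_nonneg hn (by linarith)) hb0]
    by_cases hw : w = 0
    · simp [hw]
    have hn' : ‖w‖ ≠ 0 := norm_ne_zero_iff.2 hw
    have e1 : ‖w‖ * (1 - 2 / Real.pi * w.arg) + ‖w‖ * (2 / Real.pi * w.arg) = ‖w‖ := by ring
    have e2 : Real.pi * (‖w‖ * (2 / Real.pi * w.arg)) / (2 * ‖w‖) = w.arg := by field_simp
    rw [e1, e2]
    exact Complex.norm_mul_exp_arg_mul_I w
  have h2 : ∀ w : ℂ, 0 ≤ w.re → ∃ α β, diamond α β = w := by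
    intro w hr
    rcases le_total 0 w.im with hi | hi
    · exact h1 w hr hi
    · obtain ⟨α, β, h⟩ := h1 (conj w) (by simpa using hr) (by simpa using hi)
      exact ⟨α, -β, by rw [diamond_conj, h, Complex.conj_conj]⟩
  rcases le_total 0 w.re with hr | hr
  · exact h2 w hr
  · obtain ⟨α, β, h⟩ := h2 (-w) (by simpa using hr)
    exact ⟨-α, -β, by rw [diamond_neg, h, neg_neg]⟩

/-- At the origin the quotients are not continuous, but the norm formula alone forces the limit to
be zero. -/
theorem continuous_diamond : Continuous fun p : ℝ × ℝ => diamond p.1 p.2 := by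
  rw [continuous_iff_continuousAt]
  rintro ⟨α, β⟩
  by_cases h : α = 0 ∧ β = 0
  · obtain ⟨rfl, rfl⟩ := h
    rw [ContinuousAt, diamond_zero]
    refine squeeze_zero_norm (fun p => (norm_diamond p.1 p.2).le) ?_
    have : Continuous fun p : ℝ × ℝ => |p.1| + |p.2| := by fun_prop
    simpa using this.tendsto (0, 0)
  · have hs := abs_add_abs_pos h
    unfold diamond
    have h1 : ContinuousAt (fun p : ℝ × ℝ => |p.1| + |p.2|) (α, β) := by fun_prop
    have h2 : ∀ f : ℝ × ℝ → ℝ, Continuous f → ContinuousAt (fun p : ℝ × ℝ =>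
        (Real.sin (Real.pi * f p / (2 * (|p.1| + |p.2|))) : ℂ)) (α, β) := by
      intro f hf
      refine Complex.continuous_ofReal.continuousAt.comp
        (Real.continuous_sin.continuousAt.comp (ContinuousAt.div ?_ ?_ ?_))
      · fun_prop
      · fun_prop
      · simp only; positivity
    exact (Complex.continuous_ofReal.continuousAt.comp h1).mul
      ((h2 _ continuous_fst).add (continuousAt_const.mul (h2 _ continuous_snd)))

/-! ### Equality of points of `CP²` -/

theorem mk_eq_mk_of {z w : C3} (hz : z ≠ 0) (hw : w ≠ 0) (t : ℂ) (h : ∀ i, z i = t * w i) :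
    Projectivization.mk ℂ z hz = Projectivization.mk ℂ w hw :=
  (Projectivization.mk_eq_mk_iff' ℂ z w hz hw).2 ⟨t, by ext i; exact (h i).symm⟩

/-- Once the sums of absolute values agree, only a unit scalar remains free. This normalisation lets
absolute values be compared coordinate by coordinate. -/
theorem exists_unit_of_mk_eq {z w : C3} {hz : z ≠ 0} {hw : w ≠ 0}
    (h : Projectivization.mk ℂ z hz = Projectivization.mk ℂ w hw)
    (hs : ∑ i, ‖z i‖ = ∑ i, ‖w i‖) : ∃ t : ℂ, ‖t‖ = 1 ∧ ∀ i, z i = t * w i := by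
  obtain ⟨t, rfl⟩ := (Projectivization.mk_eq_mk_iff' ℂ z w hz hw).1 h
  refine ⟨t, ?_, fun i => rfl⟩
  have h0 : ∑ i, ‖w i‖ ≠ 0 := by
    intro h0
    rw [Finset.sum_eq_zero_iff_of_nonneg fun i _ => norm_nonneg _] at h0
    exact hw (by ext i; exact norm_eq_zero.1 (h0 i (Finset.mem_univ i)))
  simp only [PiLp.smul_apply, smul_eq_mul, norm_mul, ← Finset.mul_sum] at hs
  exact mul_right_cancel₀ h0 (by rw [hs, one_mul])

theorem ne_zero_of_sum_norm {z : C3} (h : ∑ i, ‖z i‖ = 1) : z ≠ 0 := by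
  rintro rfl
  simp at h

/-! ### The model map -/

/-- The phase of the second coordinate of `model`. -/
def phase (x y γ : ℝ) : ℝ := Real.pi * γ / (6 * (1 - x - y))

/-- The map underlying both explicit formulas, symmetric in the second and third coordinates. -/
def model (x y α β γ : ℝ) : C3 :=
  !₂[diamond α β / 3,
    ((x + (1 - x - y) / 2 - (|α| + |β|) / 6 : ℝ) : ℂ) *
      Complex.exp ((phase x y γ : ℂ) * Complex.I),
    ((y + (1 - x - y) / 2 - (|α| + |β|) / 6 : ℝ) : ℂ) *
      Complex.exp ((-phase x y γ : ℝ) * Complex.I)]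

theorem model_zero (x y α β γ : ℝ) : model x y α β γ 0 = diamond α β / 3 := rfl

theorem model_one (x y α β γ : ℝ) :
    model x y α β γ 1 = ((x + (1 - x - y) / 2 - (|α| + |β|) / 6 : ℝ) : ℂ) *
      Complex.exp ((phase x y γ : ℂ) * Complex.I) := rfl

theorem model_two (x y α β γ : ℝ) :
    model x y α β γ 2 = ((y + (1 - x - y) / 2 - (|α| + |β|) / 6 : ℝ) : ℂ) *
      Complex.exp ((-phase x y γ : ℝ) * Complex.I) := rfl

theorem chart_eq_model (x α β γ : ℝ) : chart x α β γ = model 0 x α β γ := by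
  have h : phase 0 x γ = Real.pi * γ / (6 * (1 - x)) := by simp [phase]
  have h1 : (1 - x) / 2 - (|α| + |β|) / 6 = 0 + (1 - 0 - x) / 2 - (|α| + |β|) / 6 := by ring
  have h2 : (1 + x) / 2 - (|α| + |β|) / 6 = x + (1 - 0 - x) / 2 - (|α| + |β|) / 6 := by ring
  ext i
  fin_cases i
  · change (((|α| + |β|) / 3 : ℝ) : ℂ) * _ = diamond α β / 3
    rw [diamond]
    push_cast
    ring
  · change (((1 - x) / 2 - (|α| + |β|) / 6 : ℝ) : ℂ) *
      Complex.exp (Complex.I * ((Real.pi * γ / (6 * (1 - x)) : ℝ) : ℂ)) = model 0 x α β γ 1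
    rw [model_one, h, h1, mul_comm Complex.I]
  · change (((1 + x) / 2 - (|α| + |β|) / 6 : ℝ) : ℂ) *
      Complex.exp (-(Complex.I * ((Real.pi * γ / (6 * (1 - x)) : ℝ) : ℂ))) = model 0 x α β γ 2
    rw [model_two, h, h2, mul_comm Complex.I, Complex.ofReal_neg, neg_mul]

/-- The admissible parameters of `model`. -/
structure Admissible (x y α β : ℝ) : Prop where
  nonneg_left : 0 ≤ x
  nonneg_right : 0 ≤ y
  eq_zero_or : x = 0 ∨ y = 0
  abs_le : |α| + |β| ≤ 1 - x - y

namespace Admissible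

variable {x y α β : ℝ}

theorem e_nonneg (h : Admissible x y α β) : 0 ≤ 1 - x - y :=
  (add_nonneg (abs_nonneg α) (abs_nonneg β)).trans h.abs_le

theorem norm_model_zero (_ : Admissible x y α β) (γ : ℝ) :
    ‖model x y α β γ 0‖ = (|α| + |β|) / 3 := by
  rw [model_zero, norm_div, norm_diamond]
  simp

theorem norm_model_one (h : Admissible x y α β) (γ : ℝ) :
    ‖model x y α β γ 1‖ = x + (1 - x - y) / 2 - (|α| + |β|) / 6 := by
  rw [model_one, norm_mul, Complex.norm_exp_ofReal_mul_I, mul_one, Complex.norm_real,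
    Real.norm_eq_abs, abs_of_nonneg]
  linarith [h.abs_le, h.nonneg_left, h.e_nonneg]

theorem norm_model_two (h : Admissible x y α β) (γ : ℝ) :
    ‖model x y α β γ 2‖ = y + (1 - x - y) / 2 - (|α| + |β|) / 6 := by
  rw [model_two, norm_mul, Complex.norm_exp_ofReal_mul_I, mul_one, Complex.norm_real,
    Real.norm_eq_abs, abs_of_nonneg]
  linarith [h.abs_le, h.nonneg_right, h.e_nonneg]

theorem sum_norm (h : Admissible x y α β) (γ : ℝ) : ∑ i, ‖model x y α β γ i‖ = 1 := by
  rw [Fin.sum_univ_three, h.norm_model_zero, h.norm_model_one, h.norm_model_two]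
  ring

theorem model_ne_zero (h : Admissible x y α β) (γ : ℝ) : model x y α β γ ≠ 0 :=
  ne_zero_of_sum_norm (h.sum_norm γ)

theorem rot (h : Admissible x y α β) : Admissible x y (-β) α :=
  ⟨h.1, h.2, h.3, by rw [abs_neg, add_comm]; exact h.4⟩

theorem zero_zero (h : Admissible x y α β) (he : 1 - x - y = 0) : α = 0 ∧ β = 0 := by
  have := h.abs_le
  rw [he] at this
  constructor
  · exact abs_eq_zero.1 (le_antisymm (by linarith [abs_nonneg β]) (abs_nonneg α))
  · exact abs_eq_zero.1 (le_antisymm (by linarith [abs_nonneg α]) (abs_nonneg β))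

/-- The point of `CP²` given by `model`. -/
def point (h : Admissible x y α β) (γ : ℝ) : CP2 :=
  Projectivization.mk ℂ (model x y α β γ) (h.model_ne_zero γ)

theorem point_eq_iff {x' y' α' β' : ℝ} (h : Admissible x y α β) (h' : Admissible x' y' α' β')
    (γ γ' : ℝ) : h.point γ = h'.point γ' ↔
      ∃ t : ℂ, ‖t‖ = 1 ∧ ∀ i, model x y α β γ i = t * model x' y' α' β' γ' i :=
  ⟨fun e => exists_unit_of_mk_eq e ((h.sum_norm γ).trans (h'.sum_norm γ').symm),
    fun ⟨t, _, e⟩ => mk_eq_mk_of _ _ t e⟩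

/-- The last two coordinates have opposite phases. If `δ` is the difference of the phases of the two
points, the unit scalar is both `exp (iδ)` and `exp (-iδ)`, so `δ` is an integer multiple `m π` and
the scalar is `(-1) ^ m`. The 6 comes from the denominator of `phase`. When `1 - x - y = 0` the
phase carries no information. -/
theorem eq_of_point_eq {x' y' α' β' γ γ' : ℝ} (h : Admissible x y α β)
    (h' : Admissible x' y' α' β') (e : h.point γ = h'.point γ') :
    x = x' ∧ y = y' ∧ (1 - x - y = 0 ∨ ∃ m : ℤ, γ = γ' + 6 * m * (1 - x - y) ∧
      diamond α β = (-1) ^ m * diamond α' β') := by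
  obtain ⟨t, ht, H⟩ := (h.point_eq_iff h' γ γ').1 e
  have n0 := congr_arg norm (H 0)
  have n1 := congr_arg norm (H 1)
  rw [norm_mul, ht, one_mul, h.norm_model_zero, h'.norm_model_zero] at n0
  rw [norm_mul, ht, one_mul, h.norm_model_one, h'.norm_model_one] at n1
  -- The absolute values give `|α| + |β|` and `x - y`; since `x` or `y` vanishes, the difference
  -- determines both.
  have hxy : x = x' ∧ y = y' := by
    have := h.nonneg_left
    have := h.nonneg_right
    have := h'.nonneg_left
    have := h'.nonneg_right
    rcases h.eq_zero_or with hx | hx <;> rcases h'.eq_zero_or with hx' | hx' <;>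
      constructor <;> linarith
  obtain ⟨rfl, rfl⟩ := hxy
  refine ⟨rfl, rfl, ?_⟩
  by_cases he : 1 - x - y = 0
  · exact Or.inl he
  right
  have hs : |α| + |β| = |α'| + |β'| := by linarith
  have hep : 0 < 1 - x - y := lt_of_le_of_ne h.e_nonneg (Ne.symm he)
  have m1 : ((x + (1 - x - y) / 2 - (|α'| + |β'|) / 6 : ℝ) : ℂ) ≠ 0 := by
    rw [Complex.ofReal_ne_zero]
    linarith [h'.abs_le, h.nonneg_left]
  have m2 : ((y + (1 - x - y) / 2 - (|α'| + |β'|) / 6 : ℝ) : ℂ) ≠ 0 := by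
    rw [Complex.ofReal_ne_zero]
    linarith [h'.abs_le, h.nonneg_right]
  have H1 := H 1
  have H2 := H 2
  rw [model_one, model_one, hs, mul_left_comm] at H1
  rw [model_two, model_two, hs, mul_left_comm] at H2
  replace H1 := mul_left_cancel₀ m1 H1
  replace H2 := mul_left_cancel₀ m2 H2
  have ht1 : t = Complex.exp (((phase x y γ - phase x y γ' : ℝ) : ℂ) * Complex.I) := by
    rw [Complex.ofReal_sub, sub_mul, Complex.exp_sub, H1, mul_div_assoc,
      div_self (Complex.exp_ne_zero _), mul_one]
  have ht2 : t = Complex.exp (-(((phase x y γ - phase x y γ' : ℝ) : ℂ) * Complex.I)) := by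
    have : -(((phase x y γ - phase x y γ' : ℝ) : ℂ) * Complex.I) =
      ((-phase x y γ : ℝ) : ℂ) * Complex.I - ((-phase x y γ' : ℝ) : ℂ) * Complex.I := by
      push_cast; ring
    rw [this, Complex.exp_sub, H2, mul_div_assoc, div_self (Complex.exp_ne_zero _), mul_one]
  obtain ⟨m, hm⟩ := Complex.exp_eq_exp_iff_exists_int.1 (ht1.symm.trans ht2)
  have hm' : phase x y γ - phase x y γ' = m * Real.pi := by
    have h2 : ((phase x y γ - phase x y γ' : ℝ) : ℂ) = (m * Real.pi : ℝ) := by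
      apply mul_right_cancel₀ Complex.I_ne_zero
      push_cast at hm ⊢
      linear_combination hm / 2
    exact_mod_cast h2
  refine ⟨m, ?_, ?_⟩
  · rw [phase, phase, ← sub_div, div_eq_iff (by positivity)] at hm'
    apply mul_left_cancel₀ Real.pi_pos.ne'
    linear_combination hm'
  · have H0 := H 0
    rw [model_zero, model_zero] at H0
    have htm : t = (-1) ^ m := by
      rw [ht1, hm', ← Complex.exp_pi_mul_I, ← Complex.exp_int_mul]
      push_cast
      ring_nf
    rw [← htm]
    linear_combination 3 * H0

/-- At a vertex of the moment triangle the phase does not matter. -/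
theorem point_congr (h : Admissible x y α β) (he : 1 - x - y = 0) (γ γ' : ℝ) :
    h.point γ = h.point γ' := by
  have : ∀ γ, phase x y γ = 0 := fun γ => by rw [phase, he]; simp
  rw [point_eq_iff]
  refine ⟨1, by simp, fun i => ?_⟩
  rw [one_mul]
  fin_cases i
  · rfl
  · change model x y α β γ 1 = model x y α β γ' 1
    rw [model_one, model_one, this, this]
  · change model x y α β γ 2 = model x y α β γ' 2
    rw [model_two, model_two, this, this]

theorem point_congr' {x' y' α' β' γ γ' : ℝ} (h : Admissible x y α β)
    (h' : Admissible x' y' α' β') (hx : x = x') (hy : y = y') (hα : α = α') (hβ : β = β')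
    (hγ : γ = γ') : h.point γ = h'.point γ' := by
  subst hx hy hα hβ hγ
  rfl

end Admissible

/-! ### Generators of the group and their action on the model -/

/-- The element of order 6 that translates the windows. -/
def gT : G := (kleinElt 1, finRotate 3)

/-- The element `((14)(23), e)`. -/
def gNeg : G := (kleinElt 0, 1)

/-- The element `(e, (12))`. -/
def gConj : G := (1, Equiv.swap 0 1)

/-- The element `((23), e)`. -/
def gSwap : G := (Equiv.swap 1 2, 1)

/-- An element of order 3 that permutes the three homogeneous coordinates cyclically. -/
def gRot : G := (Equiv.swap 1 3 * Equiv.swap 1 2, finRotate 3)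

theorem lift_gT (z : C3) : (lift gT).1 z 0 = -z 0 ∧ (lift gT).1 z 1 = omega * z 1 ∧
    (lift gT).1 z 2 = -(omega ^ 2 * z 2) := by
  have hs : Equiv.Perm.sign gT.1 = 1 := by decide
  have hs' : Equiv.Perm.sign gT.2 = 1 := by decide
  have h2 : gT.2 2 = 0 := by decide
  refine ⟨?_, ?_, ?_⟩
  · rw [lift_apply_of (k := 0) (s := -1) (by decide), hs, hs', h2]; simp [conjPow_one]
  · rw [lift_apply_of (k := 1) (s := 1) (by decide), hs, hs', h2]; simp [conjPow_one]
  · rw [lift_apply_of (k := 2) (s := -1) (by decide), hs, hs', h2]; simp [conjPow_one]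

theorem lift_gNeg (z : C3) : (lift gNeg).1 z 0 = z 0 ∧ (lift gNeg).1 z 1 = -z 1 ∧
    (lift gNeg).1 z 2 = -z 2 := by
  have hs : Equiv.Perm.sign gNeg.1 = 1 := by decide
  have hs' : Equiv.Perm.sign gNeg.2 = 1 := by decide
  have h2 : gNeg.2 2 = 2 := by decide
  have h3 : omega ^ (3 * 2) = 1 := by rw [pow_mul, omega_pow_three, one_pow]
  refine ⟨?_, ?_, ?_⟩
  · rw [lift_apply_of (k := 0) (s := 1) (by decide), hs, hs', h2]; simp [conjPow_one]
  · rw [lift_apply_of (k := 1) (s := -1) (by decide), hs, hs', h2]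
    simp [conjPow_one, omega_pow_three]
  · rw [lift_apply_of (k := 2) (s := -1) (by decide), hs, hs', h2]; simp [conjPow_one, h3]

theorem lift_gConj (z : C3) (i : Fin 3) : (lift gConj).1 z i = conj (z i) := by
  have hs : Equiv.Perm.sign gConj.1 = 1 := by decide
  have hs' : Equiv.Perm.sign gConj.2 = -1 := by decide
  have h2 : gConj.2 2 = 2 := by decide
  rw [lift_apply_of (k := i) (s := 1) (by revert i; decide), hs, hs', h2, pow_mul,
    show (2 : Fin 3).val + 1 = 3 from rfl, omega_pow_three]
  simp [conjPow_one, conjPow_neg_one]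

theorem lift_gSwap (z : C3) : (lift gSwap).1 z 0 = conj (z 0) ∧ (lift gSwap).1 z 1 = conj (z 2) ∧
    (lift gSwap).1 z 2 = conj (z 1) := by
  have hs : Equiv.Perm.sign gSwap.1 = -1 := by decide
  have hs' : Equiv.Perm.sign gSwap.2 = 1 := by decide
  have h2 : gSwap.2 2 = 2 := by decide
  refine ⟨?_, ?_, ?_⟩
  · rw [lift_apply_of (k := 0) (s := 1) (by decide), hs, hs', h2, pow_mul,
      show (2 : Fin 3).val + 1 = 3 from rfl, omega_pow_three]
    simp [conjPow_one, conjPow_neg_one]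
  · rw [lift_apply_of (k := 2) (s := 1) (by decide), hs, hs', h2, pow_mul,
      show (2 : Fin 3).val + 1 = 3 from rfl, omega_pow_three]
    simp [conjPow_one, conjPow_neg_one]
  · rw [lift_apply_of (k := 1) (s := 1) (by decide), hs, hs', h2, pow_mul,
      show (2 : Fin 3).val + 1 = 3 from rfl, omega_pow_three]
    simp [conjPow_one, conjPow_neg_one]

theorem lift_gRot (z : C3) : (lift gRot).1 z 0 = -(omega * z 1) ∧
    (lift gRot).1 z 1 = omega ^ 2 * z 2 ∧ (lift gRot).1 z 2 = -z 0 := by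
  have hs : Equiv.Perm.sign gRot.1 = 1 := by decide
  have hs' : Equiv.Perm.sign gRot.2 = 1 := by decide
  have h2 : gRot.2 2 = 0 := by decide
  refine ⟨?_, ?_, ?_⟩
  · rw [lift_apply_of (k := 1) (s := -1) (by decide), hs, hs', h2]; simp [conjPow_one]
  · rw [lift_apply_of (k := 2) (s := 1) (by decide), hs, hs', h2]; simp [conjPow_one]
  · rw [lift_apply_of (k := 0) (s := -1) (by decide), hs, hs', h2]; simp [conjPow_one]

/-- The unit complex number with argument `aπ/6`. -/
def cis (a : ℝ) : ℂ := Complex.exp ((Real.pi / 6 * a : ℝ) * Complex.I)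

theorem cis_mul_cis (a b : ℝ) : cis a * cis b = cis (a + b) := by
  rw [cis, cis, cis, ← Complex.exp_add]
  congr 1
  push_cast
  ring

theorem I_eq_cis : Complex.I = cis 3 := by
  rw [cis, show ((Real.pi / 6 * 3 : ℝ) : ℂ) * Complex.I = Real.pi / 2 * Complex.I by
    push_cast; ring, Complex.exp_pi_div_two_mul_I]

theorem omega_eq_cis : omega = cis 4 := by
  rw [omega, cis]
  congr 1
  push_cast
  ring

theorem neg_eq_cis (z : ℂ) : -z = cis 6 * z := by
  rw [cis, show ((Real.pi / 6 * 6 : ℝ) : ℂ) * Complex.I = Real.pi * Complex.I by push_cast; ring,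
    Complex.exp_pi_mul_I, neg_one_mul]

theorem cis_congr {a b : ℝ} (k : ℤ) (h : a = b + 12 * k) : cis a = cis b := by
  rw [cis, cis, Complex.exp_eq_exp_iff_exists_int]
  refine ⟨k, ?_⟩
  rw [h]
  push_cast
  ring

theorem conj_cis (a : ℝ) : conj (cis a) = cis (-a) := by
  rw [cis, cis, ← Complex.exp_conj, map_mul, Complex.conj_ofReal, Complex.conj_I]
  congr 1
  push_cast
  ring

theorem model_one_cis (x y α β γ : ℝ) :
    model x y α β γ 1 = ((x + (1 - x - y) / 2 - (|α| + |β|) / 6 : ℝ) : ℂ) *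
      cis (γ / (1 - x - y)) := by
  rw [model_one, phase, mul_div_mul_comm, cis]

theorem model_two_cis (x y α β γ : ℝ) :
    model x y α β γ 2 = ((y + (1 - x - y) / 2 - (|α| + |β|) / 6 : ℝ) : ℂ) *
      cis (-(γ / (1 - x - y))) := by
  rw [model_two, phase, mul_div_mul_comm, cis, mul_neg]

theorem diamond_cis {α β : ℝ} (hα : 0 ≤ α) (hβ : 0 ≤ β) :
    diamond α β = ((α + β : ℝ) : ℂ) * cis (3 * β / (α + β)) := by
  rw [diamond_of_nonneg hα hβ, cis]
  congr 4
  rw [mul_div_mul_comm]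
  ring

namespace Admissible

variable {x y α β : ℝ}

theorem act_point {x' y' α' β' γ γ' : ℝ} (h : Admissible x y α β)
    (h' : Admissible x' y' α' β') (g : G) (t : ℂ)
    (H : ∀ i, (lift g).1 (model x y α β γ) i = t * model x' y' α' β' γ' i) :
    act (RHom g) (h.point γ) = h'.point γ' :=
  (act_RHom_mk g _ _).trans (mk_eq_mk_of _ _ t H)

/-- After the common factor `i = cis 3` is removed, `gT` turns the first coordinate by a right angle
and moves the phases of the other two by `±π/6`, which amounts to a shift of `γ` by `1 - x - y`. -/
theorem act_gT (h : Admissible x y α β) (γ : ℝ) :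
    act (RHom gT) (h.point γ) = h.rot.point (γ + (1 - x - y)) := by
  by_cases he : 1 - x - y = 0
  · obtain ⟨rfl, rfl⟩ := h.zero_zero he
    rw [h.point_congr he γ 0, h.rot.point_congr he _ 0]
    rcases h.eq_zero_or with rfl | rfl
    · obtain rfl : y = 1 := by linarith
      -- Only the third coordinate survives here, so the scalar is its multiplier under `gT`.
      refine act_point _ _ _ (-omega ^ 2) fun i => ?_
      obtain ⟨h0, h1, h2⟩ := lift_gT (model 0 1 0 0 0)
      fin_cases i
      · exact h0.trans (by simp [model_zero, diamond_zero])
      · exact h1.trans (by simp [model_one])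
      · exact h2.trans (by simp [model_two])
    · obtain rfl : x = 1 := by linarith
      refine act_point _ _ _ omega fun i => ?_
      obtain ⟨h0, h1, h2⟩ := lift_gT (model 1 0 0 0 0)
      fin_cases i
      · exact h0.trans (by simp [model_zero, diamond_zero])
      · exact h1.trans (by simp [model_one])
      · exact h2.trans (by simp [model_two])
  · have hp : (γ + (1 - x - y)) / (1 - x - y) = γ / (1 - x - y) + 1 := by
      rw [add_div, div_self he]
    refine act_point _ _ _ (cis 3) fun i => ?_
    obtain ⟨h0, h1, h2⟩ := lift_gT (model x y α β γ)
    fin_cases i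
    · refine h0.trans ?_
      change _ = _ * model x y (-β) α _ 0
      rw [model_zero, model_zero, diamond_rot, ← I_eq_cis]
      linear_combination (-diamond α β / 3) * Complex.I_mul_I
    · refine h1.trans ?_
      change _ = _ * model x y (-β) α _ 1
      rw [model_one_cis, model_one_cis, hp, abs_neg, add_comm |β|, mul_left_comm,
        mul_left_comm (cis 3), omega_eq_cis, cis_mul_cis, cis_mul_cis]
      congr 2
      ring
    · refine h2.trans ?_
      change _ = _ * model x y (-β) α _ 2
      rw [model_two_cis, model_two_cis, hp, abs_neg, add_comm |β|, mul_left_comm,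
        mul_left_comm (cis 3), omega_eq_cis, ← mul_neg, neg_eq_cis, sq, cis_mul_cis, cis_mul_cis,
        cis_mul_cis, cis_mul_cis]
      congr 1
      exact cis_congr 1 (by push_cast; ring)

theorem neg (h : Admissible x y α β) : Admissible x y (-α) (-β) := h.rot.rot

theorem act_gNeg (h : Admissible x y α β) (γ : ℝ) :
    act (RHom gNeg) (h.point γ) = h.neg.point γ := by
  refine act_point _ _ _ (-1) fun i => ?_
  obtain ⟨h0, h1, h2⟩ := lift_gNeg (model x y α β γ)
  fin_cases i
  · refine h0.trans ?_
    change _ = -1 * model x y (-α) (-β) γ 0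
    rw [model_zero, model_zero, diamond_neg]
    ring
  · refine h1.trans ?_
    change _ = -1 * model x y (-α) (-β) γ 1
    rw [model_one, model_one, abs_neg, abs_neg]
    ring
  · refine h2.trans ?_
    change _ = -1 * model x y (-α) (-β) γ 2
    rw [model_two, model_two, abs_neg, abs_neg]
    ring

theorem reflect (h : Admissible x y α β) : Admissible x y α (-β) :=
  ⟨h.1, h.2, h.3, by rw [abs_neg]; exact h.4⟩

theorem act_gConj (h : Admissible x y α β) (γ : ℝ) :
    act (RHom gConj) (h.point γ) = h.reflect.point (-γ) := by
  refine act_point _ _ _ 1 fun i => ?_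
  rw [lift_gConj, one_mul]
  fin_cases i
  · change conj (model x y α β γ 0) = model x y α (-β) (-γ) 0
    rw [model_zero, model_zero, diamond_conj, map_div₀, Complex.conj_ofNat]
  · change conj (model x y α β γ 1) = model x y α (-β) (-γ) 1
    rw [model_one_cis, model_one_cis, map_mul, conj_cis, neg_div, Complex.conj_ofReal, abs_neg]
  · change conj (model x y α β γ 2) = model x y α (-β) (-γ) 2
    rw [model_two_cis, model_two_cis, map_mul, conj_cis, neg_div, Complex.conj_ofReal, abs_neg]

theorem swap (h : Admissible x y α β) : Admissible y x α (-β) :=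
  ⟨h.2, h.1, h.3.symm, by rw [abs_neg]; linarith [h.4]⟩

theorem act_gSwap (h : Admissible x y α β) (γ : ℝ) :
    act (RHom gSwap) (h.point γ) = h.swap.point γ := by
  have hp : 1 - y - x = 1 - x - y := sub_right_comm _ _ _
  refine act_point _ _ _ 1 fun i => ?_
  obtain ⟨h0, h1, h2⟩ := lift_gSwap (model x y α β γ)
  rw [one_mul]
  fin_cases i
  · refine h0.trans ?_
    change _ = model y x α (-β) γ 0
    rw [model_zero, model_zero, diamond_conj, map_div₀, Complex.conj_ofNat]
  · refine h1.trans ?_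
    change _ = model y x α (-β) γ 1
    rw [model_two_cis, model_one_cis, map_mul, conj_cis, Complex.conj_ofReal, abs_neg, hp, neg_neg]
  · refine h2.trans ?_
    change _ = model y x α (-β) γ 2
    rw [model_two_cis, model_one_cis, map_mul, conj_cis, Complex.conj_ofReal, abs_neg, hp]

/-- The action of `gRot` on a triangle of the torus joined with a vertex. -/
theorem act_gRot {y a b c : ℝ} (ha : 0 ≤ a) (hb : 0 ≤ b) (hc : 0 ≤ c) (hs : y + a + b + c = 1)
    (h : Admissible 0 y a (b + c)) (h' : Admissible y 0 c (a + b)) :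
    act (RHom gRot) (h.point (b - c)) = h'.point (a - b) := by
  obtain ⟨h0, h1, h2⟩ := lift_gRot (model 0 y a (b + c) (b - c))
  by_cases he : a + b + c = 0
  · obtain rfl : y = 1 := by linarith
    obtain rfl : a = 0 := by linarith
    obtain rfl : b = 0 := by linarith
    obtain rfl : c = 0 := by linarith
    refine act_point _ _ _ (omega ^ 2) fun i => ?_
    fin_cases i
    · refine h0.trans ?_
      simp [model_zero, model_one, diamond_zero]
    · refine h1.trans ?_
      simp [model_one_cis, model_two_cis]
    · refine h2.trans ?_
      simp [model_zero, model_two, diamond_zero]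
  · have e1 : 1 - 0 - y = a + b + c := by linarith
    have e2 : 1 - y - 0 = a + b + c := by linarith
    have d0 : diamond a (b + c) = ((a + b + c : ℝ) : ℂ) * cis (3 * (b + c) / (a + b + c)) := by
      rw [diamond_cis ha (add_nonneg hb hc), add_assoc]
    have d1 : diamond c (a + b) = ((a + b + c : ℝ) : ℂ) * cis (3 * (a + b) / (a + b + c)) := by
      rw [diamond_cis hc (add_nonneg ha hb), add_comm c]
    have a1 : |a| + |b + c| = a + b + c := by
      rw [abs_of_nonneg ha, abs_of_nonneg (add_nonneg hb hc), add_assoc]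
    have a2 : |c| + |a + b| = a + b + c := by
      rw [abs_of_nonneg hc, abs_of_nonneg (add_nonneg ha hb), add_comm]
    -- On such a triangle all phases are affine in `(a, b, c) / (a + b + c)`. This scalar is the
    -- quotient of the phases of the two first coordinates, simplified by `a + b + c` over itself
    -- being 1.
    refine act_point _ _ _ (cis (9 - (2 * a + b) / (a + b + c))) fun i => ?_
    fin_cases i
    · refine h0.trans ?_
      change _ = _ * model y 0 c (a + b) (a - b) 0
      rw [model_zero, model_one_cis, e1, a1, d1, neg_eq_cis, omega_eq_cis,
        show ((0 + (a + b + c) / 2 - (a + b + c) / 6 : ℝ) : ℂ) = ((a + b + c : ℝ) : ℂ) / 3 by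
          push_cast; ring,
        mul_left_comm, mul_left_comm (cis 4), mul_div_right_comm, mul_left_comm (cis (9 - _)),
        mul_comm (cis 4), mul_comm (cis 6), mul_assoc, mul_assoc, cis_mul_cis, cis_mul_cis,
        cis_mul_cis]
      congr 2
      field_simp
      ring
    · refine h1.trans ?_
      change _ = _ * model y 0 c (a + b) (a - b) 1
      rw [model_one_cis, model_two_cis, e1, e2, a1, a2, omega_eq_cis, sq,
        mul_left_comm, mul_left_comm (cis (9 - _)), cis_mul_cis, cis_mul_cis, cis_mul_cis]
      congr 2
      field_simp
      ring
    · refine h2.trans ?_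
      change _ = _ * model y 0 c (a + b) (a - b) 2
      rw [model_zero, model_two_cis, e2, a2, d0, neg_eq_cis,
        show ((0 + (a + b + c) / 2 - (a + b + c) / 6 : ℝ) : ℂ) = ((a + b + c : ℝ) : ℂ) / 3 by
          push_cast; ring,
        mul_div_right_comm, mul_left_comm, mul_left_comm (cis (9 - _)), cis_mul_cis, cis_mul_cis]
      congr 2
      field_simp
      ring

end Admissible

/-! ### The action on barycentric coordinates -/

/-- The action of `S₄ × S₃` on barycentric coordinates. -/
def mv (h : G) (p : Vertex → ℝ) : Vertex → ℝ := fun v => p ((vertexPerm h).symm v)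

theorem mv_one (p : Vertex → ℝ) : mv 1 p = p := by
  funext v
  rw [mv, map_one]
  rfl

theorem mv_mul (h k : G) (p : Vertex → ℝ) : mv (h * k) p = mv h (mv k p) := by
  funext v
  simp only [mv, map_mul]
  rfl

theorem mv_act (h : G) (p : Vertex → ℝ) (v : Vertex) : mv h p (vertexAct h v) = p v := by
  rw [mv, ← vertexPerm_apply, Equiv.symm_apply_apply]

theorem mv_eq_iff {h : G} {p q : Vertex → ℝ} : mv h p = q ↔ ∀ v, p v = q (vertexAct h v) := by
  constructor
  · rintro rfl v
    rw [mv_act]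
  · intro H
    funext v
    obtain ⟨w, rfl⟩ := (vertexPerm h).surjective v
    rw [vertexPerm_apply, mv_act, H]

theorem mv_inv_mv (h : G) (p : Vertex → ℝ) : mv h⁻¹ (mv h p) = p := by
  rw [← mv_mul, inv_mul_cancel, mv_one]

theorem mv_mv_inv (h : G) (p : Vertex → ℝ) : mv h (mv h⁻¹ p) = p := by
  rw [← mv_mul, mul_inv_cancel, mv_one]

theorem sum_mv (h : G) (p : Vertex → ℝ) : ∑ v, mv h p v = ∑ v, p v :=
  Equiv.sum_comp (vertexPerm h).symm p

theorem mv_mem_realization (h : G) {p : Vertex → ℝ} (hp : p ∈ realization X) :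
    mv h p ∈ realization X :=
  (realize (K := X) ⟨vertexPerm h, vertexPerm_mem_Sym h⟩ ⟨p, hp⟩).2

theorem forall_vertex {P : Vertex → Prop} : (∀ v, P v) ↔
    (∀ j, P (Sum.inl (klein j))) ∧ ∀ a n, P (Sum.inr (a, n)) := by
  constructor
  · intro h
    exact ⟨fun j => h _, fun a n => h _⟩
  · rintro ⟨h1, h2⟩ (ν | ⟨a, n⟩)
    · obtain ⟨j, rfl⟩ := klein_surjective ν
      exact h1 j
    · exact h2 a n

theorem sum_vertex (p : Vertex → ℝ) :
    ∑ v, p v = (∑ j, p (Sum.inl (klein j))) + ∑ a, ∑ n, p (Sum.inr (a, n)) := by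
  rw [Fintype.sum_sum_type, Fintype.sum_prod_type]
  congr 1
  symm
  exact Equiv.sum_comp (Equiv.ofBijective klein
    ⟨klein_injective, fun ν => (klein_surjective ν).imp fun _ h => h.symm⟩) fun ν => p (Sum.inl ν)

theorem vertexAct_klein {h : G} {j k : Fin 3} (e : h.1 * kleinElt j * h.1⁻¹ = kleinElt k) :
    vertexAct h (Sum.inl (klein j)) = Sum.inl (klein k) :=
  congr_arg Sum.inl (Subtype.ext e)

/-! ### The window -/

/-- Barycentric coordinates of the points of the part of `X` on which `model` gives `f`: the join of
the vertices `(13)(24)`, `(12)(34)` with the star of the edge `(1, 3)(4, 3)` in a solid torus. -/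
structure Window (p : Vertex → ℝ) : Prop where
  nonneg : ∀ v, 0 ≤ p v
  sum_eq : ∑ v, p v = 1
  zero_klein : p (Sum.inl (klein 0)) = 0
  zero_one : ∀ n : Fin 3, n ≠ 2 → p (Sum.inr (0, n)) = 0
  zero_four : ∀ n : Fin 3, n ≠ 2 → p (Sum.inr (3, n)) = 0
  zero_two : p (Sum.inr (1, 2)) = 0
  zero_three : p (Sum.inr (2, 2)) = 0
  klein_or : p (Sum.inl (klein 1)) = 0 ∨ p (Sum.inl (klein 2)) = 0
  two_or : p (Sum.inr (1, 0)) = 0 ∨ p (Sum.inr (1, 1)) = 0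
  three_or : p (Sum.inr (2, 0)) = 0 ∨ p (Sum.inr (2, 1)) = 0

/-- The parameter `α` of `model`. -/
def alpha (p : Vertex → ℝ) : ℝ := p (Sum.inr (3, 2)) - p (Sum.inr (0, 2))

/-- The parameter `β` of `model`. -/
def beta (p : Vertex → ℝ) : ℝ :=
  p (Sum.inr (1, 0)) - p (Sum.inr (2, 0)) + p (Sum.inr (2, 1)) - p (Sum.inr (1, 1))

/-- The parameter `γ` of `model`. -/
def gamma (p : Vertex → ℝ) : ℝ :=
  p (Sum.inr (1, 0)) + p (Sum.inr (2, 0)) - p (Sum.inr (2, 1)) - p (Sum.inr (1, 1))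

/-- The map `model` in barycentric coordinates. -/
def windowMap (p : Vertex → ℝ) : C3 :=
  model (p (Sum.inl (klein 1))) (p (Sum.inl (klein 2))) (alpha p) (beta p) (gamma p)

theorem realization_eq_zero_or {p : Vertex → ℝ} (hp : p ∈ realization X) {v w : Vertex}
    (h : {v, w} ∉ X.faces) : p v = 0 ∨ p w = 0 := by
  obtain ⟨-, -, σ, hσ, hs⟩ := hp
  by_contra! hc
  exact h ((X.isRelLowerSet_faces hσ).2
    (Finset.insert_subset (hs v hc.1) (Finset.singleton_subset_iff.2 (hs w hc.2)))
    (Finset.insert_nonempty _ _))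

/-- The vertices outside the window. -/
def outside : List Vertex :=
  [Sum.inl (klein 0), Sum.inr (0, 0), Sum.inr (0, 1), Sum.inr (3, 0), Sum.inr (3, 1),
    Sum.inr (1, 2), Sum.inr (2, 2)]

theorem Window.of_mem {p : Vertex → ℝ} (hp : p ∈ realization X) (h : ∀ v ∈ outside, p v = 0) :
    Window p where
  nonneg := hp.1
  sum_eq := hp.2.1
  zero_klein := h _ (by simp [outside])
  zero_one n hn := by
    fin_cases n
    · exact h _ (by simp [outside])
    · exact h _ (by simp [outside])
    · exact absurd rfl hn
  zero_four n hn := by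
    fin_cases n
    · exact h _ (by simp [outside])
    · exact h _ (by simp [outside])
    · exact absurd rfl hn
  zero_two := h _ (by simp [outside])
  zero_three := h _ (by simp [outside])
  klein_or := realization_eq_zero_or hp fun h =>
    absurd (klein_injective (inl_inl_mem_faces.1 h)) (by decide)
  two_or := realization_eq_zero_or hp fun h => absurd (inr_inr_mem_faces.1 h rfl) (by decide)
  three_or := realization_eq_zero_or hp fun h => absurd (inr_inr_mem_faces.1 h rfl) (by decide)

theorem mem_realization_of_facet {p : Vertex → ℝ} (h0 : ∀ v, 0 ≤ p v) (h1 : ∑ v, p v = 1)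
    (j : Fin 3) (b : Fin 4 → Fin 3) (hb : ∀ a, b (kleinElt j a) ≠ b a)
    (hj : ∀ k, k ≠ j → p (Sum.inl (klein k)) = 0)
    (hbn : ∀ a n, n ≠ b a → p (Sum.inr (a, n)) = 0) : p ∈ realization X := by
  refine ⟨h0, h1, facet (klein j) b, ⟨⟨_, Finset.mem_insert_self _ _⟩, klein j, b, hb,
    subset_rfl⟩, ?_⟩
  rw [forall_vertex]
  constructor
  · intro k hk
    rw [inl_mem_facet]
    by_contra hne
    exact hk (hj k fun h => hne (by rw [h]))
  · intro a n hn
    rw [inr_mem_facet]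
    by_contra hne
    exact hn (hbn a n (Ne.symm hne))

namespace Window

variable {p q : Vertex → ℝ}

theorem mem_realization (h : Window p) : p ∈ realization X := by
  obtain ⟨j, hj1, hj⟩ : ∃ j : Fin 3, (j = 1 ∨ j = 2) ∧
      ∀ k, k ≠ j → p (Sum.inl (klein k)) = 0 := by
    rcases h.klein_or with e | e
    · refine ⟨2, Or.inr rfl, fun k hk => ?_⟩
      fin_cases k
      · exact h.zero_klein
      · exact e
      · exact absurd rfl hk
    · refine ⟨1, Or.inl rfl, fun k hk => ?_⟩
      fin_cases k
      · exact h.zero_klein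
      · exact absurd rfl hk
      · exact e
  obtain ⟨m, hm2, hm⟩ : ∃ m : Fin 3, m ≠ 2 ∧ ∀ n, n ≠ m → p (Sum.inr (1, n)) = 0 := by
    rcases h.two_or with e | e
    · refine ⟨1, by decide, fun k hk => ?_⟩
      fin_cases k
      · exact e
      · exact absurd rfl hk
      · exact h.zero_two
    · refine ⟨0, by decide, fun k hk => ?_⟩
      fin_cases k
      · exact absurd rfl hk
      · exact e
      · exact h.zero_two
  obtain ⟨l, hl2, hl⟩ : ∃ l : Fin 3, l ≠ 2 ∧ ∀ n, n ≠ l → p (Sum.inr (2, n)) = 0 := by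
    rcases h.three_or with e | e
    · refine ⟨1, by decide, fun k hk => ?_⟩
      fin_cases k
      · exact e
      · exact absurd rfl hk
      · exact h.zero_three
    · refine ⟨0, by decide, fun k hk => ?_⟩
      fin_cases k
      · exact absurd rfl hk
      · exact e
      · exact h.zero_three
  refine mem_realization_of_facet h.nonneg h.sum_eq j ![2, m, l, 2] ?_ hj ?_
  · clear hm hl hj
    revert j m l
    decide
  · intro a
    fin_cases a
    · exact h.zero_one
    · exact hm
    · exact hl
    · exact h.zero_four

theorem sum_expand (h : Window p) :
    p (Sum.inr (3, 2)) + p (Sum.inr (0, 2)) + p (Sum.inr (1, 0)) + p (Sum.inr (2, 0)) +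
      p (Sum.inr (2, 1)) + p (Sum.inr (1, 1)) =
        1 - p (Sum.inl (klein 1)) - p (Sum.inl (klein 2)) := by
  have := h.sum_eq
  rw [sum_vertex] at this
  simp only [Fin.sum_univ_three, Fin.sum_univ_four, h.zero_klein, h.zero_two, h.zero_three,
    h.zero_one 0 (by decide), h.zero_one 1 (by decide), h.zero_four 0 (by decide),
    h.zero_four 1 (by decide)] at this
  linarith

theorem admissible (h : Window p) :
    Admissible (p (Sum.inl (klein 1))) (p (Sum.inl (klein 2))) (alpha p) (beta p) where
  nonneg_left := h.nonneg _
  nonneg_right := h.nonneg _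
  eq_zero_or := h.klein_or
  abs_le := by
    rw [← h.sum_expand]
    have h1 : |alpha p| ≤ p (Sum.inr (3, 2)) + p (Sum.inr (0, 2)) := by
      rw [abs_le, alpha]
      constructor <;> linarith [h.nonneg (Sum.inr (3, 2)), h.nonneg (Sum.inr (0, 2))]
    have h2 : |beta p| ≤ p (Sum.inr (1, 0)) + p (Sum.inr (2, 0)) +
      p (Sum.inr (2, 1)) + p (Sum.inr (1, 1)) := by
      rw [abs_le, beta]
      constructor <;> linarith [h.nonneg (Sum.inr (1, 0)), h.nonneg (Sum.inr (2, 0)),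
        h.nonneg (Sum.inr (2, 1)), h.nonneg (Sum.inr (1, 1))]
    linarith

theorem abs_gamma_le (h : Window p) :
    |gamma p| ≤ 1 - p (Sum.inl (klein 1)) - p (Sum.inl (klein 2)) := by
  rw [← h.sum_expand, abs_le, gamma]
  constructor <;> linarith [h.nonneg (Sum.inr (1, 0)), h.nonneg (Sum.inr (2, 0)),
    h.nonneg (Sum.inr (2, 1)), h.nonneg (Sum.inr (1, 1)), h.nonneg (Sum.inr (3, 2)),
    h.nonneg (Sum.inr (0, 2))]

/-- The image in `CP²` of a point of the window. -/
def point (h : Window p) : CP2 := h.admissible.point (gamma p)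

theorem point_congr (h : Window p) (h' : Window q) (e : p = q) : h.point = h'.point := by
  subst e
  rfl

end Window

/-- The correspondence between points of the window is that between their images. -/
def Compatible (h : G) : Prop :=
  ∀ p q (hp : Window p) (hq : Window q), mv h p = q ↔ act (RHom h) hp.point = hq.point

theorem Compatible.inv {h : G} (H : Compatible h) : Compatible h⁻¹ := by
  intro p q hp hq
  have := H q p hq hp
  rw [map_inv, map_inv, Equiv.Perm.inv_eq_iff_eq, ← eq_comm (b := hp.point), ← this]
  constructor
  · rintro rfl
    exact mv_mv_inv _ _
  · rintro rfl
    exact mv_inv_mv _ _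

/-- `k` preserves the window and the map on it. -/
def Preserves (k : G) : Prop :=
  ∀ p (hp : Window p), ∃ hq : Window (mv k p), act (RHom k) hp.point = hq.point

theorem act_mul (h k : G) (x : CP2) : act (RHom (h * k)) x = act (RHom h) (act (RHom k) x) := by
  rw [map_mul, map_mul, Equiv.Perm.mul_apply]

/-- Compatibility thus has to be checked only on representatives of the cosets of the elements that
preserve the window. -/
theorem Compatible.mul {h k : G} (H : Compatible h) (K : Preserves k) : Compatible (h * k) := by
  intro p q hp hq
  obtain ⟨hp', e⟩ := K p hp
  rw [mv_mul, act_mul, e]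
  exact H _ _ hp' hq

theorem Preserves.mul {h k : G} (H : Preserves h) (K : Preserves k) : Preserves (h * k) := by
  intro p hp
  obtain ⟨hp', e⟩ := K p hp
  obtain ⟨hp'', e'⟩ := H _ hp'
  refine ⟨mv_mul h k p ▸ hp'', ?_⟩
  rw [act_mul, e, e']
  exact Window.point_congr _ _ (mv_mul h k p).symm

theorem Preserves.one : Preserves 1 := by
  intro p hp
  have hq : Window (mv 1 p) := by rwa [mv_one]
  refine ⟨hq, ?_⟩
  rw [map_one, map_one]
  exact Window.point_congr hp hq (mv_one p).symm

/-! ### The stabilizer of the window -/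

theorem mv_klein {h : G} {j k : Fin 3} (e : h.1 * kleinElt j * h.1⁻¹ = kleinElt k)
    (p : Vertex → ℝ) : mv h p (Sum.inl (klein k)) = p (Sum.inl (klein j)) := by
  rw [← vertexAct_klein e, mv_act]

theorem Window.congr_point {q : Vertex → ℝ} (hq : Window q) {x y α β γ : ℝ}
    (h : Admissible x y α β) (hx : q (Sum.inl (klein 1)) = x) (hy : q (Sum.inl (klein 2)) = y)
    (hα : alpha q = α) (hβ : beta q = β) (hγ : gamma q = γ) : h.point γ = hq.point :=
  h.point_congr' hq.admissible hx.symm hy.symm hα.symm hβ.symm hγ.symm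

theorem preserves_gNeg : Preserves gNeg := by
  intro p hp
  have k (j : Fin 3) : mv gNeg p (Sum.inl (klein j)) = p (Sum.inl (klein j)) :=
    mv_klein (by revert j; decide) p
  have hq : Window (mv gNeg p) := by
    refine Window.of_mem (mv_mem_realization _ hp.mem_realization) ?_
    simp only [outside, List.forall_mem_cons, k]
    exact ⟨hp.zero_klein, hp.zero_four 0 (by decide), hp.zero_four 1 (by decide),
      hp.zero_one 0 (by decide), hp.zero_one 1 (by decide), hp.zero_three, hp.zero_two, by simp⟩
  refine ⟨hq, (hp.admissible.act_gNeg _).trans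
    (hq.congr_point _ (k 1) (k 2) ?_ ?_ ?_)⟩
  · change p (Sum.inr (0, 2)) - p (Sum.inr (3, 2)) = -(p (Sum.inr (3, 2)) - p (Sum.inr (0, 2)))
    ring
  · change p (Sum.inr (2, 0)) - p (Sum.inr (1, 0)) + p (Sum.inr (1, 1)) - p (Sum.inr (2, 1)) =
      -(p (Sum.inr (1, 0)) - p (Sum.inr (2, 0)) + p (Sum.inr (2, 1)) - p (Sum.inr (1, 1)))
    ring
  · change p (Sum.inr (2, 0)) + p (Sum.inr (1, 0)) - p (Sum.inr (1, 1)) - p (Sum.inr (2, 1)) =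
      p (Sum.inr (1, 0)) + p (Sum.inr (2, 0)) - p (Sum.inr (2, 1)) - p (Sum.inr (1, 1))
    ring

theorem preserves_gConj : Preserves gConj := by
  intro p hp
  have k (j : Fin 3) : mv gConj p (Sum.inl (klein j)) = p (Sum.inl (klein j)) :=
    mv_klein (by revert j; decide) p
  have hq : Window (mv gConj p) := by
    refine Window.of_mem (mv_mem_realization _ hp.mem_realization) ?_
    simp only [outside, List.forall_mem_cons, k]
    exact ⟨hp.zero_klein, hp.zero_one 1 (by decide), hp.zero_one 0 (by decide),
      hp.zero_four 1 (by decide), hp.zero_four 0 (by decide), hp.zero_two, hp.zero_three, by simp⟩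
  refine ⟨hq, (hp.admissible.act_gConj _).trans
    (hq.congr_point _ (k 1) (k 2) ?_ ?_ ?_)⟩
  · rfl
  · change p (Sum.inr (1, 1)) - p (Sum.inr (2, 1)) + p (Sum.inr (2, 0)) - p (Sum.inr (1, 0)) =
      -(p (Sum.inr (1, 0)) - p (Sum.inr (2, 0)) + p (Sum.inr (2, 1)) - p (Sum.inr (1, 1)))
    ring
  · change p (Sum.inr (1, 1)) + p (Sum.inr (2, 1)) - p (Sum.inr (2, 0)) - p (Sum.inr (1, 0)) =
      -(p (Sum.inr (1, 0)) + p (Sum.inr (2, 0)) - p (Sum.inr (2, 1)) - p (Sum.inr (1, 1)))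
    ring

theorem preserves_gSwap : Preserves gSwap := by
  intro p hp
  have k0 : mv gSwap p (Sum.inl (klein 0)) = p (Sum.inl (klein 0)) := mv_klein (by decide) p
  have k1 : mv gSwap p (Sum.inl (klein 1)) = p (Sum.inl (klein 2)) := mv_klein (by decide) p
  have k2 : mv gSwap p (Sum.inl (klein 2)) = p (Sum.inl (klein 1)) := mv_klein (by decide) p
  have hq : Window (mv gSwap p) := by
    refine Window.of_mem (mv_mem_realization _ hp.mem_realization) ?_
    simp only [outside, List.forall_mem_cons, k0]
    exact ⟨hp.zero_klein, hp.zero_one 0 (by decide), hp.zero_one 1 (by decide),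
      hp.zero_four 0 (by decide), hp.zero_four 1 (by decide), hp.zero_three, hp.zero_two, by simp⟩
  refine ⟨hq, (hp.admissible.act_gSwap _).trans
    (hq.congr_point _ k1 k2 ?_ ?_ ?_)⟩
  · rfl
  · change p (Sum.inr (2, 0)) - p (Sum.inr (1, 0)) + p (Sum.inr (1, 1)) - p (Sum.inr (2, 1)) =
      -(p (Sum.inr (1, 0)) - p (Sum.inr (2, 0)) + p (Sum.inr (2, 1)) - p (Sum.inr (1, 1)))
    ring
  · change p (Sum.inr (2, 0)) + p (Sum.inr (1, 0)) - p (Sum.inr (1, 1)) - p (Sum.inr (2, 1)) =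
      p (Sum.inr (1, 0)) + p (Sum.inr (2, 0)) - p (Sum.inr (2, 1)) - p (Sum.inr (1, 1))
    ring

/-! ### Translations of the window -/

theorem Window.inr_eq_zero {p : Vertex → ℝ} (h : Window p)
    (he : 1 - p (Sum.inl (klein 1)) - p (Sum.inl (klein 2)) = 0) (a : Fin 4) (n : Fin 3) :
    p (Sum.inr (a, n)) = 0 := by
  have hs := h.sum_eq
  rw [sum_vertex, Fin.sum_univ_three, h.zero_klein] at hs
  have h2 : ∑ a, ∑ n, p (Sum.inr (a, n)) = 0 := by linarith
  rw [Finset.sum_eq_zero_iff_of_nonneg fun a _ => Finset.sum_nonneg fun n _ => h.nonneg _] at h2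
  have h3 := h2 a (Finset.mem_univ a)
  rw [Finset.sum_eq_zero_iff_of_nonneg fun n _ => h.nonneg _] at h3
  exact h3 n (Finset.mem_univ n)

/-- Equality of images determines the parameters up to the ambiguity `m` of `eq_of_point_eq`. A
short shift leaves only `m = 0`, and injectivity of `diamond` turns the equality into the linear
condition `hmv`. The case `1 - x - y = 0` is treated apart, because both points are then Klein
vertices. -/
theorem compatible_of_shift (g : G) (c : ℕ) (hc : c ≤ 3) (r₁ r₂ : ℝ → ℝ → ℝ)
    (hr : r₁ 0 0 = 0 ∧ r₂ 0 0 = 0)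
    (hk : ∀ j, g.1 * kleinElt j * g.1⁻¹ = kleinElt j)
    (hadm : ∀ {x y α β}, Admissible x y α β → Admissible x y (r₁ α β) (r₂ α β))
    (hact : ∀ {x y α β} (h : Admissible x y α β) (γ : ℝ),
      act (RHom g) (h.point γ) = (hadm h).point (γ + c * (1 - x - y)))
    (hmv : ∀ p q, Window p → Window q → p (Sum.inl (klein 1)) = q (Sum.inl (klein 1)) →
      p (Sum.inl (klein 2)) = q (Sum.inl (klein 2)) →
      0 < 1 - p (Sum.inl (klein 1)) - p (Sum.inl (klein 2)) →
      ((∀ a n, p (Sum.inr (a, n)) = q (vertexAct g (Sum.inr (a, n)))) ↔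
        gamma q = gamma p + c * (1 - p (Sum.inl (klein 1)) - p (Sum.inl (klein 2))) ∧
          alpha q = r₁ (alpha p) (beta p) ∧ beta q = r₂ (alpha p) (beta p))) :
    Compatible g := by
  intro p q hp hq
  rw [Window.point, hact]
  have key : p (Sum.inl (klein 1)) = q (Sum.inl (klein 1)) →
      p (Sum.inl (klein 2)) = q (Sum.inl (klein 2)) →
      (mv g p = q ↔ ∀ a n, p (Sum.inr (a, n)) = q (vertexAct g (Sum.inr (a, n)))) := by
    intro h1 h2
    rw [mv_eq_iff, forall_vertex]
    refine and_iff_right fun j => ?_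
    rw [vertexAct_klein (hk j)]
    fin_cases j
    · exact hp.zero_klein.trans hq.zero_klein.symm
    · exact h1
    · exact h2
  constructor
  · intro H
    have h1 : p (Sum.inl (klein 1)) = q (Sum.inl (klein 1)) := by rw [← H, mv_klein (hk 1)]
    have h2 : p (Sum.inl (klein 2)) = q (Sum.inl (klein 2)) := by rw [← H, mv_klein (hk 2)]
    rcases hp.admissible.e_nonneg.eq_or_lt with he | he
    · have he' : 1 - q (Sum.inl (klein 1)) - q (Sum.inl (klein 2)) = 0 := by
        rw [← h1, ← h2, ← he]
      have hz := hp.admissible.zero_zero he.symm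
      have hz' := hq.admissible.zero_zero he'
      rw [(hadm hp.admissible).point_congr he.symm _ (gamma q)]
      refine hq.congr_point _ h1.symm h2.symm ?_ ?_ rfl
      · rw [hz.1, hz.2, hr.1, hz'.1]
      · rw [hz.1, hz.2, hr.2, hz'.2]
    · obtain ⟨e1, e2, e3⟩ := (hmv p q hp hq h1 h2 he).1 ((key h1 h2).1 H)
      exact hq.congr_point _ h1.symm h2.symm e2 e3 e1
  · intro H
    obtain ⟨h1, h2, H⟩ := (hadm hp.admissible).eq_of_point_eq hq.admissible H
    rw [key h1 h2]
    rcases hp.admissible.e_nonneg.eq_or_lt with he | he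
    · intro a n
      have he' : 1 - q (Sum.inl (klein 1)) - q (Sum.inl (klein 2)) = 0 := by
        rw [← h1, ← h2, ← he]
      rw [hp.inr_eq_zero he.symm]
      exact (hq.inr_eq_zero he' _ _).symm
    · obtain ⟨m, hm, hd⟩ := H.resolve_left he.ne'
      have g1 := abs_le.1 hp.abs_gamma_le
      have g2 := abs_le.1 hq.abs_gamma_le
      rw [← h1, ← h2] at g2
      -- With `e = 1 - x - y` and both `|γ|` at most `e`, the number `6 m e` lies between `(c - 2)
      -- e` and `(c + 2) e`, hence between `-2e` and `5e`.
      have hm0 : m = 0 := by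
        have hc' : (c : ℝ) ≤ 3 := by exact_mod_cast hc
        have hc0 : (0 : ℝ) ≤ c := Nat.cast_nonneg c
        by_contra hne
        rcases lt_or_gt_of_ne hne with hlt | hgt
        · have : (m : ℝ) ≤ -1 := by exact_mod_cast Int.le_sub_one_of_lt hlt
          nlinarith
        · have : (1 : ℝ) ≤ m := by exact_mod_cast hgt
          nlinarith
      subst hm0
      rw [zpow_zero, one_mul] at hd
      obtain ⟨d1, d2⟩ := diamond_injective hd
      refine (hmv p q hp hq h1 h2 he).2 ⟨?_, d1.symm, d2.symm⟩
      rw [hm]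
      simp

theorem gT_fixes (j : Fin 3) : gT.1 * kleinElt j * gT.1⁻¹ = kleinElt j := by
  revert j; decide

/-- The half-sum and half-difference of `γ` and `β` are `b - c'` and `b' - c`. In each of these one
term vanishes, so both terms are determined by the difference. Then `α` and the total give `a` and
`a'`. -/
theorem window_linear_zero {a a' b b' c c' A A' B B' C C' : ℝ} (hb : 0 ≤ b) (hb' : 0 ≤ b')
    (hc : 0 ≤ c) (hc' : 0 ≤ c') (hB : 0 ≤ B) (hB' : 0 ≤ B') (hC : 0 ≤ C) (hC' : 0 ≤ C')
    (h1 : b = 0 ∨ c' = 0) (h2 : b' = 0 ∨ c = 0) (h3 : B = 0 ∨ C' = 0) (h4 : B' = 0 ∨ C = 0)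
    (hs : a + a' + b + b' + c + c' = A + A' + B + B' + C + C')
    (hγ : B + B' - C - C' = b + b' - c - c') (hα : A - A' = a - a')
    (hβ : B - B' + C - C' = b - b' + c - c') :
    a = A ∧ a' = A' ∧ b = B ∧ b' = B' ∧ c = C ∧ c' = C' := by
  have e1 : b = B ∧ c' = C' := by
    rcases h1 with h1 | h1 <;> rcases h3 with h3 | h3 <;> constructor <;> linarith
  have e2 : b' = B' ∧ c = C := by
    rcases h2 with h2 | h2 <;> rcases h4 with h4 | h4 <;> constructor <;> linarith
  refine ⟨?_, ?_, e1.1, e2.1, e2.2, e1.2⟩ <;> linarith [e1.1, e1.2, e2.1, e2.2]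

/-- The equations give `B - C' = a + b + b'` and `B' - C = a' + b + b'`, so `C = C' = 0` by
complementarity. Then `A = c' - b` and `A' = c - b'` force `b = b' = 0`. -/
theorem window_linear_one {a a' b b' c c' A A' B B' C C' : ℝ}
    (ha : 0 ≤ a) (ha' : 0 ≤ a') (hb : 0 ≤ b) (hb' : 0 ≤ b')
    (hA : 0 ≤ A) (hA' : 0 ≤ A') (hC : 0 ≤ C) (hC' : 0 ≤ C')
    (h1 : b = 0 ∨ c' = 0) (h2 : b' = 0 ∨ c = 0) (h3 : B = 0 ∨ C' = 0) (h4 : B' = 0 ∨ C = 0)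
    (hs : a + a' + b + b' + c + c' = A + A' + B + B' + C + C')
    (hγ : B + B' - C - C' = b + b' - c - c' + (a + a' + b + b' + c + c'))
    (hα : A - A' = -(b - b' + c - c')) (hβ : B - B' + C - C' = a - a') :
    a = B ∧ a' = B' ∧ c = A' ∧ c' = A ∧ b = 0 ∧ b' = 0 ∧ C = 0 ∧ C' = 0 := by
  have e1 : b = 0 := by rcases h1 with h1 | h1 <;> linarith
  have e2 : b' = 0 := by rcases h2 with h2 | h2 <;> linarith
  have e3 : C' = 0 := by rcases h3 with h3 | h3 <;> linarith
  have e4 : C = 0 := by rcases h4 with h4 | h4 <;> linarith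
  refine ⟨?_, ?_, ?_, ?_, e1, e2, e4, e3⟩ <;> linarith

/-- Each `γ` is bounded in absolute value by the total, so a shift by twice the total is attained
only at the opposite extremes of the two windows. -/
theorem window_linear_two {a a' b b' c c' A A' B B' C C' : ℝ}
    (ha : 0 ≤ a) (ha' : 0 ≤ a') (hb : 0 ≤ b) (hb' : 0 ≤ b')
    (hA : 0 ≤ A) (hA' : 0 ≤ A') (hC : 0 ≤ C) (hC' : 0 ≤ C')
    (hs : a + a' + b + b' + c + c' = A + A' + B + B' + C + C')
    (hγ : B + B' - C - C' = b + b' - c - c' + 2 * (a + a' + b + b' + c + c'))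
    (hβ : B - B' + C - C' = -(b - b' + c - c')) :
    a = 0 ∧ a' = 0 ∧ A = 0 ∧ A' = 0 ∧ c = B' ∧ c' = B ∧ b = 0 ∧ b' = 0 ∧ C = 0 ∧ C' = 0 := by
  refine ⟨?_, ?_, ?_, ?_, ?_, ?_, ?_, ?_, ?_, ?_⟩ <;> linarith

theorem compatible_one : Compatible 1 := by
  refine compatible_of_shift 1 0 (by norm_num) (fun α _ => α) (fun _ β => β) ⟨rfl, rfl⟩
    (fun j => by simp) id (fun h γ => ?_) ?_
  · rw [map_one, map_one]
    exact h.point_congr' _ rfl rfl rfl rfl (by simp)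
  · intro p q hp hq h1 h2 he
    have s1 := hp.sum_expand
    have s2 := hq.sum_expand
    rw [← h1, ← h2, ← s1] at s2
    rw [← s1] at he ⊢
    have n := hp.nonneg
    have n' := hq.nonneg
    constructor
    · intro H
      have e02 : p (Sum.inr (0, 2)) = q (Sum.inr (0, 2)) :=
        H 0 2
      have e10 : p (Sum.inr (1, 0)) = q (Sum.inr (1, 0)) :=
        H 1 0
      have e11 : p (Sum.inr (1, 1)) = q (Sum.inr (1, 1)) :=
        H 1 1
      have e20 : p (Sum.inr (2, 0)) = q (Sum.inr (2, 0)) :=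
        H 2 0
      have e21 : p (Sum.inr (2, 1)) = q (Sum.inr (2, 1)) :=
        H 2 1
      have e32 : p (Sum.inr (3, 2)) = q (Sum.inr (3, 2)) :=
        H 3 2
      simp only [gamma, alpha, beta]
      push_cast
      refine ⟨?_, ?_, ?_⟩ <;> linarith
    · rintro ⟨H1, H2, H3⟩
      simp only [gamma, alpha, beta] at H1 H2 H3
      obtain ⟨ea, ea', eb, eb', ec, ec'⟩ := window_linear_zero (n _) (n _) (n _) (n _) (n' _) (n' _)
        (n' _) (n' _) hp.two_or hp.three_or hq.two_or hq.three_or s2.symm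
        (by simpa using H1) H2 H3
      intro a n
      fin_cases a <;> fin_cases n
      · exact (hp.zero_one 0 (by decide)).trans (hq.zero_one 0 (by decide)).symm
      · exact (hp.zero_one 1 (by decide)).trans (hq.zero_one 1 (by decide)).symm
      · exact ea'
      · exact eb
      · exact ec'
      · exact (hp.zero_two).trans (hq.zero_two).symm
      · exact eb'
      · exact ec
      · exact (hp.zero_three).trans (hq.zero_three).symm
      · exact (hp.zero_four 0 (by decide)).trans (hq.zero_four 0 (by decide)).symm
      · exact (hp.zero_four 1 (by decide)).trans (hq.zero_four 1 (by decide)).symm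
      · exact ea

theorem compatible_gT : Compatible gT := by
  refine compatible_of_shift gT 1 (by norm_num) (fun _ β => -β) (fun α _ => α) ⟨neg_zero, rfl⟩
    gT_fixes (fun h => h.rot) (fun h γ => ?_) ?_
  · rw [h.act_gT]
    exact h.rot.point_congr' _ rfl rfl rfl rfl (by simp)
  · intro p q hp hq h1 h2 he
    have s1 := hp.sum_expand
    have s2 := hq.sum_expand
    rw [← h1, ← h2, ← s1] at s2
    rw [← s1] at he ⊢
    have n := hp.nonneg
    have n' := hq.nonneg
    constructor
    · intro H
      have e00 : 0 = q (Sum.inr (2, 1)) :=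
        (hp.zero_one 0 (by decide)).symm.trans (H 0 0)
      have e02 : p (Sum.inr (0, 2)) = q (Sum.inr (2, 0)) :=
        H 0 2
      have e10 : p (Sum.inr (1, 0)) = 0 :=
        (H 1 0).trans (hq.zero_four 1 (by decide))
      have e11 : p (Sum.inr (1, 1)) = q (Sum.inr (3, 2)) :=
        H 1 1
      have e20 : p (Sum.inr (2, 0)) = 0 :=
        (H 2 0).trans (hq.zero_one 1 (by decide))
      have e21 : p (Sum.inr (2, 1)) = q (Sum.inr (0, 2)) :=
        H 2 1
      have e30 : 0 = q (Sum.inr (1, 1)) :=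
        (hp.zero_four 0 (by decide)).symm.trans (H 3 0)
      have e32 : p (Sum.inr (3, 2)) = q (Sum.inr (1, 0)) :=
        H 3 2
      simp only [gamma, alpha, beta]
      push_cast
      refine ⟨?_, ?_, ?_⟩ <;> linarith
    · rintro ⟨H1, H2, H3⟩
      simp only [gamma, alpha, beta] at H1 H2 H3
      obtain ⟨ea, ea', ec, ec', eb, eb', eC, eC'⟩ := window_linear_one (n _) (n _) (n _) (n _)
        (n' _) (n' _) (n' _) (n' _) hp.two_or hp.three_or hq.two_or hq.three_or
        s2.symm (by simpa using H1) H2 H3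
      intro a n
      fin_cases a <;> fin_cases n
      · exact (hp.zero_one 0 (by decide)).trans eC.symm
      · exact (hp.zero_one 1 (by decide)).trans (hq.zero_three).symm
      · exact ea'
      · exact eb.trans (hq.zero_four 1 (by decide)).symm
      · exact ec'
      · exact (hp.zero_two).trans (hq.zero_four 0 (by decide)).symm
      · exact eb'.trans (hq.zero_one 1 (by decide)).symm
      · exact ec
      · exact (hp.zero_three).trans (hq.zero_one 0 (by decide)).symm
      · exact (hp.zero_four 0 (by decide)).trans eC'.symm
      · exact (hp.zero_four 1 (by decide)).trans (hq.zero_two).symm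
      · exact ea

theorem compatible_gT_two : Compatible (gT ^ 2) := by
  refine compatible_of_shift (gT ^ 2) 2 (by norm_num) (fun α _ => -α) (fun _ β => -β) ⟨neg_zero, neg_zero⟩
    (by decide) (fun h => h.rot.rot) (fun h γ => ?_) ?_
  · rw [pow_two, act_mul, h.act_gT, h.rot.act_gT]
    exact h.rot.rot.point_congr' _ rfl rfl rfl rfl (by push_cast; ring)
  · intro p q hp hq h1 h2 he
    have s1 := hp.sum_expand
    have s2 := hq.sum_expand
    rw [← h1, ← h2, ← s1] at s2
    rw [← s1] at he ⊢
    have n := hp.nonneg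
    have n' := hq.nonneg
    constructor
    · intro H
      have e00 : 0 = q (Sum.inr (0, 2)) :=
        (hp.zero_one 0 (by decide)).symm.trans (H 0 0)
      have e02 : p (Sum.inr (0, 2)) = 0 :=
        (H 0 2).trans (hq.zero_one 1 (by decide))
      have e10 : p (Sum.inr (1, 0)) = 0 :=
        (H 1 0).trans (hq.zero_two)
      have e11 : p (Sum.inr (1, 1)) = q (Sum.inr (1, 0)) :=
        H 1 1
      have e12 : 0 = q (Sum.inr (1, 1)) :=
        (hp.zero_two).symm.trans (H 1 2)
      have e20 : p (Sum.inr (2, 0)) = 0 :=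
        (H 2 0).trans (hq.zero_three)
      have e21 : p (Sum.inr (2, 1)) = q (Sum.inr (2, 0)) :=
        H 2 1
      have e22 : 0 = q (Sum.inr (2, 1)) :=
        (hp.zero_three).symm.trans (H 2 2)
      have e30 : 0 = q (Sum.inr (3, 2)) :=
        (hp.zero_four 0 (by decide)).symm.trans (H 3 0)
      have e32 : p (Sum.inr (3, 2)) = 0 :=
        (H 3 2).trans (hq.zero_four 1 (by decide))
      simp only [gamma, alpha, beta]
      push_cast
      refine ⟨?_, ?_, ?_⟩ <;> linarith
    · rintro ⟨H1, H2, H3⟩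
      simp only [gamma, alpha, beta] at H1 H2 H3
      obtain ⟨ea, ea', eA, eA', ec, ec', eb, eb', eC, eC'⟩ := window_linear_two (n _) (n _) (n _)
        (n _) (n' _) (n' _) (n' _) (n' _) s2.symm (by simpa using H1) H3
      intro a n
      fin_cases a <;> fin_cases n
      · exact (hp.zero_one 0 (by decide)).trans eA'.symm
      · exact (hp.zero_one 1 (by decide)).trans (hq.zero_one 0 (by decide)).symm
      · exact ea'.trans (hq.zero_one 1 (by decide)).symm
      · exact eb.trans (hq.zero_two).symm
      · exact ec'
      · exact (hp.zero_two).trans eC'.symm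
      · exact eb'.trans (hq.zero_three).symm
      · exact ec
      · exact (hp.zero_three).trans eC.symm
      · exact (hp.zero_four 0 (by decide)).trans eA.symm
      · exact (hp.zero_four 1 (by decide)).trans (hq.zero_four 0 (by decide)).symm
      · exact ea.trans (hq.zero_four 1 (by decide)).symm

/-- Both sides are impossible when `1 - x - y > 0`: the two windows share no torus vertex, and a
shift by `3 (1 - x - y)` exceeds the width of the range of `γ`. -/
theorem compatible_gT_three : Compatible (gT ^ 3) := by
  refine compatible_of_shift (gT ^ 3) 3 (by norm_num) (fun _ β => - -β) (fun α _ => -α) ⟨by simp, neg_zero⟩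
    (by decide) (fun h => h.rot.rot.rot) (fun h γ => ?_) ?_
  · rw [pow_succ, pow_two, act_mul, act_mul, h.act_gT, h.rot.act_gT, h.rot.rot.act_gT]
    exact h.rot.rot.rot.point_congr' _ rfl rfl rfl rfl (by push_cast; ring)
  · intro p q hp hq h1 h2 he
    have s1 := hp.sum_expand
    have s2 := hq.sum_expand
    rw [← h1, ← h2, ← s1] at s2
    rw [← s1] at he ⊢
    have n := hp.nonneg
    have n' := hq.nonneg
    constructor
    · intro H
      have e00 : 0 = q (Sum.inr (2, 0)) :=
        (hp.zero_one 0 (by decide)).symm.trans (H 0 0)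
      have e01 : 0 = q (Sum.inr (2, 1)) :=
        (hp.zero_one 1 (by decide)).symm.trans (H 0 1)
      have e02 : p (Sum.inr (0, 2)) = 0 :=
        (H 0 2).trans (hq.zero_three)
      have e10 : p (Sum.inr (1, 0)) = 0 :=
        (H 1 0).trans (hq.zero_four 0 (by decide))
      have e11 : p (Sum.inr (1, 1)) = 0 :=
        (H 1 1).trans (hq.zero_four 1 (by decide))
      have e12 : 0 = q (Sum.inr (3, 2)) :=
        (hp.zero_two).symm.trans (H 1 2)
      have e20 : p (Sum.inr (2, 0)) = 0 :=
        (H 2 0).trans (hq.zero_one 0 (by decide))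
      have e21 : p (Sum.inr (2, 1)) = 0 :=
        (H 2 1).trans (hq.zero_one 1 (by decide))
      have e22 : 0 = q (Sum.inr (0, 2)) :=
        (hp.zero_three).symm.trans (H 2 2)
      have e30 : 0 = q (Sum.inr (1, 0)) :=
        (hp.zero_four 0 (by decide)).symm.trans (H 3 0)
      have e31 : 0 = q (Sum.inr (1, 1)) :=
        (hp.zero_four 1 (by decide)).symm.trans (H 3 1)
      have e32 : p (Sum.inr (3, 2)) = 0 :=
        (H 3 2).trans (hq.zero_two)
      linarith
    · rintro ⟨H1, H2, H3⟩
      simp only [gamma, alpha, beta] at H1 H2 H3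
      have := n (Sum.inr (3, 2))
      have := n (Sum.inr (0, 2))
      have := n (Sum.inr (1, 0))
      have := n (Sum.inr (2, 0))
      have := n (Sum.inr (2, 1))
      have := n (Sum.inr (1, 1))
      have := n' (Sum.inr (3, 2))
      have := n' (Sum.inr (0, 2))
      have := n' (Sum.inr (1, 0))
      have := n' (Sum.inr (2, 0))
      have := n' (Sum.inr (2, 1))
      have := n' (Sum.inr (1, 1))
      push_cast at H1
      linarith

/-! ### The absolute values of the homogeneous coordinates -/

/-- The sum of `min (p (a, n)) (p (ν_j a, n))` over all `a` and `n`. -/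
def overlap (j : Fin 3) (p : Vertex → ℝ) : ℝ :=
  ∑ a, ∑ n, min (p (Sum.inr (a, n))) (p (Sum.inr (kleinElt j a, n)))

/-- The sum of `min (p (a, n)) (p (a', n))` over all `a`, `a'` and `n`. -/
def totalOverlap (p : Vertex → ℝ) : ℝ :=
  ∑ a, ∑ a', ∑ n, min (p (Sum.inr (a, n))) (p (Sum.inr (a', n)))

/-- The absolute value of the `j`-th homogeneous coordinate of the image of `p`, if the sum of
the three absolute values is `1`. -/
def level (j : Fin 3) (p : Vertex → ℝ) : ℝ :=
  p (Sum.inl (klein j)) + (∑ a, ∑ n, p (Sum.inr (a, n))) / 6 + totalOverlap p / 6 -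
    overlap j p / 2

theorem mv_inr (h : G) (p : Vertex → ℝ) (a : Fin 4) (n : Fin 3) :
    mv h p (Sum.inr (h.1 a, h.2 n)) = p (Sum.inr (a, n)) :=
  mv_act h p (Sum.inr (a, n))

theorem overlap_mv {h : G} {j k : Fin 3} (e : h.1 * kleinElt j * h.1⁻¹ = kleinElt k)
    (p : Vertex → ℝ) : overlap k (mv h p) = overlap j p := by
  unfold overlap
  rw [← Equiv.sum_comp h.1]
  refine Finset.sum_congr rfl fun a _ => ?_
  rw [← Equiv.sum_comp h.2]
  refine Finset.sum_congr rfl fun n _ => ?_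
  have : kleinElt k (h.1 a) = h.1 (kleinElt j a) := by
    rw [← e]
    simp
  rw [this, mv_inr, mv_inr]

theorem totalOverlap_mv (h : G) (p : Vertex → ℝ) : totalOverlap (mv h p) = totalOverlap p := by
  unfold totalOverlap
  rw [← Equiv.sum_comp h.1]
  refine Finset.sum_congr rfl fun a _ => ?_
  rw [← Equiv.sum_comp h.1]
  refine Finset.sum_congr rfl fun a' _ => ?_
  rw [← Equiv.sum_comp h.2]
  refine Finset.sum_congr rfl fun n _ => ?_
  rw [mv_inr, mv_inr]

theorem level_mv {h : G} {j k : Fin 3} (e : h.1 * kleinElt j * h.1⁻¹ = kleinElt k)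
    (p : Vertex → ℝ) : level k (mv h p) = level j p := by
  unfold level
  rw [overlap_mv e, totalOverlap_mv, mv_klein e]
  congr 4
  rw [← Equiv.sum_comp h.1]
  refine Finset.sum_congr rfl fun a _ => ?_
  rw [← Equiv.sum_comp h.2]
  exact Finset.sum_congr rfl fun n _ => mv_inr h p a n

theorem min_eq_half (a b : ℝ) : min a b = (a + b - |a - b|) / 2 := by
  rw [min_def]
  split_ifs with h
  · rw [abs_of_nonpos (by linarith)]; ring
  · rw [abs_of_nonneg (by linarith)]; ring

namespace Window

variable {p q : Vertex → ℝ}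

/-- The pairs of window vertices `(a, n)`, `(a', n)` with a common label are `(1, 3)(4, 3)`, `(2,
1)(3, 1)` and `(2, 2)(3, 2)`, all matched by `(14)(23)`. The diagonal terms of `totalOverlap`
contribute the total torus weight. -/
theorem overlaps (h : Window p) :
    overlap 0 p = 2 * (min (p (Sum.inr (3, 2))) (p (Sum.inr (0, 2))) +
      min (p (Sum.inr (1, 0))) (p (Sum.inr (2, 0))) +
      min (p (Sum.inr (2, 1))) (p (Sum.inr (1, 1)))) ∧
    overlap 1 p = 0 ∧ overlap 2 p = 0 ∧
    totalOverlap p = overlap 0 p + 1 - p (Sum.inl (klein 1)) - p (Sum.inl (klein 2)) := by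
  have k0 : kleinElt 0 0 = 3 ∧ kleinElt 0 1 = 2 ∧ kleinElt 0 2 = 1 ∧ kleinElt 0 3 = 0 := by decide
  have k1 : kleinElt 1 0 = 2 ∧ kleinElt 1 1 = 3 ∧ kleinElt 1 2 = 0 ∧ kleinElt 1 3 = 1 := by decide
  have k2 : kleinElt 2 0 = 1 ∧ kleinElt 2 1 = 0 ∧ kleinElt 2 2 = 3 ∧ kleinElt 2 3 = 2 := by decide
  have z1 (v) : min (p v) 0 = 0 := min_eq_right (h.nonneg v)
  have z2 (v) : min 0 (p v) = 0 := min_eq_left (h.nonneg v)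
  have c1 := min_comm (p (Sum.inr (3, 2))) (p (Sum.inr (0, 2)))
  have c2 := min_comm (p (Sum.inr (1, 0))) (p (Sum.inr (2, 0)))
  have c3 := min_comm (p (Sum.inr (2, 1))) (p (Sum.inr (1, 1)))
  have s := h.sum_expand
  refine ⟨?_, ?_, ?_, ?_⟩ <;>
  simp only [overlap, totalOverlap, Fin.sum_univ_three, Fin.sum_univ_four, k0, k1, k2, h.zero_two,
    h.zero_three, h.zero_one 0 (by decide), h.zero_one 1 (by decide), h.zero_four 0 (by decide),
    h.zero_four 1 (by decide), z1, z2, min_self, c1, c2, c3] <;> linarith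

theorem abs_alpha (p : Vertex → ℝ) : |alpha p| = p (Sum.inr (3, 2)) + p (Sum.inr (0, 2)) -
    2 * min (p (Sum.inr (3, 2))) (p (Sum.inr (0, 2))) := by
  rw [min_eq_half, alpha]
  ring

theorem abs_beta (h : Window p) : |beta p| = p (Sum.inr (1, 0)) + p (Sum.inr (2, 0)) +
    p (Sum.inr (2, 1)) + p (Sum.inr (1, 1)) - 2 * (min (p (Sum.inr (1, 0))) (p (Sum.inr (2, 0))) +
      min (p (Sum.inr (2, 1))) (p (Sum.inr (1, 1)))) := by
  have n1 := h.nonneg (Sum.inr (1, 0))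
  have n2 := h.nonneg (Sum.inr (2, 0))
  have n3 := h.nonneg (Sum.inr (2, 1))
  have n4 := h.nonneg (Sum.inr (1, 1))
  unfold beta
  rcases h.two_or with e | e <;> rcases h.three_or with e' | e' <;> rw [e, e']
  · rw [min_self, min_eq_half, sub_self, zero_add]
    ring
  · rw [min_eq_left n2, min_eq_left n4, abs_of_nonpos (by linarith)]
    ring
  · rw [min_eq_right n1, min_eq_right n3, abs_of_nonneg (by linarith)]
    ring
  · rw [min_self, min_eq_half, add_zero, sub_zero]
    ring

theorem abs_add_abs (h : Window p) : |alpha p| + |beta p| =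
    1 - p (Sum.inl (klein 1)) - p (Sum.inl (klein 2)) - overlap 0 p := by
  rw [abs_alpha p, h.abs_beta, h.overlaps.1, ← h.sum_expand]
  ring

/-- The diagonal part of `totalOverlap` repeats the torus weight, which therefore counts with
coefficient `1/3` for every `j`. Any overlap of opposite vertices is then shifted from one
coordinate to the two others. Since `level` is manifestly equivariant, the absolute values of `f`
are known on all of `|X|`. -/
theorem norm_windowMap (h : Window p) (j : Fin 3) : ‖windowMap p j‖ = level j p := by
  obtain ⟨-, h1, h2, h3⟩ := h.overlaps
  have hs : ∑ a, ∑ n, p (Sum.inr (a, n)) =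
      1 - p (Sum.inl (klein 1)) - p (Sum.inl (klein 2)) := by
    have := h.sum_eq
    rw [sum_vertex, Fin.sum_univ_three, h.zero_klein] at this
    linarith
  have ha := h.abs_add_abs
  unfold windowMap level
  rw [hs, h3]
  fin_cases j
  · refine (h.admissible.norm_model_zero _).trans ?_
    rw [ha]
    rw [Fin.zero_eta, h.zero_klein]
    ring
  · refine (h.admissible.norm_model_one _).trans ?_
    rw [ha]
    rw [Fin.mk_one, h1]
    ring
  · refine (h.admissible.norm_model_two _).trans ?_
    rw [ha]
    rw [show (⟨2, by decide⟩ : Fin 3) = 2 from rfl, h2]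
    ring

end Window

/-! ### Compatibility of all group elements -/

/-- The coordinate axes correspond to the Klein elements, so `ρ θ` is a signed permutation matrix
whose permutation is conjugation by `θ`. -/
theorem rhoFn_of_conj : ∀ (θ : Equiv.Perm (Fin 4)) (j k : Fin 3),
    θ * kleinElt j * θ⁻¹ = kleinElt k →
      ∃ s : ({1, -1} : Finset ℤ), ∀ l, rhoFn θ k l = if l = j then 4 * s.1 else 0 := by
  decide +kernel

theorem norm_lift_apply {h : G} {j k : Fin 3} (e : h.1 * kleinElt j * h.1⁻¹ = kleinElt k)
    (z : C3) : ‖(lift h).1 z k‖ = ‖z j‖ := by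
  obtain ⟨⟨s, hs⟩, H⟩ := rhoFn_of_conj h.1 j k e
  rw [lift_apply_of H, norm_mul, norm_conjPow, norm_mul, norm_omega_pow, norm_conjPow, one_mul]
  have : ‖(s : ℂ)‖ = 1 := by
    rcases Finset.mem_insert.1 hs with rfl | hs
    · simp
    · rw [Finset.mem_singleton.1 hs]; simp
  rw [this, one_mul]

/-- The permutation of the Klein group induced by conjugation, as a permutation of indices. -/
theorem exists_index_perm (h : G) : ∃ σ : Equiv.Perm (Fin 3),
    ∀ j, h.1 * kleinElt j * h.1⁻¹ = kleinElt (σ j) := by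
  choose σ hσ using kleinElt_conj h.1
  refine ⟨Equiv.ofBijective σ (Finite.injective_iff_bijective.1 fun i j hij => ?_),
    fun j => (hσ j).symm⟩
  have := (hσ i).symm.trans ((congr_arg kleinElt hij).trans (hσ j))
  exact kleinElt_injective (mul_left_cancel (mul_right_cancel this))

theorem sum_norm_lift (h : G) (z : C3) : ∑ i, ‖(lift h).1 z i‖ = ∑ i, ‖z i‖ := by
  obtain ⟨σ, hσ⟩ := exists_index_perm h
  rw [← Equiv.sum_comp σ]
  exact Finset.sum_congr rfl fun j _ => norm_lift_apply (hσ j) z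

theorem Window.windowMap_ne_zero {p : Vertex → ℝ} (hp : Window p) : windowMap p ≠ 0 :=
  hp.admissible.model_ne_zero _

theorem Window.point_def {p : Vertex → ℝ} (hp : Window p) :
    hp.point = Projectivization.mk ℂ (windowMap p) hp.windowMap_ne_zero := rfl

theorem Window.sum_norm {p : Vertex → ℝ} (hp : Window p) : ∑ i, ‖windowMap p i‖ = 1 :=
  hp.admissible.sum_norm _

theorem level_eq_of_act_point_eq {h : G} {p q : Vertex → ℝ} (hp : Window p) (hq : Window q)
    (H : act (RHom h) hp.point = hq.point) {j k : Fin 3}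
    (e : h.1 * kleinElt j * h.1⁻¹ = kleinElt k) : level k q = level j p := by
  rw [Window.point_def, act_RHom_mk, Window.point_def] at H
  obtain ⟨t, ht, H⟩ := exists_unit_of_mk_eq H (by rw [sum_norm_lift, hp.sum_norm, hq.sum_norm])
  rw [← hp.norm_windowMap, ← hq.norm_windowMap, ← norm_lift_apply e, H, norm_mul, ht, one_mul]

/-- The stabilizer has 48 elements: six translations times the eight elements that preserve the
window. Writing the last two translations as inverses keeps every shift within the bound 3. -/
theorem stabilizer_elements : ∀ h : G, h.1 * kleinElt 0 * h.1⁻¹ = kleinElt 0 →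
    ∃ t ∈ ([1, gT, gT ^ 2, gT ^ 3, gT⁻¹, (gT ^ 2)⁻¹] : List G),
      ∃ i j k : Fin 2, h = t * (gNeg ^ i.val * gConj ^ j.val * gSwap ^ k.val) := by
  decide +kernel

theorem Preserves.pow {g : G} (H : Preserves g) (n : ℕ) : Preserves (g ^ n) := by
  induction n with
  | zero => exact Preserves.one
  | succ n ih => rw [pow_succ]; exact ih.mul H

theorem compatible_of_stabilizer {h : G} (e : h.1 * kleinElt 0 * h.1⁻¹ = kleinElt 0) :
    Compatible h := by
  obtain ⟨t, ht, i, j, k, rfl⟩ := stabilizer_elements h e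
  refine Compatible.mul ?_ (((preserves_gNeg.pow _).mul (preserves_gConj.pow _)).mul
    (preserves_gSwap.pow _))
  simp only [List.mem_cons, List.not_mem_nil, or_false] at ht
  rcases ht with rfl | rfl | rfl | rfl | rfl | rfl
  · exact compatible_one
  · exact compatible_gT
  · exact compatible_gT_two
  · exact compatible_gT_three
  · exact compatible_gT.inv
  · exact compatible_gT_two.inv

/-! ### Reduction of an arbitrary group element to the stabilizer of `(14)(23)` -/

/-- Points of the window on the simplices `{ν, (2, 1), (3, 2), (4, 3)}`. -/
structure Thin (p : Vertex → ℝ) : Prop extends Window p where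
  one : p (Sum.inr (0, 2)) = 0
  three : p (Sum.inr (2, 0)) = 0
  two : p (Sum.inr (1, 1)) = 0

/-- `gRot` permutes the vertices `(2, 1)`, `(3, 2)`, `(4, 3)` cyclically and sends the Klein vertex
`(12)(34)` to `(13)(24)`, so it takes one thin simplex of the window to another. -/
theorem Thin.act_gRot {p : Vertex → ℝ} (hp : Thin p) (h1 : p (Sum.inl (klein 1)) = 0) :
    ∃ hq : Thin (mv gRot p), mv gRot p (Sum.inl (klein 2)) = 0 ∧
      act (RHom gRot) hp.toWindow.point = hq.toWindow.point := by
  have k0 : mv gRot p (Sum.inl (klein 0)) = p (Sum.inl (klein 1)) := mv_klein (by decide) p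
  have k1 : mv gRot p (Sum.inl (klein 1)) = p (Sum.inl (klein 2)) := mv_klein (by decide) p
  have k2 : mv gRot p (Sum.inl (klein 2)) = p (Sum.inl (klein 0)) := mv_klein (by decide) p
  have hw : Window (mv gRot p) := by
    refine Window.of_mem (mv_mem_realization _ hp.mem_realization) ?_
    simp only [outside, List.forall_mem_cons, k0]
    exact ⟨h1, hp.one, hp.zero_one 0 (by decide),
      hp.zero_three, hp.three, hp.zero_four 1 (by decide), hp.two, by simp⟩
  have hq : Thin (mv gRot p) := ⟨hw, hp.zero_one 1 (by decide), hp.zero_two,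
    hp.zero_four 0 (by decide)⟩
  refine ⟨hq, k2.trans hp.zero_klein, ?_⟩
  have s := hp.toWindow.sum_expand
  rw [h1, hp.one, hp.two, hp.three] at s
  have ha : alpha p = p (Sum.inr (3, 2)) := by rw [alpha, hp.one, sub_zero]
  have hb : beta p = p (Sum.inr (1, 0)) + p (Sum.inr (2, 1)) := by
    rw [beta, hp.two, hp.three]; ring
  have hg : gamma p = p (Sum.inr (1, 0)) - p (Sum.inr (2, 1)) := by
    rw [gamma, hp.two, hp.three]; ring
  have A : Admissible 0 (p (Sum.inl (klein 2))) (p (Sum.inr (3, 2)))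
      (p (Sum.inr (1, 0)) + p (Sum.inr (2, 1))) := by
    have := hp.admissible
    rwa [h1, ha, hb] at this
  have B : Admissible (p (Sum.inl (klein 2))) 0 (p (Sum.inr (2, 1)))
      (p (Sum.inr (3, 2)) + p (Sum.inr (1, 0))) := by
    refine ⟨hp.nonneg _, le_rfl, Or.inr rfl, ?_⟩
    rw [abs_of_nonneg (hp.nonneg _), abs_of_nonneg (add_nonneg (hp.nonneg _) (hp.nonneg _))]
    linarith
  have := A.act_gRot (hp.nonneg _) (hp.nonneg _) (hp.nonneg _) (by linarith) B
  refine Eq.trans ?_ (this.trans (hw.congr_point _ k1 (k2.trans hp.zero_klein) ?_ ?_ ?_))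
  · congr 1
    exact hp.admissible.point_congr' A h1 rfl ha hb hg
  · change p (Sum.inr (2, 1)) - p (Sum.inr (0, 1)) = _
    rw [hp.zero_one 1 (by decide), sub_zero]
  · change p (Sum.inr (3, 2)) - p (Sum.inr (1, 2)) + p (Sum.inr (1, 0)) - p (Sum.inr (3, 0)) = _
    rw [hp.zero_two, hp.zero_four 0 (by decide)]
    ring
  · change p (Sum.inr (3, 2)) + p (Sum.inr (1, 2)) - p (Sum.inr (1, 0)) - p (Sum.inr (3, 0)) = _
    rw [hp.zero_two, hp.zero_four 0 (by decide)]
    ring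

theorem Thin.act_gRot_inv {p : Vertex → ℝ} (hp : Thin p) (h2 : p (Sum.inl (klein 2)) = 0) :
    ∃ hq : Window (mv gRot⁻¹ p), act (RHom gRot⁻¹) hp.toWindow.point = hq.point := by
  have k0 : mv gRot⁻¹ p (Sum.inl (klein 0)) = p (Sum.inl (klein 2)) := mv_klein (by decide) p
  have k1 : mv gRot⁻¹ p (Sum.inl (klein 1)) = p (Sum.inl (klein 0)) := mv_klein (by decide) p
  have hw : Window (mv gRot⁻¹ p) := by
    refine Window.of_mem (mv_mem_realization _ hp.mem_realization) ?_
    simp only [outside, List.forall_mem_cons, k0]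
    exact ⟨h2, hp.zero_one 1 (by decide), hp.one, hp.two, hp.zero_two, hp.three,
      hp.zero_four 0 (by decide), by simp⟩
  have hq : Thin (mv gRot⁻¹ p) := ⟨hw, hp.zero_one 0 (by decide), hp.zero_four 1 (by decide),
    hp.zero_three⟩
  refine ⟨hw, ?_⟩
  obtain ⟨h', -, e⟩ := hq.act_gRot (k1.trans hp.zero_klein)
  rw [map_inv, map_inv, Equiv.Perm.inv_eq_iff_eq]
  exact (Window.point_congr _ _ (mv_mv_inv _ _)).symm.trans e.symm

/-- By `abs_add_abs` the hypothesis says that every overlap vanishes. The support then meets the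
torus in one of four triangles, which `gNeg` and `gConj` permute transitively. -/
theorem Window.exists_thin {p : Vertex → ℝ} (hp : Window p)
    (h : |alpha p| + |beta p| = 1 - p (Sum.inl (klein 1)) - p (Sum.inl (klein 2))) :
    ∃ k : G, Preserves k ∧ (∀ j, k.1 * kleinElt j * k.1⁻¹ = kleinElt j) ∧ Thin (mv k p) := by
  have ho := hp.abs_add_abs
  rw [h, hp.overlaps.1] at ho
  have n := hp.nonneg
  have m1 := le_min (n (Sum.inr (3, 2))) (n (Sum.inr (0, 2)))
  have m2 := le_min (n (Sum.inr (1, 0))) (n (Sum.inr (2, 0)))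
  have m3 := le_min (n (Sum.inr (2, 1))) (n (Sum.inr (1, 1)))
  have e1 : p (Sum.inr (3, 2)) = 0 ∨ p (Sum.inr (0, 2)) = 0 := by
    have : min (p (Sum.inr (3, 2))) (p (Sum.inr (0, 2))) = 0 := by linarith
    rcases min_choice (p (Sum.inr (3, 2))) (p (Sum.inr (0, 2))) with e | e <;> rw [e] at this
    exacts [Or.inl this, Or.inr this]
  have e2 : p (Sum.inr (1, 0)) = 0 ∨ p (Sum.inr (2, 0)) = 0 := by
    have : min (p (Sum.inr (1, 0))) (p (Sum.inr (2, 0))) = 0 := by linarith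
    rcases min_choice (p (Sum.inr (1, 0))) (p (Sum.inr (2, 0))) with e | e <;> rw [e] at this
    exacts [Or.inl this, Or.inr this]
  have e3 : p (Sum.inr (2, 1)) = 0 ∨ p (Sum.inr (1, 1)) = 0 := by
    have : min (p (Sum.inr (2, 1))) (p (Sum.inr (1, 1))) = 0 := by linarith
    rcases min_choice (p (Sum.inr (2, 1))) (p (Sum.inr (1, 1))) with e | e <;> rw [e] at this
    exacts [Or.inl this, Or.inr this]
  have e4 : p (Sum.inr (2, 0)) = 0 ∧ p (Sum.inr (1, 1)) = 0 ∨
      p (Sum.inr (1, 0)) = 0 ∧ p (Sum.inr (2, 1)) = 0 := by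
    have := hp.two_or
    have := hp.three_or
    tauto
  have thin (k : G) (hk : Preserves k) (h1 : mv k p (Sum.inr (0, 2)) = 0)
      (h3 : mv k p (Sum.inr (2, 0)) = 0) (h2 : mv k p (Sum.inr (1, 1)) = 0) : Thin (mv k p) :=
    ⟨(hk p hp).1, h1, h3, h2⟩
  rcases e1 with a | a <;> rcases e4 with ⟨b, c⟩ | ⟨b, c⟩
  · exact ⟨gNeg * gConj, preserves_gNeg.mul preserves_gConj, by decide,
      thin _ (preserves_gNeg.mul preserves_gConj) a c b⟩
  · exact ⟨gNeg, preserves_gNeg, by decide, thin _ preserves_gNeg a b c⟩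
  · exact ⟨1, Preserves.one, by decide, thin _ Preserves.one a b c⟩
  · exact ⟨gConj, preserves_gConj, by decide, thin _ preserves_gConj a c b⟩

theorem compatible (h : G) : Compatible h := by
  intro p q hp hq
  obtain ⟨σ, hσ⟩ := exists_index_perm h
  obtain ⟨i, hi⟩ := σ.surjective 0
  by_cases hi0 : i = 0
  · subst hi0
    exact compatible_of_stabilizer ((hσ 0).trans (congr_arg _ hi)) p q hp hq
  -- Each side of the equivalence forces the absolute values to correspond, so their equality may be
  -- assumed.
  suffices main : (∀ j, level (σ j) q = level j p) →
      (mv h p = q ↔ act (RHom h) hp.point = hq.point) by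
    constructor
    · intro H
      exact (main fun j => by rw [← H, level_mv (hσ j)]).1 H
    · intro H
      exact (main fun j => level_eq_of_act_point_eq hp hq H (hσ j)).2 H
  intro L
  -- The first coordinate is smallest at every window point. Applied to `q` and pulled back by `h`,
  -- this makes the coordinate `i` of `p` at most the coordinate `0`.
  have hmin : level i p ≤ level 0 p := by
    rw [← L i, ← L 0, hi, ← hq.norm_windowMap, ← hq.norm_windowMap]
    have s0 : σ 0 ≠ 0 := fun h0 => hi0 (σ.injective (hi.trans h0.symm))
    have n0 := hq.admissible.norm_model_zero (gamma q)
    have n1 := hq.admissible.norm_model_one (gamma q)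
    have n2 := hq.admissible.norm_model_two (gamma q)
    have := hq.admissible.abs_le
    have := hq.nonneg (Sum.inl (klein 1))
    have := hq.nonneg (Sum.inl (klein 2))
    unfold windowMap
    generalize σ 0 = l at s0
    fin_cases l
    · exact absurd rfl s0
    · exact n0.le.trans (le_trans (by linarith) n1.ge)
    · exact n0.le.trans (le_trans (by linarith) n2.ge)
  -- At `p` the coordinate `0` is also smallest, so the two tie; the formulas for the absolute
  -- values then leave no slack.
  have key : p (Sum.inl (klein i)) = 0 ∧
      |alpha p| + |beta p| = 1 - p (Sum.inl (klein 1)) - p (Sum.inl (klein 2)) := by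
    rw [← hp.norm_windowMap, ← hp.norm_windowMap] at hmin
    have n0 := hp.admissible.norm_model_zero (gamma p)
    have n1 := hp.admissible.norm_model_one (gamma p)
    have n2 := hp.admissible.norm_model_two (gamma p)
    have := hp.admissible.abs_le
    have := hp.nonneg (Sum.inl (klein 1))
    have := hp.nonneg (Sum.inl (klein 2))
    fin_cases i
    · exact absurd rfl hi0
    · have := n1.ge.trans (le_trans hmin n0.le)
      constructor
      · change p (Sum.inl (klein 1)) = 0
        linarith
      · linarith
    · have := n2.ge.trans (le_trans hmin n0.le)
      constructor
      · change p (Sum.inl (klein 2)) = 0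
        linarith
      · linarith
  obtain ⟨k, hk, hkj, ht⟩ := hp.exists_thin key.2
  have h3 : ∃ g : G, g.1 * kleinElt i * g.1⁻¹ = kleinElt 0 ∧ ∃ hw : Window (mv g p),
      act (RHom g) hp.point = hw.point := by
    have hz : mv k p (Sum.inl (klein i)) = 0 := (mv_klein (hkj i) p).trans key.1
    obtain ⟨_, e⟩ := hk p hp
    have comb (l : G) (hl : l.1 * kleinElt i * l.1⁻¹ = kleinElt 0) (hw : Window (mv l (mv k p)))
        (hwe : act (RHom l) ht.toWindow.point = hw.point) : ∃ g : G,
          g.1 * kleinElt i * g.1⁻¹ = kleinElt 0 ∧ ∃ hw : Window (mv g p),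
            act (RHom g) hp.point = hw.point := by
      refine ⟨l * k, ?_, (mv_mul l k p).symm ▸ hw, ?_⟩
      · rw [← hl]
        nth_rw 2 [← hkj i]
        change l.1 * k.1 * _ * (l.1 * k.1)⁻¹ = _
        group
      · rw [act_mul, e]
        exact hwe.trans (Window.point_congr _ _ (mv_mul l k p).symm)
    fin_cases i
    · exact absurd rfl hi0
    · obtain ⟨hq', -, he⟩ := ht.act_gRot hz
      exact comb gRot (by decide) hq'.toWindow he
    · obtain ⟨hq', he⟩ := ht.act_gRot_inv hz
      exact comb gRot⁻¹ (by decide) hq' he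
  obtain ⟨g, hg, hw, hwe⟩ := h3
  -- The element `g` carries `p` to another window point compatibly with the images, and `h * g⁻¹`
  -- lies in the stabilizer already treated.
  have hst : (h * g⁻¹).1 * kleinElt 0 * (h * g⁻¹).1⁻¹ = kleinElt 0 := by
    refine Eq.trans ?_ ((hσ i).trans (congr_arg _ hi))
    rw [← hg]
    change h.1 * g.1⁻¹ * _ * (h.1 * g.1⁻¹)⁻¹ = _
    group
  have := compatible_of_stabilizer hst _ q hw hq
  rw [← hwe, ← act_mul, ← mv_mul, inv_mul_cancel_right] at this
  exact this

/-! ### The windows cover `X` -/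

theorem mv_inr' (h : G) (p : Vertex → ℝ) (a : Fin 4) (n : Fin 3) :
    mv h p (Sum.inr (a, n)) = p (Sum.inr (h.1⁻¹ a, h.2⁻¹ n)) := by
  rw [← mv_inr h p]
  simp

/-- A finite check over the 108 facets: `gRot` adjusts the Klein vertex, `gT` translates the result
into the window, and `gSwap` interchanges the two Klein vertices there. -/
theorem exists_window_facet : ∀ (j b₀ b₁ b₂ b₃ : Fin 3),
    (∀ a, ![b₀, b₁, b₂, b₃] (kleinElt j a) ≠ ![b₀, b₁, b₂, b₃] a) →
      ∃ (c : Fin 6) (i : Fin 3) (l : Fin 2),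
        let g := gSwap ^ l.val * gT ^ c.val * gRot ^ i.val
        g.1 * kleinElt j * g.1⁻¹ = kleinElt 2 ∧
          g.2 (![b₀, b₁, b₂, b₃] (g.1⁻¹ 0)) = 2 ∧ g.2 (![b₀, b₁, b₂, b₃] (g.1⁻¹ 3)) = 2 ∧
          g.2 (![b₀, b₁, b₂, b₃] (g.1⁻¹ 1)) ≠ 2 ∧ g.2 (![b₀, b₁, b₂, b₃] (g.1⁻¹ 2)) ≠ 2 := by
  decide +kernel

/-- `p` is supported on `{(12)(34), (1, 3), (2, m), (3, l), (4, 3)}`. -/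
structure InDelta (m l : Fin 3) (p : Vertex → ℝ) : Prop where
  klein_eq : ∀ k, k ≠ 2 → p (Sum.inl (klein k)) = 0
  inr_eq : ∀ a n, n ≠ (![2, m, l, 2] : Fin 4 → Fin 3) a → p (Sum.inr (a, n)) = 0

theorem exists_inDelta {σ : Finset Vertex} (hσ : σ ∈ X.faces) :
    ∃ (g : G) (m l : Fin 3), m ≠ 2 ∧ l ≠ 2 ∧
      ∀ p : Vertex → ℝ, (∀ v, p v ≠ 0 → v ∈ σ) → InDelta m l (mv g p) := by
  obtain ⟨-, ν, b, hb, hσ⟩ := hσ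
  obtain ⟨j, rfl⟩ := klein_surjective ν
  have eb : b = ![b 0, b 1, b 2, b 3] := by
    funext a
    fin_cases a <;> rfl
  rw [eb] at hb
  obtain ⟨c, i, l, H⟩ := exists_window_facet j _ _ _ _ hb
  rw [← eb] at H
  obtain ⟨h0, h1, h2, h3, h4⟩ := H
  set g := gSwap ^ l.val * gT ^ c.val * gRot ^ i.val
  refine ⟨g, _, _, h3, h4, fun p hs => ⟨fun k hk => ?_, fun a n hn => ?_⟩⟩
  · obtain ⟨τ, hτ⟩ := exists_index_perm g
    obtain ⟨k, rfl⟩ := τ.surjective k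
    rw [mv_klein (hτ k)]
    by_contra hc
    have := klein_injective (inl_mem_facet.1 (hσ (hs _ hc)))
    subst this
    exact hk (kleinElt_injective ((hτ k).symm.trans h0))
  · rw [mv_inr']
    by_contra hc
    have := inr_mem_facet.1 (hσ (hs _ hc))
    apply hn
    have this : n = g.2 (b (g.1⁻¹ a)) := Equiv.Perm.inv_eq_iff_eq.1 this.symm
    rw [this]
    fin_cases a
    exacts [h1, rfl, rfl, h2]

theorem InDelta.window {m l : Fin 3} {p : Vertex → ℝ} (h : InDelta m l p) (hm : m ≠ 2) (hl : l ≠ 2)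
    (hp : p ∈ realization X) : Window p := by
  refine Window.of_mem hp ?_
  simp only [outside, List.forall_mem_cons]
  exact ⟨h.klein_eq 0 (by decide), h.inr_eq 0 0 (show (0 : Fin 3) ≠ 2 by decide), h.inr_eq 0 1 (show (1 : Fin 3) ≠ 2 by decide),
    h.inr_eq 3 0 (show (0 : Fin 3) ≠ 2 by decide), h.inr_eq 3 1 (show (1 : Fin 3) ≠ 2 by decide), h.inr_eq 1 2 hm.symm,
    h.inr_eq 2 2 hl.symm, by simp⟩

theorem exists_window_zero {p : Vertex → ℝ} (hp : p ∈ realization X) :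
    ∃ g, Window (mv g p) ∧ mv g p (Sum.inl (klein 1)) = 0 := by
  obtain ⟨σ, hσ, hs⟩ := hp.2.2
  obtain ⟨g, m, l, hm, hl, H⟩ := exists_inDelta hσ
  exact ⟨g, (H p hs).window hm hl (mv_mem_realization _ hp), (H p hs).klein_eq 1 (by decide)⟩

theorem exists_window {p : Vertex → ℝ} (hp : p ∈ realization X) : ∃ g, Window (mv g p) :=
  (exists_window_zero hp).imp fun _ h => h.1

/-! ### The images of the windows cover `CP²` -/

/-- A point of the window with given coordinates. -/
def windowPoint (x y a a' b b' c c' : ℝ) : Vertex → ℝ :=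
  Sum.elim (fun ν => if ν = klein 1 then x else if ν = klein 2 then y else 0)
    fun v => ![![0, 0, a'], ![b, c', 0], ![b', c, 0], ![0, 0, a]] v.1 v.2

theorem klein_ne {j k : Fin 3} (h : j ≠ k) : klein j ≠ klein k := fun e => h (klein_injective e)

theorem Admissible.exists_window {x y α β γ : ℝ} (h : Admissible x y α β)
    (hγ : |α| + |γ| ≤ 1 - x - y) : ∃ p, ∃ hp : Window p, hp.point = h.point γ := by
  -- This inverts the linear parametrisation: `b - c' = (γ + β) / 2` and `b' - c = (γ - β) / 2` are
  -- split into positive and negative parts. Their total is the larger of `|β|` and `|γ|`, so the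
  -- two bounds leave `a` and `a'` nonnegative.
  set b := max 0 ((γ + β) / 2) with hb
  set c' := max 0 (-((γ + β) / 2)) with hc'
  set b' := max 0 ((γ - β) / 2) with hb'
  set c := max 0 (-((γ - β) / 2)) with hc
  set a := (1 - x - y - (b + b' + c + c') + α) / 2 with ha
  set a' := (1 - x - y - (b + b' + c + c') - α) / 2 with ha'
  set p := windowPoint x y a a' b b' c c' with hp
  have h1 : (b = 0 ∨ c' = 0) ∧ b - c' = (γ + β) / 2 ∧ b + c' = |(γ + β) / 2| := by
    rcases le_total 0 ((γ + β) / 2) with h0 | h0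
    · rw [hb, hc', max_eq_right h0, max_eq_left (by linarith), abs_of_nonneg h0]
      exact ⟨Or.inr rfl, by ring, by ring⟩
    · rw [hb, hc', max_eq_left h0, max_eq_right (by linarith), abs_of_nonpos h0]
      exact ⟨Or.inl rfl, by ring, by ring⟩
  have h2 : (b' = 0 ∨ c = 0) ∧ b' - c = (γ - β) / 2 ∧ b' + c = |(γ - β) / 2| := by
    rcases le_total 0 ((γ - β) / 2) with h0 | h0
    · rw [hb', hc, max_eq_right h0, max_eq_left (by linarith), abs_of_nonneg h0]
      exact ⟨Or.inr rfl, by ring, by ring⟩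
    · rw [hb', hc, max_eq_left h0, max_eq_right (by linarith), abs_of_nonpos h0]
      exact ⟨Or.inl rfl, by ring, by ring⟩
  have hsum : b + b' + c + c' ≤ 1 - x - y - |α| := by
    have e : b + b' + c + c' = |(γ + β) / 2| + |(γ - β) / 2| := by
      rw [← h1.2.2, ← h2.2.2]
      ring
    have := h.abs_le
    rw [e]
    have hβ := _root_.abs_le.1 (show |β| ≤ 1 - x - y - |α| by linarith)
    have hγ := _root_.abs_le.1 (show |γ| ≤ 1 - x - y - |α| by linarith)
    rcases abs_cases ((γ + β) / 2) with ⟨e, _⟩ | ⟨e, _⟩ <;>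
      rcases abs_cases ((γ - β) / 2) with ⟨e', _⟩ | ⟨e', _⟩ <;> rw [e, e'] <;> linarith
  have ha0 : 0 ≤ a := by linarith [neg_abs_le α]
  have ha0' : 0 ≤ a' := by linarith [le_abs_self α]
  have k0 : p (Sum.inl (klein 0)) = 0 := by
    rw [hp, windowPoint, Sum.elim_inl, if_neg (klein_ne (by decide)), if_neg (klein_ne (by decide))]
  have k1 : p (Sum.inl (klein 1)) = x := by rw [hp, windowPoint, Sum.elim_inl, if_pos rfl]
  have k2 : p (Sum.inl (klein 2)) = y := by
    rw [hp, windowPoint, Sum.elim_inl, if_neg (klein_ne (by decide)), if_pos rfl]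
  have hw : Window p := by
    refine ⟨?_, ?_, k0, ?_, ?_, rfl, rfl, ?_, h1.1, h2.1⟩
    · rw [forall_vertex]
      constructor
      · intro j
        fin_cases j
        exacts [k0.ge, h.nonneg_left.trans_eq k1.symm, h.nonneg_right.trans_eq k2.symm]
      · intro i n
        fin_cases i <;> fin_cases n
        exacts [le_rfl, le_rfl, ha0', le_max_left _ _, le_max_left _ _, le_rfl, le_max_left _ _,
          le_max_left _ _, le_rfl, le_rfl, le_rfl, ha0]
    · rw [sum_vertex]
      simp only [Fin.sum_univ_three, Fin.sum_univ_four, k0, k1, k2]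
      change 0 + x + y + (0 + 0 + a' + (b + c' + 0) + (b' + c + 0) + (0 + 0 + a)) = 1
      rw [ha, ha']
      ring
    · intro n hn
      fin_cases n
      exacts [rfl, rfl, absurd rfl hn]
    · intro n hn
      fin_cases n
      exacts [rfl, rfl, absurd rfl hn]
    · rw [k1, k2]
      exact h.eq_zero_or
  refine ⟨p, hw, (hw.congr_point h k1 k2 ?_ ?_ ?_).symm⟩
  · change a - a' = α
    rw [ha, ha']
    ring
  · change b - b' + c - c' = β
    linarith
  · change b + b' - c - c' = γ
    linarith

/-- `x` is in the image of a translate of the window. -/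
def Reached (x : CP2) : Prop := ∃ (g : G) (p : Vertex → ℝ) (hp : Window p), act (RHom g) hp.point = x

theorem Reached.of_act {g : G} {x : CP2} (h : Reached (act (RHom g) x)) : Reached x := by
  obtain ⟨k, p, hp, e⟩ := h
  refine ⟨g⁻¹ * k, p, hp, ?_⟩
  rw [act_mul, e, map_inv, map_inv, Equiv.Perm.inv_eq_iff_eq]

theorem Reached.of_window {p : Vertex → ℝ} (hp : Window p) : Reached hp.point :=
  ⟨1, p, hp, by rw [map_one, map_one]; rfl⟩

/-- If `|α| + |γ|` is too large for the window, then `|β| < |γ|`. After `gT` the parameters `-β` and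
`γ + (1 - x - y)` satisfy the bound. -/
theorem Admissible.reached_of_mem {x y α β γ : ℝ} (h : Admissible x y α β)
    (h0 : -(1 - x - y) ≤ γ) (h1 : γ ≤ 0) : Reached (h.point γ) := by
  by_cases hs : |α| + |γ| ≤ 1 - x - y
  · obtain ⟨p, hp, e⟩ := h.exists_window hs
    rw [← e]
    exact Reached.of_window hp
  · apply Reached.of_act (g := gT)
    rw [h.act_gT]
    rw [not_le, abs_of_nonpos h1] at hs
    have := h.abs_le
    obtain ⟨p, hp, e⟩ := h.rot.exists_window (γ := γ + (1 - x - y)) (by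
      rw [abs_neg, abs_of_nonneg (a := γ + (1 - x - y)) (by linarith)]
      linarith)
    rw [← e]
    exact Reached.of_window hp

theorem Admissible.reached_of_nonpos {x y γ : ℝ} (n : ℕ) (h1 : γ ≤ 0) {α β : ℝ}
    (h : Admissible x y α β) (h0 : -(n * (1 - x - y)) ≤ γ) :
    Reached (h.point γ) := by
  induction n generalizing γ α β with
  | zero =>
    refine h.reached_of_mem (le_trans ?_ h0) h1
    simpa using h.e_nonneg
  | succ n ih =>
    by_cases hc : γ + (1 - x - y) ≤ 0
    · apply Reached.of_act (g := gT)
      rw [h.act_gT]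
      refine ih hc h.rot ?_
      push_cast at h0
      linarith
    · exact h.reached_of_mem (by linarith) h1

/-- Conjugation makes `γ` nonpositive, and finitely many applications of `gT` then raise it into the
last interval of length `1 - x - y` below zero. -/
theorem Admissible.reached {x y α β : ℝ} (h : Admissible x y α β) (γ : ℝ) :
    Reached (h.point γ) := by
  rcases h.e_nonneg.eq_or_lt with he | he
  · rw [h.point_congr he.symm γ 0]
    exact h.reached_of_nonpos 0 le_rfl (by simp)
  obtain ⟨n, hn⟩ := exists_nat_ge (|γ| / (1 - x - y))
  rw [div_le_iff₀ he] at hn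
  rcases le_total γ 0 with hγ | hγ
  · exact h.reached_of_nonpos n hγ (by linarith [neg_abs_le γ])
  · apply Reached.of_act (g := gConj)
    rw [h.act_gConj]
    exact h.reflect.reached_of_nonpos n (by linarith) (by linarith [le_abs_self γ])

/-- The half-sum of the arguments becomes the common factor and the half-difference the symmetric
phase. The choice `u = 0` in degenerate cases matches `phase`, which is zero by convention when its
denominator vanishes. -/
theorem exists_polar (z w : ℂ) : ∃ (t : ℂ) (u : ℝ), ‖t‖ = 1 ∧ (z = 0 ∨ w = 0 → u = 0) ∧
    z = t * (‖z‖ * Complex.exp (u * Complex.I)) ∧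
      w = t * (‖w‖ * Complex.exp ((-u : ℝ) * Complex.I)) := by
  by_cases hz : z = 0
  · refine ⟨Complex.exp (w.arg * Complex.I), 0, Complex.norm_exp_ofReal_mul_I _, fun _ => rfl,
      by simp [hz], ?_⟩
    nth_rw 1 [← Complex.norm_mul_exp_arg_mul_I w]
    simp [mul_comm]
  by_cases hw : w = 0
  · refine ⟨Complex.exp (z.arg * Complex.I), 0, Complex.norm_exp_ofReal_mul_I _, fun _ => rfl,
      ?_, by simp [hw]⟩
    nth_rw 1 [← Complex.norm_mul_exp_arg_mul_I z]
    simp [mul_comm]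
  refine ⟨Complex.exp (((z.arg + w.arg) / 2 : ℝ) * Complex.I), (z.arg - w.arg) / 2,
    Complex.norm_exp_ofReal_mul_I _, fun h => (h.elim hz hw).elim, ?_, ?_⟩
  · nth_rw 1 [← Complex.norm_mul_exp_arg_mul_I z]
    rw [mul_left_comm, ← Complex.exp_add]
    congr 2
    push_cast
    ring
  · nth_rw 1 [← Complex.norm_mul_exp_arg_mul_I w]
    rw [mul_left_comm, ← Complex.exp_add]
    congr 2
    push_cast
    ring

theorem exists_admissible_point {z : C3} (hz : z ≠ 0) (hs : ∑ i, ‖z i‖ = 1)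
    (h1 : ‖z 0‖ ≤ ‖z 1‖) (h2 : ‖z 0‖ ≤ ‖z 2‖) :
    ∃ (x y α β : ℝ) (h : Admissible x y α β) (γ : ℝ),
      Projectivization.mk ℂ z hz = h.point γ := by
  obtain ⟨t, u, ht, hu, e1, e2⟩ := exists_polar (z 1) (z 2)
  have ht0 : t ≠ 0 := by rintro rfl; simp at ht
  obtain ⟨α, β, e0⟩ := exists_diamond_eq (3 * (z 0 / t))
  have hn : |α| + |β| = 3 * ‖z 0‖ := by
    rw [← norm_diamond, e0, norm_mul, norm_div, ht]
    simp
  rw [Fin.sum_univ_three] at hs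
  set x := max 0 (‖z 1‖ - ‖z 2‖) with hx
  set y := max 0 (‖z 2‖ - ‖z 1‖) with hy
  have hxy : (x = 0 ∨ y = 0) ∧ x - y = ‖z 1‖ - ‖z 2‖ := by
    rcases le_total ‖z 1‖ ‖z 2‖ with h | h
    · rw [hx, hy, max_eq_left (by linarith), max_eq_right (by linarith)]
      exact ⟨Or.inl rfl, by ring⟩
    · rw [hx, hy, max_eq_right (by linarith), max_eq_left (by linarith)]
      exact ⟨Or.inr rfl, by ring⟩
  have hx0 : 0 ≤ x := le_max_left _ _
  have hy0 : 0 ≤ y := le_max_left _ _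
  have h : Admissible x y α β := by
    refine ⟨hx0, hy0, hxy.1, ?_⟩
    rw [hn]
    rcases hxy.1 with h | h <;> linarith
  refine ⟨x, y, α, β, h, 6 * (1 - x - y) * u / Real.pi, mk_eq_mk_of _ _ t fun i => ?_⟩
  have hphase : phase x y (6 * (1 - x - y) * u / Real.pi) = u := by
    rw [phase]
    by_cases he : 1 - x - y = 0
    · rw [he, hu]
      · simp
      · rcases hxy.1 with h | h
        · left
          rw [← norm_eq_zero]
          linarith [norm_nonneg (z 0)]
        · right
          rw [← norm_eq_zero]
          linarith [norm_nonneg (z 0)]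
    · field_simp
  fin_cases i
  · change z 0 = t * model _ _ _ _ _ 0
    rw [model_zero, e0]
    field_simp
  · change z 1 = t * model _ _ _ _ _ 1
    rw [model_one, hphase]
    refine e1.trans ?_
    congr 3
    linarith
  · change z 2 = t * model _ _ _ _ _ 2
    rw [model_two, hphase]
    refine e2.trans ?_
    congr 3
    linarith

theorem exists_conj_eq : ∀ j k : Fin 3, ∃ θ : Equiv.Perm (Fin 4),
    θ * kleinElt j * θ⁻¹ = kleinElt k := by
  decide

/-- `S₄` moves a coordinate of least absolute value to the first place. A positive rescaling then
gives `model` coordinates. -/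
theorem reached (x : CP2) : Reached x := by
  induction x using Projectivization.ind with
  | h z hz =>
  obtain ⟨j, -, hj⟩ := Finset.exists_min_image Finset.univ (fun i => ‖z i‖) Finset.univ_nonempty
  obtain ⟨θ, hθ⟩ := exists_conj_eq j 0
  have hj' : ∀ k, ‖(lift (θ, 1)).1 z 0‖ ≤ ‖(lift (θ, 1)).1 z k‖ := by
    intro k
    obtain ⟨σ, hσ⟩ := exists_index_perm (θ, 1)
    obtain ⟨i, rfl⟩ := σ.surjective k
    rw [norm_lift_apply (h := (θ, 1)) hθ, norm_lift_apply (hσ i)]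
    exact hj i (Finset.mem_univ i)
  apply Reached.of_act (g := (θ, 1))
  rw [act_RHom_mk]
  set w := (lift (θ, 1)).1 z with hw
  have hw0 : w ≠ 0 := (map_ne_zero_iff _ (lift (θ, 1)).1.injective).2 hz
  have hN : 0 < ∑ i, ‖w i‖ := by
    refine (Finset.sum_nonneg fun i _ => norm_nonneg _).lt_of_ne fun h => hw0 ?_
    ext i
    have := (Finset.sum_eq_zero_iff_of_nonneg fun i _ => norm_nonneg (w i)).1 h.symm i
      (Finset.mem_univ i)
    simpa using this
  set N := ∑ i, ‖w i‖ with hNdef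
  have hv0 : ((N⁻¹ : ℝ) : ℂ) • w ≠ 0 := smul_ne_zero (by
    rw [Complex.ofReal_ne_zero]; exact inv_ne_zero hN.ne') hw0
  have hn (i : Fin 3) : ‖(((N⁻¹ : ℝ) : ℂ) • w) i‖ = N⁻¹ * ‖w i‖ := by
    rw [PiLp.smul_apply, norm_smul, Complex.norm_real, Real.norm_eq_abs,
      abs_of_pos (inv_pos.2 hN)]
  obtain ⟨x, y, α, β, h, γ, e⟩ := exists_admissible_point hv0
    (by simp only [hn, ← Finset.mul_sum]; exact inv_mul_cancel₀ hN.ne')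
    (by rw [hn, hn]; exact mul_le_mul_of_nonneg_left (hj' 1) (inv_pos.2 hN).le)
    (by rw [hn, hn]; exact mul_le_mul_of_nonneg_left (hj' 2) (inv_pos.2 hN).le)
  have : Projectivization.mk ℂ w hw0 = Projectivization.mk ℂ _ hv0 :=
    ((Projectivization.mk_eq_mk_iff' ℂ _ _ hv0 hw0).2 ⟨_, rfl⟩).symm
  rw [this, e]
  exact h.reached γ

/-! ### The topology of `CP²` and of `|X|` -/

theorem continuous_mk {T : Type*} [TopologicalSpace T] {F : T → C3} (hF : Continuous F)
    (h0 : ∀ t, F t ≠ 0) : Continuous fun t => Projectivization.mk ℂ (F t) (h0 t) :=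
  (continuous_quotient_mk' (s := projectivizationSetoid ℂ C3)).comp (hF.subtype_mk h0)

theorem continuous_of_comp_mk {T : Type*} [TopologicalSpace T] {f : CP2 → T}
    (h : Continuous fun z : {z : C3 // z ≠ 0} => f (Projectivization.mk ℂ z.1 z.2)) :
    Continuous f :=
  continuous_coinduced_dom.2 h

theorem continuous_projMap (g : Uhat) : Continuous (projMap g) := by
  refine continuous_of_comp_mk ?_
  exact continuous_mk ((LinearMap.continuous_of_finiteDimensional g.1.toLinearMap).comp
    continuous_subtype_val) fun z => (map_ne_zero_iff g.1 g.1.injective).2 z.2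

theorem continuous_act (x : PUhat) : Continuous (act x) := by
  induction x using QuotientGroup.induction_on with
  | H g => exact continuous_projMap g

/-- The orthogonal projector onto a line, as a matrix. -/
def projector (z : C3) (i j : Fin 3) : ℂ := z i * conj (z j) / ((‖z‖ ^ 2 : ℝ) : ℂ)

theorem projector_smul {t : ℂ} (ht : t ≠ 0) (z : C3) : projector (t • z) = projector z := by
  funext i j
  have h : (‖t‖ : ℂ) ^ 2 ≠ 0 := by simpa using ht
  rw [projector, projector, norm_smul, PiLp.smul_apply, PiLp.smul_apply, smul_eq_mul, smul_eq_mul,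
    map_mul, mul_pow, Complex.ofReal_mul, Complex.ofReal_pow, ← Complex.mul_conj',
    mul_mul_mul_comm, mul_div_mul_left]
  rwa [Complex.mul_conj']

/-- The projector onto a point of `CP²`. -/
def cpProjector : CP2 → Fin 3 → Fin 3 → ℂ :=
  Projectivization.lift (fun z => projector z.1) (by
    rintro ⟨z, hz⟩ ⟨w, hw⟩ t (rfl : z = t • w)
    exact projector_smul (by rintro rfl; simp at hz) w)

theorem continuous_cpProjector : Continuous cpProjector := by
  refine continuous_of_comp_mk (continuous_pi fun i => continuous_pi fun j => ?_)
  change Continuous fun z : {z : C3 // z ≠ 0} => projector z.1 i j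
  unfold projector
  refine Continuous.div (by fun_prop) (by fun_prop) fun z => ?_
  rw [Complex.ofReal_ne_zero]
  exact pow_ne_zero 2 (norm_ne_zero_iff.2 z.2)

/-- A nonzero column of the projector spans the line. Embedding `CP²` in matrices in this way makes
it Hausdorff. -/
theorem cpProjector_injective : Function.Injective cpProjector := by
  intro x y h
  induction x using Projectivization.ind with
  | h z hz =>
  induction y using Projectivization.ind with
  | h w hw =>
  have h' (i j) : projector z i j = projector w i j := congr_fun (congr_fun h i) j
  obtain ⟨j, hj⟩ : ∃ j, w j ≠ 0 := by
    by_contra! hc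
    exact hw (PiLp.ext hc)
  have nz : ((‖z‖ ^ 2 : ℝ) : ℂ) ≠ 0 :=
    Complex.ofReal_ne_zero.2 (pow_ne_zero 2 (norm_ne_zero_iff.2 hz))
  have nw : ((‖w‖ ^ 2 : ℝ) : ℂ) ≠ 0 :=
    Complex.ofReal_ne_zero.2 (pow_ne_zero 2 (norm_ne_zero_iff.2 hw))
  have hj' : conj (z j) ≠ 0 := by
    intro h0
    have := h' j j
    rw [projector, h0, mul_zero, zero_div, projector, eq_comm, div_eq_zero_iff] at this
    simp [hj] at this
    exact hw this
  refine mk_eq_mk_of hz hw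
    (((‖z‖ ^ 2 : ℝ) : ℂ) * conj (w j) / (((‖w‖ ^ 2 : ℝ) : ℂ) * conj (z j))) fun i => ?_
  have := h' i j
  rw [projector, projector, div_eq_div_iff nz nw] at this
  field_simp
  linear_combination this

instance instT2SpaceCP2 : T2Space CP2 :=
  T2Space.of_injective_continuous cpProjector_injective continuous_cpProjector

theorem isClosed_realization {V : Type*} [Fintype V] (K : PreAbstractSimplicialComplex V) :
    IsClosed (realization K) := by
  have : realization K = {p | ∀ v, 0 ≤ p v} ∩ ({p | ∑ v, p v = 1} ∩
      ⋃ σ ∈ K.faces, {p | ∀ v ∉ σ, p v = 0}) := by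
    ext p
    simp only [realization, Set.mem_ofPred_eq, Set.mem_inter_iff, Set.mem_iUnion, exists_prop,
      not_imp_comm, ne_eq]
  rw [this]
  refine IsClosed.inter ?_ (IsClosed.inter ?_ ?_)
  · simp only [Set.ofPred_forall]
    exact isClosed_iInter fun v => isClosed_le continuous_const (continuous_apply v)
  · exact isClosed_eq (by fun_prop) continuous_const
  · refine Set.Finite.isClosed_biUnion (Set.toFinite _) fun σ _ => ?_
    simp only [Set.ofPred_forall]
    exact isClosed_iInter fun v => isClosed_iInter fun _ =>
      isClosed_eq (continuous_apply v) continuous_const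

theorem isCompact_realization {V : Type*} [Fintype V] (K : PreAbstractSimplicialComplex V) :
    IsCompact (realization K) := by
  refine (isCompact_Icc (a := (0 : V → ℝ)) (b := 1)).of_isClosed_subset (isClosed_realization K) ?_
  intro p hp
  refine ⟨hp.1, fun v => ?_⟩
  rw [Pi.one_apply, ← hp.2.1]
  exact Finset.single_le_sum (fun w _ => hp.1 w) (Finset.mem_univ v)

/-! ### The map on `|X|` -/

/-- The equivariant extension of the map on the window. -/
def toCP2 (p : realization X) : CP2 :=
  act (RHom (exists_window p.2).choose⁻¹) (exists_window p.2).choose_spec.point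

/-- The element chosen in the definition is immaterial: two windows containing translates of `p` are
related by a compatible element. -/
theorem toCP2_eq (p : realization X) {g : G} (hw : Window (mv g p.1)) :
    toCP2 p = act (RHom g⁻¹) hw.point := by
  have h := exists_window p.2
  have := (compatible (g * h.choose⁻¹) _ _ h.choose_spec hw).1 (by
    rw [mv_mul, mv_inv_mv])
  rw [← this, ← act_mul, inv_mul_cancel_left]
  rfl

theorem toCP2_window (p : realization X) (hp : Window p.1) : toCP2 p = hp.point := by
  have hw : Window (mv 1 p.1) := by rwa [mv_one]
  rw [toCP2_eq p hw, inv_one, map_one, map_one]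
  exact Window.point_congr hw hp (mv_one _)

theorem realize_symEquiv (h : G) (p : realization X) :
    (realize (symEquiv h) p).1 = mv h p.1 := rfl

theorem toCP2_realize (h : G) (p : realization X) :
    toCP2 (realize (symEquiv h) p) = act (RHom h) (toCP2 p) := by
  obtain ⟨g, hg⟩ := exists_window p.2
  have e : mv (g * h⁻¹) (realize (symEquiv h) p).1 = mv g p.1 := by
    rw [realize_symEquiv, mv_mul, mv_inv_mv]
  have hw : Window (mv (g * h⁻¹) (realize (symEquiv h) p).1) := by rwa [e]
  rw [toCP2_eq p hg, toCP2_eq _ hw, ← act_mul, mul_inv_rev, inv_inv, Window.point_congr hw hg e]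

/-- This is the direction of `compatible` from images back to points, after both points are moved
into the window. -/
theorem toCP2_injective : Function.Injective toCP2 := by
  intro p q H
  obtain ⟨g, hg⟩ := exists_window p.2
  obtain ⟨k, hk⟩ := exists_window q.2
  rw [toCP2_eq p hg, toCP2_eq q hk, map_inv _ k, map_inv _ (RHom k), eq_comm,
    Equiv.Perm.inv_eq_iff_eq, ← act_mul, eq_comm, ← compatible _ _ _ hg hk] at H
  rw [mv_mul, mv_inv_mv] at H
  exact Subtype.ext (by rw [← mv_inv_mv k p.1, H, mv_inv_mv])

theorem toCP2_surjective : Function.Surjective toCP2 := by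
  intro x
  obtain ⟨g, p, hp, rfl⟩ := reached x
  refine ⟨realize (symEquiv g) ⟨p, hp.mem_realization⟩, ?_⟩
  rw [toCP2_realize, toCP2_window _ hp]

theorem continuous_mul_cexp_div {T : Type*} [TopologicalSpace T] {r : T → ℂ} {γ e : T → ℝ}
    (hr : Continuous r) (hγ : Continuous γ) (he : Continuous e) (hre : ∀ t, ‖r t‖ ≤ e t) :
    Continuous fun t => r t * Complex.exp ((γ t / e t : ℝ) * Complex.I) := by
  rw [continuous_iff_continuousAt]
  intro t
  by_cases h : e t = 0
  · have h0 : r t = 0 := norm_le_zero_iff.1 ((hre t).trans_eq h)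
    rw [ContinuousAt, h0, zero_mul]
    refine squeeze_zero_norm (a := fun t => ‖r t‖) (fun s => ?_) ?_
    · rw [norm_mul, Complex.norm_exp_ofReal_mul_I, mul_one]
    · have := hr.norm.tendsto t
      rwa [h0, norm_zero] at this
  · have : ContinuousAt (fun t => γ t / e t) t := hγ.continuousAt.div he.continuousAt h
    fun_prop

/-- The phase oscillates as the weight of `(12)(34)` tends to 1. Multiplying the representative by
the unit `w` makes the third coordinate real. The other two are bounded by `e`, which tends to 0
there, so their phases do no harm. -/
theorem continuous_point {T : Type*} [TopologicalSpace T] {q : T → Vertex → ℝ}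
    (hq : Continuous q) (hw : ∀ t, Window (q t)) (h1 : ∀ t, q t (Sum.inl (klein 1)) = 0) :
    Continuous fun t => (hw t).point := by
  have hv (v) : Continuous fun t => q t v := (continuous_apply v).comp hq
  have hα : Continuous fun t => alpha (q t) := by unfold alpha; fun_prop
  have hβ : Continuous fun t => beta (q t) := by unfold beta; fun_prop
  have hγ : Continuous fun t => gamma (q t) := by unfold gamma; fun_prop
  set e : T → ℝ := fun t => 1 - q t (Sum.inl (klein 2)) with he
  have hec : Continuous e := by fun_prop
  have hle (t) : |alpha (q t)| + |beta (q t)| ≤ e t := by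
    have := (hw t).admissible.abs_le
    rwa [h1, sub_zero] at this
  set w : T → ℂ := fun t => Complex.exp ((phase 0 (q t (Sum.inl (klein 2))) (gamma (q t)) : ℝ) *
    Complex.I) with hwdef
  have hF0 (t : T) : w t • windowMap (q t) ≠ 0 :=
    smul_ne_zero (Complex.exp_ne_zero _) (hw t).windowMap_ne_zero
  have heq : (fun t => (hw t).point) = fun t => Projectivization.mk ℂ (w t • windowMap (q t))
      (hF0 t) := by
    funext t
    exact ((Projectivization.mk_eq_mk_iff' ℂ _ _ _ _).2 ⟨w t, rfl⟩).symm
  rw [heq]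
  refine continuous_mk ?_ _
  have hph (t : T) : phase 0 (q t (Sum.inl (klein 2))) (gamma (q t)) =
      (Real.pi * gamma (q t) / 6) / e t := by
    rw [phase, sub_zero, he, div_div]
  refine (PiLp.continuous_toLp 2 _).comp (continuous_pi fun i => ?_) |>.congr fun t => rfl
  fin_cases i
  · change Continuous fun t => w t * (diamond (alpha (q t)) (beta (q t)) / 3)
    refine (continuous_mul_cexp_div (r := fun t => diamond (alpha (q t)) (beta (q t)) / 3)
      (γ := fun t => Real.pi * gamma (q t) / 6) (e := e) ?_ ?_ hec fun t => ?_).congr fun t => ?_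
    · exact (continuous_diamond.comp (hα.prodMk hβ)).div_const 3
    · fun_prop
    · rw [norm_div, norm_diamond]
      have := hle t
      have := add_nonneg (abs_nonneg (alpha (q t))) (abs_nonneg (beta (q t)))
      simp only [Complex.norm_ofNat]
      linarith
    · rw [mul_comm, ← hph]
  · change Continuous fun t => w t * windowMap (q t) 1
    refine (continuous_mul_cexp_div
      (r := fun t => (((e t) / 2 - (|alpha (q t)| + |beta (q t)|) / 6 : ℝ) : ℂ))
      -- The factor 2 is the phase of the second coordinate together with the equal phase of `w`.
      (γ := fun t => 2 * (Real.pi * gamma (q t) / 6)) (e := e) ?_ ?_ hec fun t => ?_).congr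
        fun t => ?_
    · fun_prop
    · fun_prop
    · rw [Complex.norm_real, Real.norm_eq_abs, abs_le]
      have := hle t
      have := add_nonneg (abs_nonneg (alpha (q t))) (abs_nonneg (beta (q t)))
      constructor <;> linarith
    · rw [windowMap, model_one, h1, hwdef, mul_left_comm, ← Complex.exp_add, hph, zero_add,
        sub_zero]
      congr 2
      push_cast
      ring
  · change Continuous fun t => w t * windowMap (q t) 2
    have : (fun t => w t * windowMap (q t) 2) = fun t =>
        ((q t (Sum.inl (klein 2)) + (e t) / 2 - (|alpha (q t)| + |beta (q t)|) / 6 : ℝ) : ℂ) := by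
      funext t
      rw [windowMap, model_two, h1, hwdef, mul_left_comm, ← Complex.exp_add, sub_zero,
        Complex.ofReal_neg, neg_mul, add_neg_cancel, Complex.exp_zero, mul_one]
    rw [this]
    fun_prop

theorem continuous_mv (g : G) : Continuous (mv g) :=
  continuous_pi fun _ => continuous_apply _

/-- Finitely many closed pieces `S g` cover `|X|`. The weight of `(13)(24)` is required to vanish
after translation, so that `continuous_point` applies on each. -/
theorem continuous_toCP2 : Continuous toCP2 := by
  let S (g : G) : Set (realization X) :=
    {p | (∀ v ∈ outside, mv g p.1 v = 0) ∧ mv g p.1 (Sum.inl (klein 1)) = 0}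
  have hc (v : Vertex) (g : G) : Continuous fun p : realization X => mv g p.1 v :=
    (continuous_apply v).comp ((continuous_mv g).comp continuous_subtype_val)
  have hS (g : G) : IsClosed (S g) := by
    refine IsClosed.inter ?_ (isClosed_eq (hc _ g) continuous_const)
    change IsClosed {p : realization X | ∀ v ∈ outside, mv g p.1 v = 0}
    simp only [Set.ofPred_forall]
    exact isClosed_iInter fun v => isClosed_iInter fun _ => isClosed_eq (hc v g) continuous_const
  refine (locallyFinite_of_finite S).continuous ?_ hS fun g => ?_
  · rw [Set.eq_univ_iff_forall]
    intro p
    obtain ⟨g, hg, h1⟩ := exists_window_zero p.2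
    refine Set.mem_iUnion.2 ⟨g, ?_, h1⟩
    simp only [outside, List.forall_mem_cons]
    exact ⟨hg.zero_klein, hg.zero_one 0 (by decide), hg.zero_one 1 (by decide),
      hg.zero_four 0 (by decide), hg.zero_four 1 (by decide), hg.zero_two, hg.zero_three, by simp⟩
  · rw [continuousOn_iff_continuous_domRestrict]
    have hw (p : S g) : Window (mv g p.1.1) :=
      Window.of_mem (mv_mem_realization _ p.1.2) p.2.1
    have := (continuous_act (RHom g⁻¹)).comp (continuous_point (q := fun p : S g => mv g p.1.1)
      ((continuous_mv g).comp (continuous_subtype_val.comp continuous_subtype_val)) hw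
        fun p => p.2.2)
    exact this.congr fun p => (toCP2_eq p.1 (hw p)).symm

instance : CompactSpace (realization X) := isCompact_iff_compactSpace.1 (isCompact_realization X)

/-- The homeomorphism `|X| → CP²`. -/
def homeo : realization X ≃ₜ CP2 :=
  Continuous.homeoOfEquivCompactToT2
    (f := Equiv.ofBijective toCP2 ⟨toCP2_injective, toCP2_surjective⟩) continuous_toCP2

/-! ### The explicit formulas -/

theorem toCP2_eq_mk {p : realization X} (hp : Window p.1) {z : C3} (h : windowMap p.1 = z) :
    ∃ hz : z ≠ 0, toCP2 p = Projectivization.mk ℂ z hz := by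
  subst h
  exact ⟨hp.windowMap_ne_zero, toCP2_window p hp⟩

theorem eq_zero_of_notMem {p : Vertex → ℝ} {S : Set Vertex} (h : ∀ v, p v ≠ 0 → v ∈ S) {v : Vertex}
    (hv : v ∉ S) : p v = 0 := by
  by_contra hc
  exact hv (h v hc)

theorem toCP2_formula₁ (p : realization X) (h : ∀ v, p.1 v ≠ 0 → v ∈ Set.range delta₁) :
    ∃ hz : formula₁ (fun i => p.1 (delta₁ i)) ≠ 0, toCP2 p = Projectivization.mk ℂ _ hz := by
  have hp : Window p.1 := Window.of_mem p.2 fun v hv => eq_zero_of_notMem h (by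
    revert v; decide)
  have h1 : p.1 (Sum.inl (klein 1)) = 0 := eq_zero_of_notMem h (by decide)
  have h2 : p.1 (Sum.inr (1, 1)) = 0 := eq_zero_of_notMem h (by decide)
  have h3 : p.1 (Sum.inr (2, 0)) = 0 := eq_zero_of_notMem h (by decide)
  refine toCP2_eq_mk hp ?_
  rw [formula₁, chart_eq_model, windowMap, h1, alpha, beta, gamma, h2, h3]
  simp only [sub_zero, add_zero]
  rfl

theorem toCP2_formula₂ (p : realization X) (h : ∀ v, p.1 v ≠ 0 → v ∈ Set.range delta₂) :
    ∃ hz : formula₂ (fun i => p.1 (delta₂ i)) ≠ 0, toCP2 p = Projectivization.mk ℂ _ hz := by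
  have hp : Window p.1 := Window.of_mem p.2 fun v hv => eq_zero_of_notMem h (by
    revert v; decide)
  have h1 : p.1 (Sum.inl (klein 1)) = 0 := eq_zero_of_notMem h (by decide)
  have h2 : p.1 (Sum.inr (1, 1)) = 0 := eq_zero_of_notMem h (by decide)
  have h3 : p.1 (Sum.inr (2, 1)) = 0 := eq_zero_of_notMem h (by decide)
  refine toCP2_eq_mk hp ?_
  rw [formula₂, chart_eq_model, windowMap, h1, alpha, beta, gamma, h2, h3]
  simp only [sub_zero, add_zero]
  rfl

/-! ### The vertices -/

theorem singleton_mem_faces (v : Vertex) : {v} ∈ X.faces := by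
  have h (j a n) : ({Sum.inl (klein j), Sum.inr (a, n)} : Finset Vertex) ∈ X.faces :=
    inl_inr_mem_faces _ a n
  rcases v with ν | ⟨a, n⟩
  · obtain ⟨j, rfl⟩ := klein_surjective ν
    exact (X.isRelLowerSet_faces (h j 0 0)).2 (by simp) (Finset.singleton_nonempty _)
  · exact (X.isRelLowerSet_faces (h 0 a n)).2 (by simp) (Finset.singleton_nonempty _)

theorem single_mem_realization (v : Vertex) : (Pi.single v 1 : Vertex → ℝ) ∈ realization X := by
  refine ⟨fun w => ?_, by simp, {v}, singleton_mem_faces v, fun w hw => ?_⟩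
  · rw [Pi.single_apply]
    split_ifs <;> norm_num
  · rw [Pi.single_apply] at hw
    simpa using hw

theorem eq_single {p : Vertex → ℝ} (hp : p ∈ realization X) {v : Vertex} (h : p v = 1) :
    p = Pi.single v 1 := by
  have h0 := hp.2.1
  rw [← Finset.add_sum_erase _ _ (Finset.mem_univ v), h, add_eq_left,
    Finset.sum_eq_zero_iff_of_nonneg fun w _ => hp.1 w] at h0
  funext w
  by_cases hw : w = v
  · rw [hw, h, Pi.single_eq_same]
  · rw [h0 w (Finset.mem_erase.2 ⟨hw, Finset.mem_univ w⟩), Pi.single_eq_of_ne hw]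

/-- If `R h` is trivial, equivariance and injectivity of `toCP2` make `h` fix every vertex of `X`.
-/
theorem RHom_injective : Function.Injective RHom := by
  rw [injective_iff_map_eq_one]
  intro h hh
  apply vertexPerm_injective
  rw [map_one]
  ext v : 1
  have e := toCP2_realize h ⟨_, single_mem_realization v⟩
  rw [hh, map_one, Equiv.Perm.one_apply] at e
  have e1 := congr_fun (congr_arg Subtype.val (toCP2_injective e)) (vertexAct h v)
  rw [realize_symEquiv, mv_act] at e1
  change (Pi.single v 1 : Vertex → ℝ) v = (Pi.single v 1 : Vertex → ℝ) (vertexAct h v) at e1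
  rw [Pi.single_eq_same, Pi.single_apply] at e1
  by_contra hc
  rw [vertexPerm_apply, Equiv.Perm.one_apply] at hc
  rw [if_neg hc] at e1
  exact one_ne_zero e1

theorem exists_rep (p : realization X) : ∃ (z : C3) (hz : z ≠ 0),
    toCP2 p = Projectivization.mk ℂ z hz ∧ ∀ j, ‖z j‖ = level j p.1 := by
  obtain ⟨g, hg⟩ := exists_window p.2
  refine ⟨(lift g⁻¹).1 (windowMap (mv g p.1)),
    (map_ne_zero_iff _ (lift g⁻¹).1.injective).2 hg.windowMap_ne_zero, toCP2_eq p hg, fun j => ?_⟩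
  obtain ⟨σ, hσ⟩ := exists_index_perm g⁻¹
  obtain ⟨i, rfl⟩ := σ.surjective j
  rw [norm_lift_apply (hσ i), hg.norm_windowMap, ← level_mv (hσ i), mv_inv_mv]

theorem level_single_klein (j k : Fin 3) :
    level k (Pi.single (Sum.inl (klein j)) 1) = if k = j then 1 else 0 := by
  unfold level totalOverlap overlap
  simp only [Pi.single_apply, reduceCtorEq, if_false, Finset.sum_const_zero, min_self, Sum.inl.injEq,
    klein_injective.eq_iff]
  simp

theorem toCP2_klein (j : Fin 3) (p : realization X) (h : p.1 (Sum.inl (klein j)) = 1) :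
    ∃ hz : EuclideanSpace.single j (1 : ℂ) ≠ 0, toCP2 p = Projectivization.mk ℂ _ hz := by
  obtain ⟨z, hz, e, hl⟩ := exists_rep p
  rw [eq_single p.2 h] at hl
  have h0 : EuclideanSpace.single j (1 : ℂ) ≠ 0 := by simp
  refine ⟨h0, e.trans (mk_eq_mk_of _ _ (z j) fun i => ?_)⟩
  have := hl i
  rw [level_single_klein] at this
  by_cases hij : i = j
  · subst hij
    simp
  · rw [if_neg hij, norm_eq_zero] at this
    simp [this, hij]

/-- The translation of `{1, 2, 3, 4}` that takes `4` to `a`. -/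
def translation : Fin 4 → Equiv.Perm (Fin 4) := ![kleinElt 0, kleinElt 1, kleinElt 2, 1]

theorem rhoFn_translation : ∀ (a : Fin 4) (i j : Fin 3),
    rhoFn (translation a) i j = if j = i then 4 * -tet a i else 0 := by
  decide

theorem sign_translation : ∀ a, Equiv.Perm.sign (translation a) = 1 := by decide

theorem sign_finRotate_pow : ∀ b : Fin 3, Equiv.Perm.sign (finRotate 3 ^ (b.val + 1)) = 1 ∧
    (finRotate 3 ^ (b.val + 1)) 2 = b := by decide

theorem toCP2_inr (a : Fin 4) (b : Fin 3) (p : realization X) (h : p.1 (Sum.inr (a, b)) = 1) :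
    ∃ hz : torusPoint a b ≠ 0, toCP2 p = Projectivization.mk ℂ _ hz := by
  -- The vertex `(4, 3)` has image `(1 : 1 : 1)`, with all normalised coordinates `1/3`. Every other
  -- `(a, b)` is its translate by an element acting diagonally, by signs and powers of `omega`.
  set g : G := (translation a, finRotate 3 ^ (b.val + 1)) with hg
  set q : realization X := ⟨_, single_mem_realization (Sum.inr (3, 2))⟩ with hq
  have hv : vertexAct g (Sum.inr (3, 2)) = Sum.inr (a, b) := by
    rw [hg]
    clear hg hq g q h
    revert a b
    decide
  have hpq : p = realize (symEquiv g) q := by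
    apply Subtype.ext
    rw [realize_symEquiv, eq_comm, mv_eq_iff]
    intro v
    rw [eq_single p.2 h, ← hv, ← vertexPerm_apply, ← vertexPerm_apply]
    simp only [hq, Pi.single_apply, EmbeddingLike.apply_eq_iff_eq]
  have hw : Window q.1 := by
    refine Window.of_mem q.2 fun v hv => Pi.single_eq_of_ne ?_ _
    revert v
    decide
  have hval (v : Vertex) : q.1 v = if v = Sum.inr (3, 2) then 1 else 0 := Pi.single_apply _ _ _
  have hα : alpha q.1 = 1 := by simp [alpha, hval]
  have hβ : beta q.1 = 0 := by simp [beta, hval]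
  have hγ : gamma q.1 = 0 := by simp [gamma, hval]
  have hwm (i : Fin 3) : windowMap q.1 i = 1 / 3 := by
    have hx (j) : q.1 (Sum.inl (klein j)) = 0 := by simp [hval]
    rw [windowMap, hx, hx, hα, hβ, hγ]
    fin_cases i
    · change model _ _ _ _ _ 0 = _
      rw [model_zero, diamond_of_nonneg (by norm_num) (by norm_num)]
      simp
    · change model _ _ _ _ _ 1 = _
      rw [model_one, phase]
      norm_num
    · change model _ _ _ _ _ 2 = _
      rw [model_two, phase]
      norm_num
  have htp (i : Fin 3) : (tet a i : ℂ) * omega ^ ((b.val + 1) * i.val) =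
      (if a = 3 then -1 else 1) * torusPoint a b i := by
    fin_cases a <;> fin_cases i <;> simp [torusPoint, tet, mul_comm]
  have hne : torusPoint a b ≠ 0 := by
    intro h0
    have := htp 0
    rw [h0] at this
    fin_cases a <;> simp [tet] at this
  refine ⟨hne, ?_⟩
  rw [hpq, toCP2_realize, toCP2_window _ hw, Window.point_def, act_RHom_mk]
  refine mk_eq_mk_of _ _ (-(if a = 3 then -1 else 1) / 3) fun i => ?_
  rw [lift_apply_of (h := g) (rhoFn_translation a i), hwm, sign_translation,
    (sign_finRotate_pow b).1, (sign_finRotate_pow b).2]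
  simp only [conjPow_one]
  push_cast
  linear_combination (-1 / 3) * htp i

/-! ### The disks -/

/-- The condition for a point of `|X|` to lie in the star of the vertex `klein j`. -/
def InStar (j : Fin 3) (p : Vertex → ℝ) : Prop :=
  (∀ k, k ≠ j → p (Sum.inl (klein k)) = 0) ∧ overlap j p = 0

theorem InStar.mv {h : G} {j k : Fin 3} (e : h.1 * kleinElt j * h.1⁻¹ = kleinElt k)
    {p : Vertex → ℝ} (H : InStar j p) : InStar k (mv h p) := by
  refine ⟨fun l hl => ?_, (overlap_mv e p).trans H.2⟩
  obtain ⟨σ, hσ⟩ := exists_index_perm h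
  obtain ⟨i, rfl⟩ := σ.surjective l
  rw [mv_klein (hσ i)]
  refine H.1 i ?_
  rintro rfl
  exact hl (kleinElt_injective ((hσ i).symm.trans e))

theorem Window.inStar_iff {p : Vertex → ℝ} (hp : Window p) (j : Fin 3) :
    InStar j p ↔ ∀ k, level k p ≤ level j p := by
  obtain ⟨-, h1, h2, h3⟩ := hp.overlaps
  have n0 := hp.admissible.norm_model_zero (gamma p)
  have n1 := hp.admissible.norm_model_one (gamma p)
  have n2 := hp.admissible.norm_model_two (gamma p)
  have l0 := hp.norm_windowMap 0
  have l1 := hp.norm_windowMap 1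
  have l2 := hp.norm_windowMap 2
  have hs := hp.abs_add_abs
  have hle := hp.admissible.abs_le
  have x0 := hp.nonneg (Sum.inl (klein 1))
  have y0 := hp.nonneg (Sum.inl (klein 2))
  unfold windowMap at l0 l1 l2
  rw [n0] at l0
  rw [n1] at l1
  rw [n2] at l2
  have z0 := hp.zero_klein
  simp only [InStar, Fin.forall_fin_succ, IsEmpty.forall_iff, and_true,
    Fin.succ_zero_eq_one, Fin.succ_one_eq_two, ← l0, ← l1, ← l2]
  fin_cases j
  · simp only [Fin.zero_eta, ne_eq, not_true_eq_false, one_ne_zero, not_false_eq_true,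
      Fin.reduceEq, IsEmpty.forall_iff, true_and, forall_const, ← l0]
    constructor
    · rintro ⟨⟨e1, e2⟩, e3⟩
      exact ⟨le_rfl, by linarith, by linarith⟩
    · rintro ⟨-, e2, e3⟩
      exact ⟨⟨by linarith, by linarith⟩, by linarith⟩
  · simp only [Fin.mk_one, ne_eq, not_true_eq_false, zero_ne_one, not_false_eq_true,
      Fin.reduceEq, IsEmpty.forall_iff, true_and, forall_const, z0, h1, ← l1, and_true]
    constructor
    · intro e
      exact ⟨by linarith, le_rfl, by linarith⟩
    · rintro ⟨-, -, e⟩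
      rcases hp.klein_or with h | h <;> linarith
  · have h22 : (⟨2, by decide⟩ : Fin 3) = 2 := rfl
    simp only [h22, ne_eq, not_true_eq_false, not_false_eq_true,
      Fin.reduceEq, IsEmpty.forall_iff, true_and, forall_const, z0, h2, ← l2, and_true]
    constructor
    · intro e
      exact ⟨by linarith, by linarith, le_rfl⟩
    · rintro ⟨-, e, -⟩
      rcases hp.klein_or with h | h <;> linarith

/-- Both sides are equivariant, so the equivalence only needs the explicit absolute values on the
window. Together with `toCP2_mem_disk` it identifies the disks with stars. -/
theorem inStar_iff_level {p : Vertex → ℝ} (hp : p ∈ realization X) (j : Fin 3) :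
    InStar j p ↔ ∀ k, level k p ≤ level j p := by
  obtain ⟨g, hg⟩ := exists_window hp
  obtain ⟨σ, hσ⟩ := exists_index_perm g
  have h1 : InStar j p ↔ InStar (σ j) (mv g p) := by
    refine ⟨InStar.mv (hσ j), fun h => ?_⟩
    have := InStar.mv (h := g⁻¹) (j := σ j) (k := j) (by
      rw [← hσ j]
      change g.1⁻¹ * _ * (g.1⁻¹)⁻¹ = _
      group) h
    rwa [mv_inv_mv] at this
  rw [h1, hg.inStar_iff, ← σ.forall_congr_right]
  simp only [level_mv (hσ _)]

theorem toCP2_mem_disk (p : realization X) (j : Fin 3) :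
    toCP2 p ∈ disk j ↔ ∀ k, level k p.1 ≤ level j p.1 := by
  obtain ⟨z, hz, e, hl⟩ := exists_rep p
  simp only [← hl]
  constructor
  · rintro ⟨w, hw, e', h⟩ k
    obtain ⟨t, rfl⟩ := (Projectivization.mk_eq_mk_iff' ℂ _ _ _ _).1 (e.symm.trans e')
    rw [PiLp.smul_apply, PiLp.smul_apply, norm_smul, norm_smul]
    exact mul_le_mul_of_nonneg_left (h k) (norm_nonneg t)
  · intro h
    exact ⟨z, hz, e, h⟩

theorem overlap_eq_zero_iff {p : Vertex → ℝ} (hp : ∀ v, 0 ≤ p v) (j : Fin 3) :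
    overlap j p = 0 ↔ ∀ a n, p (Sum.inr (a, n)) = 0 ∨ p (Sum.inr (kleinElt j a, n)) = 0 := by
  unfold overlap
  rw [Finset.sum_eq_zero_iff_of_nonneg fun a _ => Finset.sum_nonneg fun n _ => le_min (hp _) (hp _)]
  refine forall_congr' fun a => ?_
  rw [Finset.sum_eq_zero_iff_of_nonneg fun n _ => le_min (hp _) (hp _)]
  simp only [Finset.mem_univ, forall_const]
  refine forall_congr' fun n => ?_
  constructor
  · intro h
    rcases min_choice (p (Sum.inr (a, n))) (p (Sum.inr (kleinElt j a, n))) with e | e <;>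
      rw [h] at e
    exacts [Or.inl e.symm, Or.inr e.symm]
  · rintro (h | h)
    · rw [h, min_eq_left (hp _)]
    · rw [h, min_eq_right (hp _)]

theorem kleinElt_kleinElt : ∀ j a, kleinElt j (kleinElt j a) = a := by decide

theorem exists_facet_of_inStar {p : Vertex → ℝ} (hp : p ∈ realization X) {j : Fin 3}
    (h : InStar j p) : ∃ b : Fin 4 → Fin 3, (∀ a, b (kleinElt j a) ≠ b a) ∧
      ∀ v, p v ≠ 0 → v ∈ facet (klein j) b := by
  have h2 := (overlap_eq_zero_iff hp.1 j).1 h.2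
  obtain ⟨σ, ⟨-, ν, b, -, hσ⟩, hs⟩ := hp.2.2
  have hb : ∀ a n, p (Sum.inr (a, n)) ≠ 0 → b a = n := fun a n hne =>
    inr_mem_facet.1 (hσ (hs _ hne))
  classical
  let P (a : Fin 4) : Prop := p (Sum.inr (a, b a)) ≠ 0
  -- Labels outside the support are chosen afresh so that opposite indices differ: a lone label is
  -- avoided by adding 1, and an empty pair gets `0` and `1`.
  let b' (a : Fin 4) : Fin 3 := if P a then b a else if P (kleinElt j a) then b (kleinElt j a) + 1
    else if a < kleinElt j a then 0 else 1
  have hne : ∀ n : Fin 3, n + 1 ≠ n := by decide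
  refine ⟨b', fun a => ?_, ?_⟩
  · simp only [b', kleinElt_kleinElt]
    by_cases h0 : P a <;> by_cases h1 : P (kleinElt j a) <;> simp only [h0, h1, if_true, if_false]
    · intro e
      have := h2 a (b a)
      rw [← e] at this
      rcases this with h3 | h3
      · rw [e] at h3
        exact h0 h3
      · exact h1 h3
    · exact hne _
    · exact (hne _).symm
    · have := kleinElt_ne j a
      rcases lt_or_gt_of_ne this with h4 | h4
      · rw [if_pos h4, if_neg h4.not_gt]
        decide
      · rw [if_neg h4.not_gt, if_pos h4]
        decide
  · rw [forall_vertex]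
    constructor
    · intro k hk
      rw [inl_mem_facet]
      by_contra hc
      exact hk (h.1 k fun e => hc (by rw [e]))
    · intro a n hn
      obtain rfl := hb a n hn
      rw [inr_mem_facet]
      exact if_pos hn

theorem mem_commonStar_iff {p : Vertex → ℝ} (hp : p ∈ realization X) (J : Finset (Fin 3)) :
    p ∈ realization (commonStar J) ↔ ∀ j ∈ J, InStar j p := by
  constructor
  · rintro ⟨-, -, σ, ⟨-, hσ⟩, hs⟩ j hj
    have H := hσ j hj
    refine ⟨fun k hk => ?_, (overlap_eq_zero_iff hp.1 j).2 fun a n => ?_⟩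
    · by_contra hc
      refine hk.symm (klein_injective (inl_inl_mem_faces.1
        ((X.isRelLowerSet_faces H).2 ?_ (Finset.insert_nonempty _ _))))
      exact Finset.insert_subset_insert _ (Finset.singleton_subset_iff.2 (hs _ hc))
    · by_contra! hc
      have := (X.isRelLowerSet_faces H).2 (Finset.insert_subset_insert _
        (Finset.insert_subset (hs _ hc.1) (Finset.singleton_subset_iff.2 (hs _ hc.2))))
          (Finset.insert_nonempty _ _)
      exact (inl_inr_inr_mem_faces.1 this).2 ⟨rfl, rfl⟩
  · intro h
    classical
    obtain ⟨σ, hσ, hs⟩ := hp.2.2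
    have hne : (Finset.univ.filter fun v => p v ≠ 0).Nonempty := by
      rw [Finset.filter_nonempty_iff]
      by_contra! hc
      have := hp.2.1
      rw [Finset.sum_congr rfl hc] at this
      simp at this
    refine ⟨hp.1, hp.2.1, Finset.univ.filter fun v => p v ≠ 0, ⟨(X.isRelLowerSet_faces hσ).2
      (fun v hv => hs v (Finset.mem_filter.1 hv).2) hne, fun j hj => ?_⟩, fun v hv => by simpa⟩
    obtain ⟨b, hb, hf⟩ := exists_facet_of_inStar hp (h j hj)
    refine ⟨Finset.insert_nonempty _ _, klein j, b, hb, Finset.insert_subset ?_ fun v hv =>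
      hf v (Finset.mem_filter.1 hv).2⟩
    rw [inl_mem_facet]

theorem imageOf_commonStar (J : Finset (Fin 3)) :
    imageOf toCP2 (commonStar J) = ⋂ j ∈ J, disk j := by
  have key (p : realization X) : p.1 ∈ realization (commonStar J) ↔ ∀ j ∈ J, toCP2 p ∈ disk j := by
    rw [mem_commonStar_iff p.2]
    simp only [inStar_iff_level p.2, toCP2_mem_disk]
  ext x
  obtain ⟨p, rfl⟩ := toCP2_surjective x
  rw [Set.mem_iInter₂, ← key]
  exact toCP2_injective.mem_set_image

theorem imageOf_star (j : Fin 3) : imageOf toCP2 (commonStar {j}) = disk j := by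
  rw [imageOf_commonStar]
  simp

theorem imageOf_solidTorus (j : Fin 3) : imageOf toCP2 (commonStar {j}ᶜ) = solidTorus j := by
  rw [imageOf_commonStar, solidTorus]
  simp

theorem imageOf_torus : imageOf toCP2 (commonStar Finset.univ) = torus := by
  rw [imageOf_commonStar, torus]
  simp

theorem commonStar_le (J : Finset (Fin 3)) : commonStar J ≤ X := fun _ h => h.1

theorem isEquilibrium_toCP2 : IsEquilibrium X toCP2 :=
  ⟨fun j => ⟨_, commonStar_le _, imageOf_star j⟩, fun j => ⟨_, commonStar_le _, imageOf_solidTorus j⟩,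
    _, commonStar_le _, imageOf_torus⟩

/-! ### A subdivision of `X` -/

/-- The vertices of the subdivision: those of `X` and the midpoints of the edges
`{(a, n), (a', n)}`. -/
def subVertex : Fin 3 ⊕ (Fin 4 × Fin 4 × Fin 3) → Vertex → ℝ
  | Sum.inl j => Pi.single (Sum.inl (klein j)) 1
  | Sum.inr (a, a', n) => (2⁻¹ : ℝ) • (Pi.single (Sum.inr (a, n)) 1 + Pi.single (Sum.inr (a', n)) 1)

theorem subVertex_comm (a a' : Fin 4) (n : Fin 3) :
    subVertex (Sum.inr (a, a', n)) = subVertex (Sum.inr (a', a, n)) := by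
  simp only [subVertex, add_comm]

theorem subVertex_nonneg (q) (v : Vertex) : 0 ≤ subVertex q v := by
  rcases q with j | ⟨a, a', n⟩
  · simp only [subVertex, Pi.single_apply]
    split_ifs <;> norm_num
  · simp only [subVertex, Pi.smul_apply, Pi.add_apply, Pi.single_apply, smul_eq_mul]
    split_ifs <;> norm_num

theorem subVertex_sum (q) : ∑ v, subVertex q v = 1 := by
  rcases q with j | ⟨a, a', n⟩
  · simp [subVertex]
  · simp only [subVertex, Pi.smul_apply, Pi.add_apply, smul_eq_mul, ← Finset.mul_sum,
      Finset.sum_add_distrib]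
    simp
    norm_num

theorem subVertex_inr_inr (b b' : Fin 4) (m : Fin 3) (a : Fin 4) (n : Fin 3) :
    subVertex (Sum.inr (b, b', m)) (Sum.inr (a, n)) =
      2⁻¹ * ((if a = b ∧ n = m then 1 else 0) + (if a = b' ∧ n = m then 1 else 0)) := by
  simp [subVertex, Pi.single_apply]

theorem subVertex_inl_inr (j : Fin 3) (a : Fin 4) (n : Fin 3) :
    subVertex (Sum.inl j) (Sum.inr (a, n)) = 0 := by
  simp [subVertex]

theorem subVertex_inr_inl (b b' : Fin 4) (m : Fin 3) (ν : Klein) :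
    subVertex (Sum.inr (b, b', m)) (Sum.inl ν) = 0 := by
  simp [subVertex]

theorem subVertex_inl_inl (j k : Fin 3) :
    subVertex (Sum.inl j) (Sum.inl (klein k)) = if k = j then 1 else 0 := by
  simp [subVertex, Pi.single_apply, klein_injective.eq_iff]

/-! ### Comonotone simplices and the coordinates dual to the subdivision -/

/-- The coordinates of `y` at `(a, n)` and `(a', n)` are in the same order for all `y ∈ s`. -/
def Comonotone (s : Set (Vertex → ℝ)) : Prop :=
  ∀ a a' n, (∀ y ∈ s, y (Sum.inr (a, n)) ≤ y (Sum.inr (a', n))) ∨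
    ∀ y ∈ s, y (Sum.inr (a', n)) ≤ y (Sum.inr (a, n))

/-- `c` is linear on `convexHull s` for every comonotone set `s`. -/
def PiecewiseLinear (c : (Vertex → ℝ) → ℝ) : Prop :=
  ∀ s, Comonotone s → ∃ l : (Vertex → ℝ) →ₗ[ℝ] ℝ, ∀ p ∈ convexHull ℝ s, c p = l p

theorem le_of_mem_convexHull {s : Set (Vertex → ℝ)} {v w : Vertex} (h : ∀ y ∈ s, y v ≤ y w)
    {p : Vertex → ℝ} (hp : p ∈ convexHull ℝ s) : p v ≤ p w := by
  have hc : Convex ℝ {p : Vertex → ℝ | p v ≤ p w} := by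
    intro x hx y hy a b ha hb _
    exact add_le_add (mul_le_mul_of_nonneg_left hx ha) (mul_le_mul_of_nonneg_left hy hb)
  exact convexHull_min (t := {p : Vertex → ℝ | p v ≤ p w}) h hc hp

namespace PiecewiseLinear

theorem coord (v : Vertex) : PiecewiseLinear fun p => p v :=
  fun _ _ => ⟨LinearMap.proj v, fun _ _ => rfl⟩

/-- A common order of two coordinates passes to the convex hull, where the minimum is then one fixed
coordinate. -/
theorem min (a a' : Fin 4) (n : Fin 3) :
    PiecewiseLinear fun p => min (p (Sum.inr (a, n))) (p (Sum.inr (a', n))) := by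
  intro s hs
  rcases hs a a' n with h | h
  · exact ⟨LinearMap.proj (Sum.inr (a, n)), fun p hp => min_eq_left (le_of_mem_convexHull h hp)⟩
  · exact ⟨LinearMap.proj (Sum.inr (a', n)), fun p hp => min_eq_right (le_of_mem_convexHull h hp)⟩

variable {c d : (Vertex → ℝ) → ℝ}

theorem sub (hc : PiecewiseLinear c) (hd : PiecewiseLinear d) : PiecewiseLinear (c - d) := by
  intro s hs
  obtain ⟨l, hl⟩ := hc s hs
  obtain ⟨m, hm⟩ := hd s hs
  exact ⟨l - m, fun p hp => by rw [Pi.sub_apply, hl p hp, hm p hp]; rfl⟩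

theorem sum {ι : Type*} (t : Finset ι) {c : ι → (Vertex → ℝ) → ℝ}
    (hc : ∀ i, PiecewiseLinear (c i)) : PiecewiseLinear (∑ i ∈ t, c i) := by
  intro s hs
  choose l hl using fun i => hc i s hs
  refine ⟨∑ i ∈ t, l i, fun p hp => ?_⟩
  rw [Finset.sum_apply, LinearMap.sum_apply]
  exact Finset.sum_congr rfl fun i _ => hl i p hp

theorem smul (r : ℝ) (hc : PiecewiseLinear c) : PiecewiseLinear (r • c) := by
  intro s hs
  obtain ⟨l, hl⟩ := hc s hs
  exact ⟨r • l, fun p hp => by rw [Pi.smul_apply, hl p hp]; rfl⟩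

theorem map_sum (hc : PiecewiseLinear c) {s : Finset (Vertex → ℝ)} (hs : Comonotone s)
    {w : (Vertex → ℝ) → ℝ} (h0 : ∀ y ∈ s, 0 ≤ w y) (h1 : ∑ y ∈ s, w y = 1) :
    c (∑ y ∈ s, w y • y) = ∑ y ∈ s, w y * c y := by
  obtain ⟨l, hl⟩ := hc s hs
  rw [hl _ ((convex_convexHull ℝ _).sum_mem h0 h1 fun y hy => subset_convexHull ℝ _ hy), _root_.map_sum]
  refine Finset.sum_congr rfl fun y hy => ?_
  rw [map_smul, smul_eq_mul, hl y (subset_convexHull ℝ _ hy)]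

end PiecewiseLinear

/-- The barycentric coordinates for the subdivision, that of a midpoint being shared by the two
corresponding indices. -/
def subCoord : Fin 3 ⊕ (Fin 4 × Fin 4 × Fin 3) → (Vertex → ℝ) → ℝ
  | Sum.inl j => fun p => p (Sum.inl (klein j))
  | Sum.inr (a, a', n) =>
    if a = a' then
      (fun p => p (Sum.inr (a, n))) -
        ∑ c ∈ Finset.univ.erase a, fun p => min (p (Sum.inr (a, n))) (p (Sum.inr (c, n)))
    else fun p => min (p (Sum.inr (a, n))) (p (Sum.inr (a', n)))

theorem subCoord_diag (a : Fin 4) (n : Fin 3) (p : Vertex → ℝ) :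
    subCoord (Sum.inr (a, a, n)) p = p (Sum.inr (a, n)) -
      ∑ c ∈ Finset.univ.erase a, min (p (Sum.inr (a, n))) (p (Sum.inr (c, n))) := by
  simp [subCoord]

theorem subCoord_of_ne {a a' : Fin 4} (h : a ≠ a') (n : Fin 3) (p : Vertex → ℝ) :
    subCoord (Sum.inr (a, a', n)) p = min (p (Sum.inr (a, n))) (p (Sum.inr (a', n))) := by
  simp [subCoord, h]

theorem piecewiseLinear_subCoord (q) : PiecewiseLinear (subCoord q) := by
  rcases q with j | ⟨a, a', n⟩
  · exact PiecewiseLinear.coord _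
  · by_cases h : a = a'
    · simp only [subCoord, if_pos h]
      exact (PiecewiseLinear.coord _).sub (PiecewiseLinear.sum _ fun c => PiecewiseLinear.min a c n)
    · simp only [subCoord, if_neg h]
      exact PiecewiseLinear.min a a' n

/-- Doubling clears the halves of the midpoints, so the values of the dual coordinates become
decidable statements about natural numbers. -/
theorem min_indicator : ∀ a a' : Fin 4, a ≠ a' → ∀ b b' : Fin 4, ∀ n m : Fin 3,
    min ((if a = b ∧ n = m then 1 else 0) + (if a = b' ∧ n = m then 1 else 0) : ℕ)
      ((if a' = b ∧ n = m then 1 else 0) + (if a' = b' ∧ n = m then 1 else 0)) =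
    if n = m ∧ (a = b ∧ a' = b' ∨ a = b' ∧ a' = b) then 1 else 0 := by
  decide +kernel

theorem sum_indicator : ∀ a b b' : Fin 4, ∀ n m : Fin 3,
    ((if a = b ∧ n = m then 1 else 0) + (if a = b' ∧ n = m then 1 else 0) : ℕ) =
      (if a = b ∧ a = b' ∧ n = m then 2 else 0) + ∑ c ∈ Finset.univ.erase a,
        if n = m ∧ (a = b ∧ c = b' ∨ a = b' ∧ c = b) then 1 else 0 := by
  decide +kernel

theorem min_subVertex {a a' : Fin 4} (h : a ≠ a') (b b' : Fin 4) (n m : Fin 3) :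
    min (subVertex (Sum.inr (b, b', m)) (Sum.inr (a, n)))
      (subVertex (Sum.inr (b, b', m)) (Sum.inr (a', n))) =
    2⁻¹ * ((if n = m ∧ (a = b ∧ a' = b' ∨ a = b' ∧ a' = b) then 1 else 0 : ℕ) : ℝ) := by
  rw [← min_indicator a a' h b b' n m, subVertex_inr_inr, subVertex_inr_inr, Nat.cast_min,
    mul_min_of_nonneg _ _ (by norm_num)]
  push_cast
  rfl

/-- These functions are dual to the vertices of the subdivision and linear on all of its simplices.
Affine independence and the intersection property both follow from them. -/
theorem exists_coord (q) : ∃ c, PiecewiseLinear c ∧ c (subVertex q) = 1 ∧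
    ∀ r, subVertex r ≠ subVertex q → c (subVertex r) = 0 := by
  rcases q with j | ⟨a, a', n⟩
  · refine ⟨_, piecewiseLinear_subCoord (Sum.inl j), ?_, ?_⟩
    · simp [subCoord, subVertex_inl_inl]
    · rintro (k | ⟨b, b', m⟩) hr
      · have hjk : j ≠ k := fun e => hr (by rw [e])
        simp [subCoord, subVertex_inl_inl, hjk]
      · simp [subCoord, subVertex_inr_inl]
  · by_cases h : a = a'
    · subst h
      have key (b b' m) : subCoord (Sum.inr (a, a, n)) (subVertex (Sum.inr (b, b', m))) =
          2⁻¹ * ((if a = b ∧ a = b' ∧ n = m then 2 else 0 : ℕ) : ℝ) := by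
        rw [subCoord_diag, Finset.sum_congr rfl fun c hc =>
          min_subVertex (Finset.ne_of_mem_erase hc).symm b b' n m, ← Finset.mul_sum,
          subVertex_inr_inr, ← mul_sub, sub_eq_iff_eq_add.2]
        have := congr_arg (Nat.cast (R := ℝ)) (sum_indicator a b b' n m)
        push_cast at this ⊢
        exact this
      refine ⟨_, piecewiseLinear_subCoord (Sum.inr (a, a, n)), ?_, ?_⟩
      · rw [key]
        simp
      · rintro (k | ⟨b, b', m⟩) hr
        · rw [subCoord_diag]
          simp [subVertex_inl_inr]
        · rw [key, if_neg]
          · simp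
          · rintro ⟨rfl, rfl, rfl⟩
            exact hr rfl
    · have key (b b' m) : subCoord (Sum.inr (a, a', n)) (subVertex (Sum.inr (b, b', m))) =
          2⁻¹ * ((if n = m ∧ (a = b ∧ a' = b' ∨ a = b' ∧ a' = b) then 1 else 0 : ℕ) : ℝ) := by
        rw [subCoord_of_ne h, min_subVertex h]
      -- At the midpoint both coordinates are `1/2`, and so is their minimum.
      refine ⟨_, (piecewiseLinear_subCoord (Sum.inr (a, a', n))).smul 2, ?_, ?_⟩
      · rw [Pi.smul_apply, key]
        simp
      · rintro (k | ⟨b, b', m⟩) hr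
        · rw [Pi.smul_apply, subCoord_of_ne h]
          simp [subVertex_inl_inr]
        · rw [Pi.smul_apply, key, if_neg]
          · simp
          · rintro ⟨rfl, ⟨rfl, rfl⟩ | ⟨rfl, rfl⟩⟩
            · exact hr rfl
            · exact hr (subVertex_comm _ _ _)

/-- The faces of the subdivision. -/
def subFaces : Set (Finset (Vertex → ℝ)) :=
  {s | s.Nonempty ∧ (∀ y ∈ s, y ∈ Set.range subVertex) ∧ Comonotone s ∧
    ∃ σ ∈ X.faces, ∀ y ∈ s, ∀ v, y v ≠ 0 → v ∈ σ}

theorem exists_coord_of_mem {s : Finset (Vertex → ℝ)} (hs : s ∈ subFaces) {y : Vertex → ℝ}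
    (hy : y ∈ s) : ∃ c, PiecewiseLinear c ∧ ∀ t ∈ subFaces, ∀ w : (Vertex → ℝ) → ℝ,
      (∀ x ∈ t, 0 ≤ w x) → ∑ x ∈ t, w x = 1 →
        c (∑ x ∈ t, w x • x) = if y ∈ t then w y else 0 := by
  obtain ⟨q, rfl⟩ := hs.2.1 y hy
  obtain ⟨c, hc, h1, h0⟩ := exists_coord q
  refine ⟨c, hc, fun t ht w hw hw1 => ?_⟩
  have h0' : ∀ x ∈ t, x ≠ subVertex q → w x * c x = 0 := by
    intro x hx hne
    obtain ⟨r, rfl⟩ := ht.2.1 x hx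
    rw [h0 r hne, mul_zero]
  rw [hc.map_sum ht.2.2.1 hw hw1]
  split_ifs with hq
  · rw [Finset.sum_eq_single_of_mem _ hq h0', h1, mul_one]
  · exact Finset.sum_eq_zero fun x hx => h0' x hx fun e => hq (e ▸ hx)

theorem affineIndependent_of_mem {s : Finset (Vertex → ℝ)} (hs : s ∈ subFaces) :
    AffineIndependent ℝ ((↑) : s → Vertex → ℝ) := by
  rw [affineIndependent_iff]
  intro t w _ hw e he
  obtain ⟨c, hc, H⟩ := exists_coord_of_mem hs e.2
  obtain ⟨l, hl⟩ := hc s hs.2.2.1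
  have hx (x : s) : l x = if x = e then 1 else 0 := by
    classical
    have := H s hs (fun z => if z = x then 1 else 0) (fun z _ => by split_ifs <;> norm_num)
      (by simp)
    simp only [ite_smul, one_smul, zero_smul, Finset.sum_ite_eq', x.2, e.2, if_true] at this
    rw [← hl x (subset_convexHull ℝ _ x.2), this]
    simp only [Subtype.ext_iff, eq_comm]
  have := congr_arg l hw
  simpa [hx, he] using this

/-- Evaluated on the representation over `t`, the coordinate dual to a vertex outside `t` is zero,
so that vertex has weight zero over `s` too. -/
theorem inter_subset_of_mem {s t : Finset (Vertex → ℝ)} (hs : s ∈ subFaces) (ht : t ∈ subFaces) :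
    convexHull ℝ ↑s ∩ convexHull ℝ ↑t ⊆ convexHull ℝ (s ∩ t : Set (Vertex → ℝ)) := by
  rintro p ⟨hp, hp'⟩
  obtain ⟨w, h0, h1, rfl⟩ := Finset.mem_convexHull'.1 hp
  obtain ⟨w', h0', h1', e⟩ := Finset.mem_convexHull'.1 hp'
  have hw : ∀ y ∈ s, y ∉ t → w y = 0 := by
    intro y hy hyt
    obtain ⟨c, -, H⟩ := exists_coord_of_mem hs hy
    have h2 := H s hs w h0 h1
    rw [← e, H t ht w' h0' h1', if_neg hyt, if_pos hy] at h2
    exact h2.symm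
  classical
  have e1 : ∑ y ∈ s ∩ t, w y = 1 := by
    rw [← h1]
    refine Finset.sum_subset Finset.inter_subset_left fun y hy hn => hw y hy fun h => ?_
    exact hn (Finset.mem_inter.2 ⟨hy, h⟩)
  have e2 : ∑ y ∈ s, w y • y = ∑ y ∈ s ∩ t, w y • y := by
    symm
    refine Finset.sum_subset Finset.inter_subset_left fun y hy hn => ?_
    rw [hw y hy fun h => hn (Finset.mem_inter.2 ⟨hy, h⟩), zero_smul]
  rw [e2]
  refine (convex_convexHull ℝ _).sum_mem (fun y hy => h0 y (Finset.mem_inter.1 hy).1) e1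
    fun y hy => subset_convexHull ℝ _ ?_
  exact ⟨(Finset.mem_inter.1 hy).1, (Finset.mem_inter.1 hy).2⟩

theorem mem_realization_of_mem_convexHull {s : Finset (Vertex → ℝ)} (hs : s ∈ subFaces)
    {p : Vertex → ℝ} (hp : p ∈ convexHull ℝ (s : Set (Vertex → ℝ))) :
    p ∈ realization X := by
  obtain ⟨-, hv, -, σ, hσ, hsup⟩ := hs
  have hc : Convex ℝ {p : Vertex → ℝ | (∀ v, 0 ≤ p v) ∧ ∑ v, p v = 1 ∧ ∀ v, v ∉ σ → p v = 0} := by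
    rintro x ⟨x0, x1, x2⟩ y ⟨y0, y1, y2⟩ a b ha hb hab
    refine ⟨fun v => add_nonneg (mul_nonneg ha (x0 v)) (mul_nonneg hb (y0 v)), ?_, fun v hv => ?_⟩
    · simp only [Pi.add_apply, Pi.smul_apply, smul_eq_mul, Finset.sum_add_distrib,
        ← Finset.mul_sum, x1, y1, mul_one, hab]
    · simp [x2 v hv, y2 v hv]
  have := convexHull_min (𝕜 := ℝ) (s := (s : Set (Vertex → ℝ))) ?_ hc hp
  · exact ⟨this.1, this.2.1, σ, hσ, fun v hv => by_contra fun h => hv (this.2.2 v h)⟩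
  · intro y hy
    obtain ⟨q, rfl⟩ := hv y hy
    exact ⟨subVertex_nonneg q, subVertex_sum q, fun v hv => by_contra fun h => hv (hsup _ hy v h)⟩

theorem subCoord_comm (a a' : Fin 4) (n : Fin 3) (p : Vertex → ℝ) :
    subCoord (Sum.inr (a, a', n)) p = subCoord (Sum.inr (a', a, n)) p := by
  by_cases h : a = a'
  · rw [h]
  · rw [subCoord_of_ne h, subCoord_of_ne (Ne.symm h), min_comm]

/-- The two orderings of a midpoint each carry the minimum, which cancels the factor `1/2`. The
diagonal coefficient is what remains of `p (a, n)` after the minima are removed. -/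
theorem sum_subCoord_smul (p : Vertex → ℝ) : ∑ q, subCoord q p • subVertex q = p := by
  funext v
  revert v
  rw [forall_vertex]
  constructor
  · intro j
    rw [Finset.sum_apply, Fintype.sum_sum_type]
    refine (congr_arg₂ (· + ·) (?_ : _ = p (Sum.inl (klein j)))
      (Finset.sum_eq_zero fun x _ => ?_)).trans (add_zero _)
    · simp [subVertex_inl_inl, subCoord]
    · rw [Pi.smul_apply, subVertex_inr_inl x.1 x.2.1 x.2.2, smul_zero]
  · intro a n
    have h : ∑ c, subCoord (Sum.inr (a, c, n)) p = p (Sum.inr (a, n)) := by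
      rw [← Finset.add_sum_erase _ _ (Finset.mem_univ a), subCoord_diag,
        Finset.sum_congr rfl fun c hc => subCoord_of_ne (Finset.ne_of_mem_erase hc).symm n p]
      ring
    have h' : ∑ c, subCoord (Sum.inr (c, a, n)) p = p (Sum.inr (a, n)) := by
      rw [← h]
      exact Finset.sum_congr rfl fun c _ => subCoord_comm c a n p
    rw [Finset.sum_apply, Fintype.sum_sum_type]
    simp only [Pi.smul_apply, smul_eq_mul, subVertex_inl_inr, subVertex_inr_inr, mul_zero,
      Finset.sum_const_zero, zero_add, Fintype.sum_prod_type, mul_add, ite_and, mul_ite, mul_one,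
      Finset.sum_add_distrib]
    simp only [Finset.sum_ite_irrel, Finset.sum_ite_eq, Finset.sum_const_zero, Finset.mem_univ,
      if_true, ← Finset.sum_mul, h, h']
    ring

theorem inr_eq_zero_or {p : Vertex → ℝ} (hp : p ∈ realization X) {a a' a'' : Fin 4} (n : Fin 3)
    (h : a ≠ a') (h' : a ≠ a'') (h'' : a' ≠ a'') :
    p (Sum.inr (a, n)) = 0 ∨ p (Sum.inr (a', n)) = 0 ∨ p (Sum.inr (a'', n)) = 0 := by
  obtain ⟨-, -, σ, hσ, hs⟩ := hp
  by_contra! hc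
  exact inr_inr_inr_notMem_faces n h h' h'' ((X.isRelLowerSet_faces hσ).2
    (Finset.insert_subset (hs _ hc.1) (Finset.insert_subset (hs _ hc.2.1)
      (Finset.singleton_subset_iff.2 (hs _ hc.2.2)))) (Finset.insert_nonempty _ _))

/-- No face has three vertices with the same label, so at most one of the subtracted minima is
nonzero. -/
theorem subCoord_nonneg {p : Vertex → ℝ} (hp : p ∈ realization X) (q) : 0 ≤ subCoord q p := by
  rcases q with j | ⟨a, a', n⟩
  · exact hp.1 _
  by_cases h : a = a'
  · subst h
    rw [subCoord_diag, sub_nonneg]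
    by_cases hc : ∃ c ∈ Finset.univ.erase a, min (p (Sum.inr (a, n))) (p (Sum.inr (c, n))) ≠ 0
    · obtain ⟨c, hc, h0⟩ := hc
      rw [Finset.sum_eq_single_of_mem c hc]
      · exact min_le_left _ _
      · intro d hd hdc
        rcases inr_eq_zero_or hp n (Finset.ne_of_mem_erase hc).symm (Finset.ne_of_mem_erase hd).symm
          hdc.symm with e | e | e
        · rw [e, min_eq_left (hp.1 _)]
        · rw [e, min_eq_right (hp.1 _)] at h0
          exact absurd rfl h0
        · rw [e, min_eq_right (hp.1 _)]
    · push Not at hc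
      rw [Finset.sum_eq_zero hc]
      exact hp.1 _
  · rw [subCoord_of_ne h]
    exact le_min (hp.1 _) (hp.1 _)

theorem inr_ne_zero_of_subCoord {p : Vertex → ℝ} (hp : p ∈ realization X) {a a' : Fin 4} {n : Fin 3}
    (h : subCoord (Sum.inr (a, a', n)) p ≠ 0) : p (Sum.inr (a, n)) ≠ 0 := by
  intro h0
  apply h
  by_cases e : a = a'
  · subst e
    rw [subCoord_diag, h0, Finset.sum_eq_zero fun c _ => min_eq_left (hp.1 _), sub_zero]
  · rw [subCoord_of_ne e, h0, min_eq_left (hp.1 _)]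

theorem ne_zero_of_subVertex_ne_zero {p : Vertex → ℝ} (hp : p ∈ realization X) {q}
    (h : subCoord q p ≠ 0) {v : Vertex} (hv : subVertex q v ≠ 0) : p v ≠ 0 := by
  rcases q with j | ⟨a, a', n⟩
  · have : v = Sum.inl (klein j) := by
      by_contra hne
      exact hv (Pi.single_eq_of_ne hne _)
    rw [this]
    exact h
  · have : v = Sum.inr (a, n) ∨ v = Sum.inr (a', n) := by
      by_contra! hne
      apply hv
      simp [subVertex, Pi.single_eq_of_ne hne.1, Pi.single_eq_of_ne hne.2]
    rcases this with rfl | rfl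
    · exact inr_ne_zero_of_subCoord hp h
    · rw [subCoord_comm] at h
      exact inr_ne_zero_of_subCoord hp h

/-- A vertex used by `p` that involves the smaller coordinate `(a, n)` must be the midpoint with
`(a', n)`. The remainder of the smaller coordinate is zero, and a third index with label `n` cannot
occur. Hence the support of the decomposition is comonotone. -/
theorem subVertex_le {p : Vertex → ℝ} (hp : p ∈ realization X) {q} (h : subCoord q p ≠ 0)
    {a a' : Fin 4} {n : Fin 3} (hle : p (Sum.inr (a, n)) ≤ p (Sum.inr (a', n))) :
    subVertex q (Sum.inr (a, n)) ≤ subVertex q (Sum.inr (a', n)) := by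
  rcases q with j | ⟨b, b', m⟩
  · rw [subVertex_inl_inr, subVertex_inl_inr]
  by_cases haa : a = a'
  · rw [haa]
  have key : ∀ {b b'}, subCoord (Sum.inr (b, b', m)) p ≠ 0 → a = b → n = m → b' = a' := by
    rintro b b' h rfl rfl
    by_contra hne
    by_cases hb : a = b'
    · subst hb
      refine h (le_antisymm ?_ (subCoord_nonneg hp _))
      rw [subCoord_diag, sub_nonpos]
      refine (le_min le_rfl hle).trans (Finset.single_le_sum
        (f := fun c => min (p (Sum.inr (a, n))) (p (Sum.inr (c, n))))
        (fun c _ => le_min (hp.1 _) (hp.1 _)) (Finset.mem_erase.2 ⟨Ne.symm haa, Finset.mem_univ _⟩))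
    · have h1 := inr_ne_zero_of_subCoord hp h
      rw [subCoord_comm] at h
      have h2 := inr_ne_zero_of_subCoord hp h
      have h3 : p (Sum.inr (a', n)) ≠ 0 :=
        (lt_of_lt_of_le (lt_of_le_of_ne (hp.1 _) h1.symm) hle).ne'
      have := inr_eq_zero_or hp n haa hb (Ne.symm hne)
      tauto
  rw [subVertex_inr_inr, subVertex_inr_inr]
  by_cases hm : n = m
  · have k1 := fun e => key h e hm
    have k2 := fun e => key (by rwa [subCoord_comm] at h) e hm
    by_cases e1 : a = b <;> by_cases e2 : a = b'
    · exact absurd (e2.trans (k1 e1)) haa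
    · have e3 := k1 e1
      rw [if_pos ⟨e1, hm⟩, if_neg fun e => e2 e.1, if_neg fun e => haa (e1.trans e.1.symm),
        if_pos ⟨e3.symm, hm⟩]
      norm_num
    · have e3 := k2 e2
      rw [if_neg fun e => e1 e.1, if_pos ⟨e2, hm⟩, if_pos ⟨e3.symm, hm⟩,
        if_neg fun e => haa (e2.trans e.1.symm)]
      norm_num
    · simp [e1, e2]
      split_ifs <;> norm_num
  · simp [hm]

theorem exists_subFace {p : Vertex → ℝ} (hp : p ∈ realization X) :
    ∃ s ∈ subFaces, p ∈ convexHull ℝ (s : Set (Vertex → ℝ)) := by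
  classical
  set T := Finset.univ.filter fun q => subCoord q p ≠ 0 with hT
  have e : ∑ q ∈ T, subCoord q p • subVertex q = p := by
    rw [hT, Finset.sum_filter_of_ne, sum_subCoord_smul]
    intro q _ h h0
    rw [h0, zero_smul] at h
    exact h rfl
  have e1 : ∑ q ∈ T, subCoord q p = 1 := by
    rw [← hp.2.1]
    nth_rw 2 [← e]
    simp only [Finset.sum_apply, Pi.smul_apply, smul_eq_mul]
    rw [Finset.sum_comm]
    refine Finset.sum_congr rfl fun q _ => ?_
    rw [← Finset.mul_sum, subVertex_sum, mul_one]
  refine ⟨T.image subVertex, ⟨?_, ?_, ?_, ?_⟩, ?_⟩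
  · rw [Finset.image_nonempty]
    by_contra hc
    rw [Finset.not_nonempty_iff_eq_empty.1 hc] at e1
    simp at e1
  · intro y hy
    obtain ⟨q, -, rfl⟩ := Finset.mem_image.1 hy
    exact ⟨q, rfl⟩
  · intro a a' n
    rcases le_total (p (Sum.inr (a, n))) (p (Sum.inr (a', n))) with h | h
    · left
      intro y hy
      obtain ⟨q, hq, rfl⟩ := Finset.mem_image.1 hy
      exact subVertex_le hp (Finset.mem_filter.1 hq).2 h
    · right
      intro y hy
      obtain ⟨q, hq, rfl⟩ := Finset.mem_image.1 hy
      exact subVertex_le hp (Finset.mem_filter.1 hq).2 h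
  · obtain ⟨σ, hσ, hs⟩ := hp.2.2
    refine ⟨σ, hσ, fun y hy v hv => ?_⟩
    obtain ⟨q, hq, rfl⟩ := Finset.mem_image.1 hy
    exact hs v (ne_zero_of_subVertex_ne_zero hp (Finset.mem_filter.1 hq).2 hv)
  · nth_rw 1 [← e]
    exact (convex_convexHull ℝ _).sum_mem (fun q _ => subCoord_nonneg hp q) e1 fun q hq =>
      subset_convexHull ℝ _ (Finset.mem_coe.2 (Finset.mem_image_of_mem _ hq))

/-- The subdivision of `X` whose new vertices are the midpoints of the edges
`{(a, n), (a', n)}`. -/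
def subdivision : Geometry.SimplicialComplex ℝ (Vertex → ℝ) where
  faces := subFaces
  isRelLowerSet_faces := by
    rintro s ⟨h, hr, hc, σ, hσ, hs⟩
    refine ⟨h, fun t ht hne => ⟨hne, fun y hy => hr y (ht hy), fun a a' n => ?_, σ, hσ,
      fun y hy => hs y (ht hy)⟩⟩
    exact (hc a a' n).imp (fun H y hy => H y (ht hy)) fun H y hy => H y (ht hy)
  indep := affineIndependent_of_mem
  inter_subset_convexHull := inter_subset_of_mem

theorem subdivision_space : subdivision.space = realization X := by
  ext p
  rw [Geometry.SimplicialComplex.mem_space_iff]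
  constructor
  · rintro ⟨s, hs, hp⟩
    exact mem_realization_of_mem_convexHull hs hp
  · intro hp
    obtain ⟨s, hs, h⟩ := exists_subFace hp
    exact ⟨s, hs, h⟩

theorem subFaces_finite : subFaces.Finite := by
  classical
  refine ((Set.finite_range subVertex).toFinset.powerset : Finset (Finset (Vertex → ℝ))).finite_toSet.subset ?_
  intro s hs
  rw [Finset.mem_coe, Finset.mem_powerset]
  intro y hy
  rw [Set.Finite.mem_toFinset]
  exact hs.2.1 y hy

/-! ### The smooth branches of the map -/

/-- The linear form that is `|α| + |β|` where `α` and `β` have the signs `δ₁` and `δ₂`. -/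
def scale (δ₁ δ₂ : ℝ) (q : Vertex → ℝ) : ℝ := δ₁ * alpha q + δ₂ * beta q

/-- The smooth map that agrees with `windowMap` where `|α| + |β| = scale δ₁ δ₂` and `x = 0`. -/
def branch (δ₁ δ₂ : ℝ) (q : Vertex → ℝ) : C3 :=
  !₂[((scale δ₁ δ₂ q / 3 : ℝ) : ℂ) *
      ((Real.sin (Real.pi * alpha q / (2 * scale δ₁ δ₂ q)) : ℂ) +
        Complex.I * (Real.sin (Real.pi * beta q / (2 * scale δ₁ δ₂ q)) : ℂ)),
    (((1 - q (Sum.inl (klein 2))) / 2 - scale δ₁ δ₂ q / 6 : ℝ) : ℂ) *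
      Complex.exp (Complex.I * ((Real.pi * gamma q / (6 * (1 - q (Sum.inl (klein 2)))) : ℝ) : ℂ)),
    (((1 + q (Sum.inl (klein 2))) / 2 - scale δ₁ δ₂ q / 6 : ℝ) : ℂ) *
      Complex.exp (-(Complex.I *
        ((Real.pi * gamma q / (6 * (1 - q (Sum.inl (klein 2)))) : ℝ) : ℂ)))]

theorem branch_zero (δ₁ δ₂ : ℝ) (q : Vertex → ℝ) : branch δ₁ δ₂ q 0 =
    ((scale δ₁ δ₂ q / 3 : ℝ) : ℂ) *
      ((Real.sin (Real.pi * alpha q / (2 * scale δ₁ δ₂ q)) : ℂ) +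
        Complex.I * (Real.sin (Real.pi * beta q / (2 * scale δ₁ δ₂ q)) : ℂ)) := rfl

theorem branch_one (δ₁ δ₂ : ℝ) (q : Vertex → ℝ) : branch δ₁ δ₂ q 1 =
    (((1 - q (Sum.inl (klein 2))) / 2 - scale δ₁ δ₂ q / 6 : ℝ) : ℂ) *
      Complex.exp (Complex.I *
        ((Real.pi * gamma q / (6 * (1 - q (Sum.inl (klein 2)))) : ℝ) : ℂ)) := rfl

theorem branch_two (δ₁ δ₂ : ℝ) (q : Vertex → ℝ) : branch δ₁ δ₂ q 2 =
    (((1 + q (Sum.inl (klein 2))) / 2 - scale δ₁ δ₂ q / 6 : ℝ) : ℂ) *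
      Complex.exp (-(Complex.I *
        ((Real.pi * gamma q / (6 * (1 - q (Sum.inl (klein 2)))) : ℝ) : ℂ))) := rfl

theorem windowMap_eq_branch {δ₁ δ₂ : ℝ} {q : Vertex → ℝ} (h1 : q (Sum.inl (klein 1)) = 0)
    (hs : |alpha q| + |beta q| = scale δ₁ δ₂ q) : windowMap q = branch δ₁ δ₂ q := by
  rw [windowMap, h1, ← chart_eq_model, chart, hs]
  rfl

/-- The set where `branch δ₁ δ₂` is smooth. -/
def branchDomain (δ₁ δ₂ : ℝ) : Set (Vertex → ℝ) :=
  {q | 1 - q (Sum.inl (klein 2)) ≠ 0 ∧ (δ₁ = 0 ∧ δ₂ = 0 ∨ scale δ₁ δ₂ q ≠ 0)}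

theorem continuous_scale (δ₁ δ₂ : ℝ) : Continuous (scale δ₁ δ₂) := by
  unfold scale alpha beta
  fun_prop

theorem isOpen_branchDomain (δ₁ δ₂ : ℝ) : IsOpen (branchDomain δ₁ δ₂) := by
  refine IsOpen.inter (isOpen_ne_fun (by fun_prop) continuous_const) ?_
  by_cases h : δ₁ = 0 ∧ δ₂ = 0
  · simp only [h, and_self, true_or]
    exact isOpen_univ
  · simp only [h, false_or]
    exact isOpen_ne_fun (continuous_scale _ _) continuous_const

theorem contDiffAt_branch {δ₁ δ₂ : ℝ} {q : Vertex → ℝ} (hq : q ∈ branchDomain δ₁ δ₂) :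
    ContDiffAt ℝ ∞ (branch δ₁ δ₂) q := by
  obtain ⟨he, hL⟩ := hq
  have hα : ContDiff ℝ ∞ alpha := by unfold alpha; fun_prop
  have hβ : ContDiff ℝ ∞ beta := by unfold beta; fun_prop
  have hγ : ContDiff ℝ ∞ gamma := by unfold gamma; fun_prop
  have hs : ContDiff ℝ ∞ (scale δ₁ δ₂) := by unfold scale; fun_prop
  have hof : ContDiff ℝ ∞ Complex.ofReal := Complex.ofRealCLM.contDiff
  have hy : ContDiff ℝ ∞ fun q : Vertex → ℝ => q (Sum.inl (klein 2)) := by fun_prop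
  have hθ : ContDiffAt ℝ ∞ (fun q : Vertex → ℝ =>
      ((Real.pi * gamma q / (6 * (1 - q (Sum.inl (klein 2)))) : ℝ) : ℂ)) q :=
    hof.contDiffAt.comp q (ContDiffAt.div (by fun_prop) (by fun_prop)
      (mul_ne_zero (by norm_num) he))
  refine (contDiffAt_piLp 2).2 fun i => ?_
  fin_cases i
  · change ContDiffAt ℝ ∞ (fun q => branch δ₁ δ₂ q 0) q
    simp only [branch_zero]
    -- With both signs zero, the first coordinate vanishes identically; this branch serves simplices
    -- on which `alpha` and `beta` vanish.
    rcases hL with ⟨rfl, rfl⟩ | hL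
    · simp only [scale, zero_mul, add_zero, zero_div, Complex.ofReal_zero]
      exact contDiffAt_const
    · have h2 : 2 * scale δ₁ δ₂ q ≠ 0 := mul_ne_zero (by norm_num) hL
      have ha : ContDiffAt ℝ ∞ (fun q => Real.pi * alpha q / (2 * scale δ₁ δ₂ q)) q :=
        ContDiffAt.div (by fun_prop) (by fun_prop) h2
      have hb : ContDiffAt ℝ ∞ (fun q => Real.pi * beta q / (2 * scale δ₁ δ₂ q)) q :=
        ContDiffAt.div (by fun_prop) (by fun_prop) h2
      exact (hof.contDiffAt.comp q (by fun_prop)).mul ((hof.contDiffAt.comp q ha.sin).add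
        (contDiffAt_const.mul (hof.contDiffAt.comp q hb.sin)))
  · change ContDiffAt ℝ ∞ (fun q => branch δ₁ δ₂ q 1) q
    simp only [branch_one]
    exact (hof.contDiffAt.comp q (by fun_prop)).mul (contDiffAt_const.mul hθ).cexp
  · change ContDiffAt ℝ ∞ (fun q => branch δ₁ δ₂ q 2) q
    simp only [branch_two]
    exact (hof.contDiffAt.comp q (by fun_prop)).mul (contDiffAt_const.mul hθ).neg.cexp

theorem norm_branch_one (δ₁ δ₂ : ℝ) (q : Vertex → ℝ) : ‖branch δ₁ δ₂ q 1‖ ^ 2 =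
    ((1 - q (Sum.inl (klein 2))) / 2 - scale δ₁ δ₂ q / 6) ^ 2 := by
  rw [branch_one, norm_mul, Complex.norm_exp_I_mul_ofReal, mul_one, Complex.norm_real,
    Real.norm_eq_abs, sq_abs]

theorem norm_branch_two (δ₁ δ₂ : ℝ) (q : Vertex → ℝ) : ‖branch δ₁ δ₂ q 2‖ ^ 2 =
    ((1 + q (Sum.inl (klein 2))) / 2 - scale δ₁ δ₂ q / 6) ^ 2 := by
  rw [branch_two, ← mul_neg, ← Complex.ofReal_neg, norm_mul, Complex.norm_exp_I_mul_ofReal,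
    mul_one, Complex.norm_real, Real.norm_eq_abs, sq_abs]

theorem branch_one_mul_two (δ₁ δ₂ : ℝ) (q : Vertex → ℝ) :
    branch δ₁ δ₂ q 1 * branch δ₁ δ₂ q 2 =
      ((((1 - q (Sum.inl (klein 2))) / 2 - scale δ₁ δ₂ q / 6) *
        ((1 + q (Sum.inl (klein 2))) / 2 - scale δ₁ δ₂ q / 6) : ℝ) : ℂ) := by
  rw [branch_one, branch_two, mul_mul_mul_comm, ← Complex.exp_add, add_neg_cancel, Complex.exp_zero,
    mul_one, Complex.ofReal_mul]

/-- Up to the signs `δ₁`, `δ₂` the two angles add up to `π/2`, so the sines are a sine and a cosine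
of the same angle. -/
theorem sin_sq_add_sin_sq {δ₁ δ₂ : ℝ} (h1 : δ₁ = 1 ∨ δ₁ = -1) (h2 : δ₂ = 1 ∨ δ₂ = -1)
    {q : Vertex → ℝ} (hL : scale δ₁ δ₂ q ≠ 0) :
    Real.sin (Real.pi * alpha q / (2 * scale δ₁ δ₂ q)) ^ 2 +
      Real.sin (Real.pi * beta q / (2 * scale δ₁ δ₂ q)) ^ 2 = 1 := by
  have e : Real.pi * beta q / (2 * scale δ₁ δ₂ q) =
      δ₂ * (Real.pi / 2 - δ₁ * (Real.pi * alpha q / (2 * scale δ₁ δ₂ q))) := by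
    have h3 : δ₂ * δ₂ = 1 := by rcases h2 with rfl | rfl <;> norm_num
    have : beta q = δ₂ * (scale δ₁ δ₂ q - δ₁ * alpha q) := by
      rw [scale]
      linear_combination (-beta q) * h3
    rw [this]
    field_simp
  rw [e]
  rcases h1 with rfl | rfl <;> rcases h2 with rfl | rfl <;>
    simp only [one_mul, neg_mul, Real.sin_neg, neg_sq, sub_neg_eq_add, Real.sin_pi_div_two_sub,
      add_comm (Real.pi / 2), Real.sin_add_pi_div_two, Real.sin_sq_add_cos_sq]

theorem norm_branch_zero {δ₁ δ₂ : ℝ} (h1 : δ₁ = 1 ∨ δ₁ = -1) (h2 : δ₂ = 1 ∨ δ₂ = -1)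
    {q : Vertex → ℝ} (hL : scale δ₁ δ₂ q ≠ 0) :
    ‖branch δ₁ δ₂ q 0‖ ^ 2 = (scale δ₁ δ₂ q / 3) ^ 2 := by
  rw [branch_zero, norm_mul, mul_pow, Complex.norm_real, Real.norm_eq_abs, sq_abs, mul_comm Complex.I,
    ← Complex.normSq_eq_norm_sq, Complex.normSq_add_mul_I, sin_sq_add_sin_sq h1 h2 hL, mul_one]

/-- Differentiating the squared absolute value isolates the real part of `μ`, without reference to
the phase. -/
theorem mul_eq_of_norm {c : ℝ → ℂ} {μ : ℂ} {m m' : ℝ} (hc : HasDerivAt c (μ * c 0) 0)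
    (hm : ∀ᶠ t in nhds (0 : ℝ), ‖c t‖ ^ 2 = (m + t * m') ^ 2) : m * m' = μ.re * m ^ 2 := by
  have h1 := hc.norm_sq
  have h2 : HasDerivAt (fun t : ℝ => (m + t * m') ^ 2) (2 * m * m') 0 := by
    have := (((hasDerivAt_id (0 : ℝ)).mul_const m').const_add m).pow 2
    refine this.congr_deriv ?_
    simp
  have h3 := (h2.congr_of_eventuallyEq (f₁ := fun t => ‖c t‖ ^ 2) hm).unique h1
  have h0 := hm.self_of_nhds
  rw [zero_mul, add_zero, ← Complex.normSq_eq_norm_sq, Complex.normSq_apply] at h0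
  rw [Complex.inner] at h3
  simp at h3
  linear_combination (1 / 2) * h3 + μ.re * h0

theorem alpha_line (q v : Vertex → ℝ) (t : ℝ) : alpha (q + t • v) = alpha q + t * alpha v := by
  simp only [alpha, Pi.add_apply, Pi.smul_apply, smul_eq_mul]
  ring

theorem beta_line (q v : Vertex → ℝ) (t : ℝ) : beta (q + t • v) = beta q + t * beta v := by
  simp only [beta, Pi.add_apply, Pi.smul_apply, smul_eq_mul]
  ring

theorem gamma_line (q v : Vertex → ℝ) (t : ℝ) : gamma (q + t • v) = gamma q + t * gamma v := by
  simp only [gamma, Pi.add_apply, Pi.smul_apply, smul_eq_mul]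
  ring

theorem scale_line (δ₁ δ₂ : ℝ) (q v : Vertex → ℝ) (t : ℝ) :
    scale δ₁ δ₂ (q + t • v) = scale δ₁ δ₂ q + t * scale δ₁ δ₂ v := by
  rw [scale, alpha_line, beta_line, scale, scale]
  ring

theorem hasDerivAt_line {F : (Vertex → ℝ) → C3} {q : Vertex → ℝ} (hF : DifferentiableAt ℝ F q)
    (v : Vertex → ℝ) (i : Fin 3) :
    HasDerivAt (fun t : ℝ => F (q + t • v) i) (fderiv ℝ F q v i) 0 := by
  have h1 : HasDerivAt (fun t : ℝ => q + t • v) v 0 := by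
    simpa using ((hasDerivAt_id (0 : ℝ)).smul_const v).const_add q
  have h2 : HasFDerivAt F (fderiv ℝ F q) (q + (0 : ℝ) • v) := by
    simpa using hF.hasFDerivAt
  exact ((PiLp.proj 2 (𝕜 := ℝ) (fun _ : Fin 3 => ℂ) i).hasFDerivAt).comp_hasDerivAt 0
    (h2.comp_hasDerivAt 0 h1)

theorem hasDerivAt_affine (a b : ℝ) : HasDerivAt (fun t : ℝ => a + t * b) b 0 := by
  simpa using ((hasDerivAt_id (0 : ℝ)).mul_const b).const_add a

/-- A direction killed in `CP²` multiplies the representative by `μ` to first order. The affine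
absolute values add up to 1 identically, so `Re μ = 0` and they are stationary. The product of the
last two coordinates is real with stationary modulus, so `μ = 0`. Each coordinate is then
stationary, and the phases give the remaining parameters. -/
theorem branch_immersive {δ₁ δ₂ : ℝ} {q v : Vertex → ℝ} {μ : ℂ} (hq : q ∈ branchDomain δ₁ δ₂)
    (he : 0 < 1 - q (Sum.inl (klein 2))) (hy : 0 ≤ q (Sum.inl (klein 2)))
    (hL : scale δ₁ δ₂ q ≤ 1 - q (Sum.inl (klein 2)))
    (hδ : δ₁ = 0 ∧ δ₂ = 0 ∨ (δ₁ = 1 ∨ δ₁ = -1) ∧ (δ₂ = 1 ∨ δ₂ = -1))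
    (H : ∀ i, fderiv ℝ (branch δ₁ δ₂) q v i = μ * branch δ₁ δ₂ q i) :
    v (Sum.inl (klein 2)) = 0 ∧ gamma v = 0 ∧ (δ₁ ≠ 0 → alpha v = 0 ∧ beta v = 0) := by
  have hd : DifferentiableAt ℝ (branch δ₁ δ₂) q :=
    (contDiffAt_branch hq).differentiableAt (by simp)
  have D (i) := hasDerivAt_line hd v i
  simp only [H] at D
  have q0 : q + (0 : ℝ) • v = q := by simp
  set y := q (Sum.inl (klein 2)) with hydef
  set y' := v (Sum.inl (klein 2)) with hy'
  set L := scale δ₁ δ₂ q with hLdef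
  set L' := scale δ₁ δ₂ v with hL'
  have hyl (t : ℝ) : (q + t • v) (Sum.inl (klein 2)) = y + t * y' := rfl
  have D' (i) : HasDerivAt (fun t : ℝ => branch δ₁ δ₂ (q + t • v) i)
      (μ * branch δ₁ δ₂ (q + (0 : ℝ) • v) i) 0 := by
    rw [q0]
    exact D i
  have m1pos : 0 < (1 - y) / 2 - L / 6 := by linarith
  have m2pos : 0 < (1 + y) / 2 - L / 6 := by linarith
  have r1 : (-y' / 2 - L' / 6) = μ.re * ((1 - y) / 2 - L / 6) := by
    have := mul_eq_of_norm (m := (1 - y) / 2 - L / 6) (m' := -y' / 2 - L' / 6) (D' 1)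
      (Filter.Eventually.of_forall fun t => by
        simp only [norm_branch_one, hyl, scale_line]
        ring)
    apply mul_left_cancel₀ m1pos.ne'
    linear_combination this
  have r2 : (y' / 2 - L' / 6) = μ.re * ((1 + y) / 2 - L / 6) := by
    have := mul_eq_of_norm (m := (1 + y) / 2 - L / 6) (m' := y' / 2 - L' / 6) (D' 2)
      (Filter.Eventually.of_forall fun t => by
        simp only [norm_branch_two, hyl, scale_line]
        ring)
    apply mul_left_cancel₀ m2pos.ne'
    linear_combination this
  have r0 : L' = μ.re * L := by
    rcases hδ with ⟨rfl, rfl⟩ | ⟨h1, h2⟩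
    · simp [hLdef, hL', scale]
    · have hL0 : L ≠ 0 := by
        rcases hq.2 with h | h
        · rcases h1 with h1 | h1 <;> rw [h1] at h <;> norm_num at h
        · exact h
      have := mul_eq_of_norm (m := L / 3) (m' := L' / 3) (D' 0) (by
        have hc : Filter.Tendsto (fun t : ℝ => scale δ₁ δ₂ (q + t • v)) (nhds 0)
            (nhds (scale δ₁ δ₂ (q + (0 : ℝ) • v))) :=
          Continuous.tendsto ((continuous_scale δ₁ δ₂).comp (by fun_prop)) 0
        rw [q0] at hc
        filter_upwards [hc.eventually_ne hL0] with t ht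
        rw [norm_branch_zero h1 h2 ht, scale_line]
        ring)
      have hL3 : L / 3 ≠ 0 := div_ne_zero hL0 (by norm_num)
      have h3 : L' / 3 = μ.re * (L / 3) := by
        apply mul_left_cancel₀ hL3
        linear_combination this
      linear_combination 3 * h3
  -- The three absolute values have sum 1, so adding their equations gives `0 = Re μ`.
  have hre : μ.re = 0 := by linear_combination -r1 - r2 - r0 / 3
  rw [hre, zero_mul] at r0 r1 r2
  have hy0 : y' = 0 := by linarith
  have hμ : μ = 0 := by
    have h1 := (D 1).mul (D 2)
    simp only [q0, Pi.mul_def, branch_one_mul_two, hyl, scale_line, ← hLdef, ← hL', r0, hy0,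
      mul_zero, add_zero] at h1
    have h2 := h1.unique (hasDerivAt_const _ _)
    have h3 := branch_one_mul_two δ₁ δ₂ q
    have h4 : branch δ₁ δ₂ q 1 * branch δ₁ δ₂ q 2 ≠ 0 := by
      rw [h3, Complex.ofReal_ne_zero]
      exact (mul_pos m1pos m2pos).ne'
    have h5 : μ * (branch δ₁ δ₂ q 1 * branch δ₁ δ₂ q 2) = 0 := by linear_combination h2 / 2
    exact (mul_eq_zero.1 h5).resolve_right h4
  simp only [hμ, zero_mul] at D
  refine ⟨hy0, ?_, fun hne => ?_⟩
  · have h1 := D 1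
    simp only [branch_one, hyl, scale_line, ← hLdef, ← hL', r0, hy0, mul_zero, add_zero,
      gamma_line] at h1
    have h2 : HasDerivAt (fun t : ℝ => Real.pi * (gamma q + t * gamma v) / (6 * (1 - y)))
        (Real.pi * gamma v / (6 * (1 - y))) 0 :=
      ((hasDerivAt_affine (gamma q) (gamma v)).const_mul Real.pi).div_const _
    have h3 := ((h2.ofReal_comp.const_mul Complex.I).cexp.const_mul
      (((1 - y) / 2 - L / 6 : ℝ) : ℂ)).unique h1
    have h4 := (mul_eq_zero.1 h3).resolve_left (Complex.ofReal_ne_zero.2 m1pos.ne')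
    have h5 := (mul_eq_zero.1 h4).resolve_left (Complex.exp_ne_zero _)
    have h6 := (mul_eq_zero.1 h5).resolve_left Complex.I_ne_zero
    rw [Complex.ofReal_eq_zero, div_eq_zero_iff] at h6
    rcases h6 with h6 | h6
    · exact (mul_eq_zero.1 h6).resolve_left Real.pi_pos.ne'
    · exact absurd h6 (by positivity)
  · obtain ⟨h1, h2⟩ := hδ.resolve_left fun h => hne h.1
    have hL0 : L ≠ 0 := hq.2.resolve_left fun h => hne h.1
    have h0 := D 0
    simp only [branch_zero, scale_line, ← hLdef, ← hL', r0, mul_zero, add_zero, alpha_line,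
      beta_line] at h0
    have ha : HasDerivAt (fun t : ℝ => Real.pi * (alpha q + t * alpha v) / (2 * L))
        (Real.pi * alpha v / (2 * L)) 0 :=
      ((hasDerivAt_affine (alpha q) (alpha v)).const_mul Real.pi).div_const _
    have hb : HasDerivAt (fun t : ℝ => Real.pi * (beta q + t * beta v) / (2 * L))
        (Real.pi * beta v / (2 * L)) 0 :=
      ((hasDerivAt_affine (beta q) (beta v)).const_mul Real.pi).div_const _
    have h3 := ((ha.sin.ofReal_comp.add (hb.sin.ofReal_comp.const_mul Complex.I)).const_mul
      ((L / 3 : ℝ) : ℂ)).unique h0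
    have h4 := (mul_eq_zero.1 h3).resolve_left
      (Complex.ofReal_ne_zero.2 (div_ne_zero hL0 (by norm_num)))
    have hre := congr_arg Complex.re h4
    have him := congr_arg Complex.im h4
    simp only [zero_mul, add_zero, Complex.add_re, Complex.ofReal_re, Complex.mul_re, Complex.I_re,
      Complex.I_im, Complex.ofReal_im, Complex.add_im, Complex.mul_im, one_mul, mul_zero, sub_zero,
      zero_add, Complex.zero_re, Complex.zero_im] at hre him
    have hs := sin_sq_add_sin_sq h1 h2 hL0
    rw [← hLdef] at hs
    have hlin : δ₁ * alpha v + δ₂ * beta v = 0 := by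
      change L' = 0
      exact r0
    have hd1 : δ₁ ≠ 0 := hne
    have hd2 : δ₂ ≠ 0 := by rcases h2 with rfl | rfl <;> norm_num
    have fin {z : ℝ} (h : Real.pi * z / (2 * L) = 0) : z = 0 := by
      rcases div_eq_zero_iff.1 h with h | h
      · exact (mul_eq_zero.1 h).resolve_left Real.pi_pos.ne'
      · exact absurd h (mul_ne_zero (by norm_num) hL0)
    -- The sum of the squared sines is 1, so the two cosines cannot both vanish. One of `alpha v`,
    -- `beta v` is therefore zero, and the linear relation `hlin` gives the other.
    by_cases hc : Real.cos (Real.pi * alpha q / (2 * L)) = 0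
    · have hc2 : Real.cos (Real.pi * beta q / (2 * L)) ≠ 0 := by
        intro hc2
        have e1 := Real.sin_sq_add_cos_sq (Real.pi * alpha q / (2 * L))
        have e2 := Real.sin_sq_add_cos_sq (Real.pi * beta q / (2 * L))
        rw [hc] at e1
        rw [hc2] at e2
        linarith
      have hb0 := fin ((mul_eq_zero.1 him).resolve_left hc2)
      rw [hb0, mul_zero, add_zero] at hlin
      exact ⟨(mul_eq_zero.1 hlin).resolve_left hd1, hb0⟩
    · have ha0 := fin ((mul_eq_zero.1 hre).resolve_left hc)
      rw [ha0, mul_zero, zero_add] at hlin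
      exact ⟨ha0, (mul_eq_zero.1 hlin).resolve_left hd2⟩

/-! ### Piecewise smoothness -/

section Convexity

variable {E : Type*} [NormedAddCommGroup E] [NormedSpace ℝ E]

/-- The segment from `y` to `p` can be prolonged slightly beyond `p` inside the hull. A positive
value at `y` would make `l` negative there. -/
theorem eq_zero_of_intrinsicInterior {s : Set E} {p : E}
    (hp : p ∈ intrinsicInterior ℝ (convexHull ℝ s)) (l : E →ₗ[ℝ] ℝ) (h0 : ∀ y ∈ s, 0 ≤ l y)
    (hl : l p = 0) : ∀ y ∈ s, l y = 0 := by
  intro y hy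
  refine le_antisymm ?_ (h0 y hy)
  have hpos : ∀ z ∈ convexHull ℝ s, 0 ≤ l z :=
    convexHull_min (t := {z | 0 ≤ l z}) h0 (convex_halfSpace_ge l.isLinear 0)
  obtain ⟨x, hx, rfl⟩ := hp
  have hyS : y ∈ affineSpan ℝ (convexHull ℝ s) :=
    subset_affineSpan ℝ _ (subset_convexHull ℝ _ hy)
  let c (t : ℝ) : affineSpan ℝ (convexHull ℝ s) :=
    ⟨AffineMap.lineMap y (x : E) t, AffineMap.lineMap_mem t hyS x.2⟩
  have hc : Continuous c := by
    refine Continuous.subtype_mk ?_ _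
    exact AffineMap.lineMap_continuous
  have hc1 : c 1 = x := Subtype.ext (AffineMap.lineMap_apply_one _ _)
  have hmem : ∀ᶠ t in nhds (1 : ℝ), (c t : E) ∈ convexHull ℝ s := by
    have : c ⁻¹' (interior ((↑) ⁻¹' convexHull ℝ s)) ∈ nhds (1 : ℝ) :=
      hc.continuousAt.preimage_mem_nhds (isOpen_interior.mem_nhds (by rwa [hc1]))
    filter_upwards [this] with t ht
    have h := interior_subset (Set.mem_preimage.1 ht)
    exact h
  obtain ⟨t, ht, h1⟩ := ((hmem.filter_mono nhdsWithin_le_nhds).and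
    (self_mem_nhdsWithin (a := (1 : ℝ)) (s := Set.Ioi 1))).exists
  have h2 := hpos _ ht
  simp only [c, AffineMap.lineMap_apply_module, map_add, map_smul, hl, smul_eq_mul, mul_zero,
    add_zero] at h2
  have h1' : 1 < t := h1
  nlinarith

theorem map_eq_zero_of_mem_vectorSpan {s : Set E} {u : E} (hu : u ∈ vectorSpan ℝ s)
    (l : E →ₗ[ℝ] ℝ) (c : ℝ) (h : ∀ y ∈ s, l y = c) : l u = 0 := by
  have : vectorSpan ℝ s ≤ LinearMap.ker l := by
    rw [vectorSpan_def, Submodule.span_le]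
    rintro _ ⟨x, hx, y, hy, rfl⟩
    rw [SetLike.mem_coe, LinearMap.mem_ker]
    change l (x - y) = 0
    rw [map_sub, h x hx, h y hy, sub_self]
  exact this hu

end Convexity

/-! ### Choice of a smooth branch on each open simplex -/

/-- `mv` as a linear map. -/
def mvL (g : G) : (Vertex → ℝ) →L[ℝ] (Vertex → ℝ) where
  toFun := mv g
  map_add' _ _ := rfl
  map_smul' _ _ := rfl
  cont := continuous_mv g

theorem mvL_apply (g : G) (p : Vertex → ℝ) : mvL g p = mv g p := rfl

/-- `scale` as a linear map. -/
def scaleL (δ₁ δ₂ : ℝ) : (Vertex → ℝ) →ₗ[ℝ] ℝ where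
  toFun := scale δ₁ δ₂
  map_add' p q := by
    have := scale_line δ₁ δ₂ p q 1
    rwa [one_smul, one_mul] at this
  map_smul' t q := by
    have := scale_line δ₁ δ₂ 0 q t
    rw [zero_add] at this
    rw [this]
    simp [scale, alpha, beta]

/-- `scale` after the action of `g`. -/
def scaleMv (δ₁ δ₂ : ℝ) (g : G) : (Vertex → ℝ) →ₗ[ℝ] ℝ := scaleL δ₁ δ₂ ∘ₗ (mvL g).toLinearMap

theorem scaleMv_apply (δ₁ δ₂ : ℝ) (g : G) (p : Vertex → ℝ) :
    scaleMv δ₁ δ₂ g p = scale δ₁ δ₂ (mv g p) := rfl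

/-- The linear form that is `1 - y` on `|X|`. -/
def coheight (g : G) : (Vertex → ℝ) →ₗ[ℝ] ℝ :=
  ((∑ v : Vertex, (LinearMap.proj v : (Vertex → ℝ) →ₗ[ℝ] ℝ)) -
    LinearMap.proj (Sum.inl (klein 2))) ∘ₗ (mvL g).toLinearMap

theorem coheight_apply (g : G) (p : Vertex → ℝ) (hp : ∑ v, p v = 1) :
    coheight g p = 1 - mv g p (Sum.inl (klein 2)) := by
  rw [← hp, ← sum_mv g p]
  simp only [coheight, LinearMap.comp_apply, LinearMap.sub_apply, LinearMap.sum_apply,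
    LinearMap.proj_apply, ContinuousLinearMap.coe_coe, mvL_apply]

namespace InDelta

variable {m l : Fin 3} {p : Vertex → ℝ}

theorem sum_eq (h : InDelta m l p) :
    ∑ v, p v = p (Sum.inl (klein 2)) + p (Sum.inr (0, 2)) + p (Sum.inr (1, m)) +
      p (Sum.inr (2, l)) + p (Sum.inr (3, 2)) := by
  rw [sum_vertex, Fin.sum_univ_three, h.klein_eq 0 (by decide), h.klein_eq 1 (by decide),
    Fin.sum_univ_four, Finset.sum_eq_single_of_mem 2 (Finset.mem_univ _) fun n _ hn => h.inr_eq 0 n hn,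
    Finset.sum_eq_single_of_mem m (Finset.mem_univ _) fun n _ hn => h.inr_eq 1 n hn,
    Finset.sum_eq_single_of_mem l (Finset.mem_univ _) fun n _ hn => h.inr_eq 2 n hn,
    Finset.sum_eq_single_of_mem 2 (Finset.mem_univ _) fun n _ hn => h.inr_eq 3 n hn]
  ring

theorem eq_zero (h : InDelta m l p) (hm : m ≠ 2) (hl : l ≠ 2) (hs : ∑ v, p v = 0)
    (hy : p (Sum.inl (klein 2)) = 0) (hα : alpha p = 0) (hβ : beta p = 0) (hγ : gamma p = 0) :
    p = 0 := by
  rw [h.sum_eq, hy] at hs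
  unfold alpha at hα
  unfold beta at hβ
  unfold gamma at hγ
  have hml : p (Sum.inr (1, m)) = 0 ∧ p (Sum.inr (2, l)) = 0 := by
    have h1 := fun n (hn : n ≠ m) => h.inr_eq 1 n hn
    have h2 := fun n (hn : n ≠ l) => h.inr_eq 2 n hn
    have cases : ∀ n : Fin 3, n ≠ 2 → n = 0 ∨ n = 1 := by decide
    rcases cases m hm with rfl | rfl <;> rcases cases l hl with rfl | rfl
    · rw [h1 1 (by decide), h2 1 (by decide)] at hβ hγ
      constructor <;> linarith
    · rw [h1 1 (by decide), h2 0 (by decide)] at hβ hγ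
      constructor <;> linarith
    · rw [h1 0 (by decide), h2 1 (by decide)] at hβ hγ
      constructor <;> linarith
    · rw [h1 0 (by decide), h2 0 (by decide)] at hβ hγ
      constructor <;> linarith
  rw [hml.1, hml.2] at hs
  have h0 : p (Sum.inr (0, 2)) = 0 := by linarith
  have h3 : p (Sum.inr (3, 2)) = 0 := by linarith
  funext v
  revert v
  rw [forall_vertex]
  constructor
  · intro k
    by_cases hk : k = 2
    · rw [hk]; exact hy
    · exact h.klein_eq k hk
  · intro a n
    by_cases hn : n = (![2, m, l, 2] : Fin 4 → Fin 3) a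
    · subst hn
      fin_cases a
      exacts [h0, hml.1, hml.2, h3]
    · exact h.inr_eq a n hn

end InDelta

theorem exists_sign_of_forall {S : Set (Vertex → ℝ)} {φ : (Vertex → ℝ) → ℝ}
    (h : (∀ y ∈ S, 0 ≤ φ y) ∨ ∀ y ∈ S, φ y ≤ 0) :
    ∃ ε : ℝ, (ε = 1 ∨ ε = -1) ∧ ∀ y ∈ S, 0 ≤ ε * φ y := by
  rcases h with h | h
  · exact ⟨1, Or.inl rfl, fun y hy => by rw [one_mul]; exact h y hy⟩
  · exact ⟨-1, Or.inr rfl, fun y hy => by linarith [h y hy]⟩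

theorem comonotone_mv {S : Set (Vertex → ℝ)} (hS : Comonotone S) (g : G) (a a' : Fin 4) (n : Fin 3) :
    (∀ y ∈ S, mv g y (Sum.inr (a, n)) ≤ mv g y (Sum.inr (a', n))) ∨
      ∀ y ∈ S, mv g y (Sum.inr (a', n)) ≤ mv g y (Sum.inr (a, n)) := by
  simp only [mv_inr']
  exact hS _ _ _

theorem exists_sign_alpha {S : Set (Vertex → ℝ)} (hS : Comonotone S) (g : G) :
    ∃ ε : ℝ, (ε = 1 ∨ ε = -1) ∧ ∀ y ∈ S, 0 ≤ ε * alpha (mv g y) := by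
  refine exists_sign_of_forall ((comonotone_mv hS g 0 3 2).imp ?_ ?_) <;>
    intro h y hy <;> have := h y hy <;> unfold alpha <;> linarith

/-- If the second and third labels agree, `beta` is a difference of coordinates with one label,
whose order is constant by comonotonicity. Otherwise both surviving terms have the same sign. -/
theorem exists_sign_beta {S : Set (Vertex → ℝ)} (hS : Comonotone S) (g : G) {m l : Fin 3}
    (hm : m ≠ 2) (hl : l ≠ 2) (hd : ∀ y ∈ S, InDelta m l (mv g y))
    (h0 : ∀ y ∈ S, ∀ v, 0 ≤ y v) :
    ∃ ε : ℝ, (ε = 1 ∨ ε = -1) ∧ ∀ y ∈ S, 0 ≤ ε * beta (mv g y) := by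
  apply exists_sign_of_forall
  have cases : ∀ n : Fin 3, n ≠ 2 → n = 0 ∨ n = 1 := by decide
  have n0 (y) (hy : y ∈ S) (v) : 0 ≤ mv g y v := h0 y hy _
  rcases cases m hm with rfl | rfl <;> rcases cases l hl with rfl | rfl
  · refine (comonotone_mv hS g 2 1 0).imp ?_ ?_ <;> intro h y hy <;> have := h y hy <;>
      have h1 := (hd y hy).inr_eq 1 1 (by decide) <;>
      have h2 := (hd y hy).inr_eq 2 1 (by decide) <;> unfold beta <;> linarith
  · left
    intro y hy
    have h1 := (hd y hy).inr_eq 1 1 (by decide)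
    have h2 := (hd y hy).inr_eq 2 0 (by decide)
    unfold beta
    linarith [n0 y hy (Sum.inr (1, 0)), n0 y hy (Sum.inr (2, 1))]
  · right
    intro y hy
    have h1 := (hd y hy).inr_eq 1 0 (by decide)
    have h2 := (hd y hy).inr_eq 2 1 (by decide)
    unfold beta
    linarith [n0 y hy (Sum.inr (1, 1)), n0 y hy (Sum.inr (2, 0))]
  · refine (comonotone_mv hS g 1 2 1).imp ?_ ?_ <;> intro h y hy <;> have := h y hy <;>
      have h1 := (hd y hy).inr_eq 1 0 (by decide) <;>
      have h2 := (hd y hy).inr_eq 2 0 (by decide) <;> unfold beta <;> linarith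

/-- A linear or antilinear bijection carries complex lines to complex lines, so immersivity need
only be checked in the window. -/
theorem notMem_span_of_lift {g : G} {w z : C3} (h : ∀ μ : ℂ, w ≠ μ • z) :
    (lift g).1 w ∉ Submodule.span ℂ {(lift g).1 z} := by
  rw [Submodule.mem_span_singleton]
  rintro ⟨t, ht⟩
  rcases Uhat_semilinear (lift g).1 (lift g).2 with H | H
  · rw [← H] at ht
    exact h t ((lift g).1.injective ht).symm
  · rw [← Complex.conj_conj t, ← H] at ht
    exact h _ ((lift g).1.injective ht).symm

theorem toCP2_eq_lift (p : realization X) {g : G} (hw : Window (mv g p.1)) {z : C3}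
    (h : windowMap (mv g p.1) = z) :
    ∃ hz : (lift g⁻¹).1 z ≠ 0, toCP2 p = Projectivization.mk ℂ ((lift g⁻¹).1 z) hz := by
  subst h
  exact ⟨(map_ne_zero_iff _ (lift g⁻¹).1.injective).2 hw.windowMap_ne_zero, toCP2_eq p hw⟩

/-- On a simplex in standard position, the height, `alpha`, `beta`, `gamma` and the total are linear
coordinates (`InDelta.eq_zero`). A tangent vector on which all of them vanish is zero. -/
theorem smooth_of_branch {s : Finset (Vertex → ℝ)} (hs : s ∈ subFaces) {g : G} {m l : Fin 3}
    (hm : m ≠ 2) (hl : l ≠ 2)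
    (hd : ∀ p ∈ convexHull ℝ (s : Set (Vertex → ℝ)), InDelta m l (mv g p)) {δ₁ δ₂ : ℝ}
    (hδ : δ₁ = 0 ∧ δ₂ = 0 ∧ (∀ y ∈ s, scale 1 0 (mv g y) = 0 ∧ scale 0 1 (mv g y) = 0) ∨
      (δ₁ = 1 ∨ δ₁ = -1) ∧ (δ₂ = 1 ∨ δ₂ = -1))
    (H : ∀ p ∈ intrinsicInterior ℝ (convexHull ℝ (s : Set (Vertex → ℝ))),
      mv g p ∈ branchDomain δ₁ δ₂ ∧
        |alpha (mv g p)| + |beta (mv g p)| = scale δ₁ δ₂ (mv g p)) :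
    SmoothOnOpenSimplex toCP2 s := by
  have hw (p) (hp : p ∈ convexHull ℝ (s : Set (Vertex → ℝ))) : Window (mv g p) :=
    (hd p hp).window hm hl (mv_mem_realization g (mem_realization_of_mem_convexHull hs hp))
  let A : C3 →L[ℝ] C3 := LinearMap.toContinuousLinearMap (lift g⁻¹).1.toLinearMap
  have hF (p) (hp : mv g p ∈ branchDomain δ₁ δ₂) : ContDiffAt ℝ ∞ (fun p => A (branch δ₁ δ₂ (mv g p))) p := by
    refine A.contDiff.contDiffAt.comp p ?_
    exact (contDiffAt_branch hp).comp p (mvL g).contDiff.contDiffAt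
  refine ⟨mv g ⁻¹' branchDomain δ₁ δ₂, fun p => A (branch δ₁ δ₂ (mv g p)),
    (isOpen_branchDomain _ _).preimage (continuous_mv g), fun p hp => (H p hp).1,
    fun p hp => (hF p hp).contDiffWithinAt, fun p hp => ⟨?_, fun u hu hu0 => ?_⟩⟩
  · have hpc := intrinsicInterior_subset hp
    exact toCP2_eq_lift p (hw p.1 hpc)
      (windowMap_eq_branch ((hd p.1 hpc).klein_eq 1 (by decide)) (H p.1 hp).2)
  · have hpc := intrinsicInterior_subset hp
    have hwp := hw p.1 hpc
    obtain ⟨hdom, habs⟩ := H p.1 hp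
    have hdiff : DifferentiableAt ℝ (branch δ₁ δ₂) (mv g p.1) :=
      (contDiffAt_branch hdom).differentiableAt (by simp)
    have hfd : fderiv ℝ (fun p => A (branch δ₁ δ₂ (mv g p))) p.1 u =
        (lift g⁻¹).1 (fderiv ℝ (branch δ₁ δ₂) (mv g p.1) (mv g u)) := by
      have := A.hasFDerivAt.comp p.1
        (hdiff.hasFDerivAt.comp p.1 ((mvL g).hasFDerivAt (x := p.1)))
      rw [show (fun p => A (branch δ₁ δ₂ (mv g p))) = A ∘ branch δ₁ δ₂ ∘ mv g from rfl,
        this.fderiv]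
      rfl
    rw [hfd]
    refine notMem_span_of_lift fun μ hμ => hu0 ?_
    have hadm := hwp.admissible
    have hle := hadm.abs_le
    rw [(hd p.1 hpc).klein_eq 1 (by decide), habs, sub_zero] at hle
    have he : 0 < 1 - mv g p.1 (Sum.inl (klein 2)) := by
      refine lt_of_le_of_ne ?_ hdom.1.symm
      rw [← habs] at hle
      exact (add_nonneg (abs_nonneg _) (abs_nonneg _)).trans hle
    obtain ⟨hy, hγ, hαβ⟩ := branch_immersive hdom he (hwp.nonneg _) hle
      (hδ.imp (fun h => ⟨h.1, h.2.1⟩) id) fun i => by rw [hμ]; rfl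
    have hspan (f : (Vertex → ℝ) →ₗ[ℝ] ℝ) (c : ℝ) (h : ∀ y ∈ s, f y = c) : f u = 0 :=
      map_eq_zero_of_mem_vectorSpan hu f c h
    have hys (y) (hy : y ∈ s) : y ∈ convexHull ℝ (s : Set (Vertex → ℝ)) := subset_convexHull ℝ _ hy
    have hin : InDelta m l (mv g u) := by
      constructor
      · intro k hk
        exact hspan (LinearMap.proj (Sum.inl (klein k)) ∘ₗ (mvL g).toLinearMap) 0 fun y hy =>
          (hd y (hys y hy)).klein_eq k hk
      · intro a n hn
        exact hspan (LinearMap.proj (Sum.inr (a, n)) ∘ₗ (mvL g).toLinearMap) 0 fun y hy =>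
          (hd y (hys y hy)).inr_eq a n hn
    have hsum : ∑ v, mv g u v = 0 := by
      have e (y : Vertex → ℝ) : ((∑ v : Vertex, (LinearMap.proj v : (Vertex → ℝ) →ₗ[ℝ] ℝ)) ∘ₗ
          (mvL g).toLinearMap) y = ∑ v, mv g y v := by
        simp only [LinearMap.comp_apply, LinearMap.sum_apply, LinearMap.proj_apply,
          ContinuousLinearMap.coe_coe, mvL_apply]
      rw [← e]
      exact hspan _ 1 fun y hy => (e y).trans (hw y (hys y hy)).sum_eq
    have hab : alpha (mv g u) = 0 ∧ beta (mv g u) = 0 := by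
      rcases hδ with ⟨-, -, h⟩ | ⟨h, -⟩
      · have h1 := hspan (scaleMv 1 0 g) 0 fun y hy => (h y hy).1
        have h2 := hspan (scaleMv 0 1 g) 0 fun y hy => (h y hy).2
        simp only [scaleMv_apply, scale, one_mul, zero_mul, add_zero, zero_add] at h1 h2
        exact ⟨h1, h2⟩
      · exact hαβ (by rcases h with rfl | rfl <;> norm_num)
    have h0 := hin.eq_zero hm hl hsum hy hab.1 hab.2 hγ
    rw [← mv_inv_mv g u, h0]
    rfl

theorem smoothOnOpenSimplex_toCP2 {s : Finset (Vertex → ℝ)} (hs : s ∈ subFaces) :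
    SmoothOnOpenSimplex toCP2 s := by
  obtain ⟨σ, hσ, hsup⟩ := hs.2.2.2
  obtain ⟨g, m, l, hm, hl, hD⟩ := exists_inDelta hσ
  have hd (p) (hp : p ∈ convexHull ℝ (s : Set (Vertex → ℝ))) : InDelta m l (mv g p) := by
    refine hD p fun v hv => by_contra fun hvσ => hv ?_
    have : ∀ y ∈ (s : Set (Vertex → ℝ)), y v = 0 := fun y hy =>
      by_contra fun h => hvσ (hsup y hy v h)
    exact convexHull_min (t := {p : Vertex → ℝ | p v = 0}) this
      (convex_hyperplane (LinearMap.proj v).isLinear 0) hp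
  have hr (p) (hp : p ∈ convexHull ℝ (s : Set (Vertex → ℝ))) : p ∈ realization X :=
    mem_realization_of_mem_convexHull hs hp
  have hw (p) (hp : p ∈ convexHull ℝ (s : Set (Vertex → ℝ))) : Window (mv g p) :=
    (hd p hp).window hm hl (mv_mem_realization g (hr p hp))
  have hys (y) (hy : y ∈ s) : y ∈ convexHull ℝ (s : Set (Vertex → ℝ)) := subset_convexHull ℝ _ hy
  have hco (p) (hp : p ∈ convexHull ℝ (s : Set (Vertex → ℝ))) :=
    coheight_apply g p (hr p hp).2.1
  have hco0 (p) (hp : p ∈ convexHull ℝ (s : Set (Vertex → ℝ))) : 0 ≤ coheight g p := by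
    have := (hw p hp).admissible.e_nonneg
    rwa [(hd p hp).klein_eq 1 (by decide), sub_zero, ← hco p hp] at this
  -- A nonnegative linear form vanishing at an interior point vanishes on the whole simplex. Here
  -- the simplex is then a single Klein vertex, which has no nonzero tangent vectors, and a constant
  -- map suffices.
  by_cases hA : ∃ p ∈ intrinsicInterior ℝ (convexHull ℝ (s : Set (Vertex → ℝ))), coheight g p = 0
  · obtain ⟨p₀, hp₀, h0⟩ := hA
    have hz := eq_zero_of_intrinsicInterior hp₀ (coheight g) (fun y hy => hco0 y (hys y hy)) h0
    have hone (p) (hp : p ∈ convexHull ℝ (s : Set (Vertex → ℝ))) :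
        mv g p = Pi.single (Sum.inl (klein 2)) 1 := by
      have : coheight g p = 0 := convexHull_min (t := {p : Vertex → ℝ | coheight g p = 0}) hz
        (convex_hyperplane (coheight g).isLinear 0) hp
      rw [hco p hp] at this
      exact eq_single (mv_mem_realization g (hr p hp)) (by linarith)
    refine ⟨Set.univ, fun _ => (lift g⁻¹).1 (windowMap (mv g p₀)), isOpen_univ, Set.subset_univ _,
      contDiffOn_const, fun p hp => ⟨?_, fun u hu hu0 => absurd ?_ hu0⟩⟩
    · have hpc := intrinsicInterior_subset hp
      exact toCP2_eq_lift p (hw p.1 hpc) (by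
        rw [hone p.1 hpc, hone p₀ (intrinsicInterior_subset hp₀)])
    · funext v
      refine map_eq_zero_of_mem_vectorSpan hu (LinearMap.proj v) (p₀ v) fun y hy => ?_
      have : y = p₀ := by
        rw [← mv_inv_mv g y, hone y (hys y hy), ← hone p₀ (intrinsicInterior_subset hp₀), mv_inv_mv]
      rw [this]
      rfl
  push Not at hA
  have hA' (p) (hp : p ∈ intrinsicInterior ℝ (convexHull ℝ (s : Set (Vertex → ℝ)))) :
      1 - mv g p (Sum.inl (klein 2)) ≠ 0 := by
    rw [← hco p (intrinsicInterior_subset hp)]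
    exact hA p hp
  obtain ⟨ε₁, hε₁, h1⟩ := exists_sign_alpha hs.2.2.1 g
  obtain ⟨ε₂, hε₂, h2⟩ := exists_sign_beta hs.2.2.1 g hm hl (fun y hy => hd y (hys y hy))
    fun y hy => (hr y (hys y hy)).1
  have hpos : ∀ y ∈ (s : Set (Vertex → ℝ)), 0 ≤ scaleMv ε₁ ε₂ g y :=
    fun y hy => add_nonneg (h1 y hy) (h2 y hy)
  -- By the same principle `|α| + |β|` is either identically zero on the simplex, where the branch
  -- with zero signs applies, or nonzero throughout its interior.
  by_cases hB : ∃ p ∈ intrinsicInterior ℝ (convexHull ℝ (s : Set (Vertex → ℝ))),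
      scaleMv ε₁ ε₂ g p = 0
  · obtain ⟨p₀, hp₀, h0⟩ := hB
    have hz := eq_zero_of_intrinsicInterior hp₀ (scaleMv ε₁ ε₂ g) hpos h0
    have hab (y) (hy : y ∈ s) : scale 1 0 (mv g y) = 0 ∧ scale 0 1 (mv g y) = 0 := by
      have e : ε₁ * alpha (mv g y) + ε₂ * beta (mv g y) = 0 := hz y hy
      have n1 := h1 y hy
      have n2 := h2 y hy
      have e1 : ε₁ * alpha (mv g y) = 0 := by linarith
      have e2 : ε₂ * beta (mv g y) = 0 := by linarith
      simp only [scale, one_mul, zero_mul, add_zero, zero_add]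
      constructor
      · exact (mul_eq_zero.1 e1).resolve_left (by rcases hε₁ with rfl | rfl <;> norm_num)
      · exact (mul_eq_zero.1 e2).resolve_left (by rcases hε₂ with rfl | rfl <;> norm_num)
    refine smooth_of_branch hs hm hl hd (δ₁ := 0) (δ₂ := 0) (Or.inl ⟨rfl, rfl, hab⟩) fun p hp =>
      ⟨⟨hA' p hp, Or.inl ⟨rfl, rfl⟩⟩, ?_⟩
    have k1 : scaleMv 1 0 g p = 0 := convexHull_min
      (t := {p : Vertex → ℝ | scaleMv 1 0 g p = 0}) (fun y hy => (hab y hy).1)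
        (convex_hyperplane (scaleMv 1 0 g).isLinear 0) (intrinsicInterior_subset hp)
    have k2 : scaleMv 0 1 g p = 0 := convexHull_min
      (t := {p : Vertex → ℝ | scaleMv 0 1 g p = 0}) (fun y hy => (hab y hy).2)
        (convex_hyperplane (scaleMv 0 1 g).isLinear 0) (intrinsicInterior_subset hp)
    simp only [scaleMv_apply, scale, one_mul, zero_mul, add_zero, zero_add] at k1 k2
    simp [scale, k1, k2]
  · push Not at hB
    refine smooth_of_branch hs hm hl hd (Or.inr ⟨hε₁, hε₂⟩) fun p hp =>
      ⟨⟨hA' p hp, Or.inr (hB p hp)⟩, ?_⟩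
    have sgn {ε x : ℝ} (hε : ε = 1 ∨ ε = -1) (h : 0 ≤ ε * x) : |x| = ε * x := by
      rcases hε with rfl | rfl
      · rw [one_mul] at h ⊢
        exact abs_of_nonneg h
      · rw [neg_one_mul] at h ⊢
        exact abs_of_nonpos (by linarith)
    have k1 : 0 ≤ scaleMv ε₁ 0 g p := convexHull_min
      (t := {p : Vertex → ℝ | 0 ≤ scaleMv ε₁ 0 g p}) (fun y hy => by
        have := h1 y hy
        simpa [scaleMv_apply, scale] using this)
        (convex_halfSpace_ge (scaleMv ε₁ 0 g).isLinear 0) (intrinsicInterior_subset hp)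
    have k2 : 0 ≤ scaleMv 0 ε₂ g p := convexHull_min
      (t := {p : Vertex → ℝ | 0 ≤ scaleMv 0 ε₂ g p}) (fun y hy => by
        have := h2 y hy
        simpa [scaleMv_apply, scale] using this)
        (convex_halfSpace_ge (scaleMv 0 ε₂ g).isLinear 0) (intrinsicInterior_subset hp)
    simp only [scaleMv_apply, scale, zero_mul, add_zero, zero_add] at k1 k2
    rw [sgn hε₁ k1, sgn hε₂ k2, scale]

theorem isPiecewiseSmooth_toCP2 : IsPiecewiseSmooth X toCP2 :=
  ⟨subdivision, subFaces_finite, subdivision_space, fun _ hs => hs.2.2.2,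
    fun _ hs => smoothOnOpenSimplex_toCP2 hs⟩

/-! ### Values on generators -/

theorem rhoInt_swaps :
    rhoInt (Equiv.swap 0 1) = !![0, 4, 0; 4, 0, 0; 0, 0, 4] ∧
    rhoInt (Equiv.swap 1 2) = !![4, 0, 0; 0, 0, 4; 0, 4, 0] ∧
    rhoInt (Equiv.swap 2 3) = !![0, -4, 0; -4, 0, 0; 0, 0, 4] := by
  decide

theorem rho_swap_zero_one :
    (rho (Equiv.swap 0 1)).1 = !![0, 1, 0; 1, 0, 0; 0, 0, 1] := by
  change rhoMat _ = _
  rw [rhoMat, rhoInt_swaps.1]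
  ext i j
  fin_cases i <;> fin_cases j <;> simp

theorem rho_swap_one_two :
    (rho (Equiv.swap 1 2)).1 = !![1, 0, 0; 0, 0, 1; 0, 1, 0] := by
  change rhoMat _ = _
  rw [rhoMat, rhoInt_swaps.2.1]
  ext i j
  fin_cases i <;> fin_cases j <;> simp

theorem rho_swap_two_three :
    (rho (Equiv.swap 2 3)).1 = !![0, -1, 0; -1, 0, 0; 0, 0, 1] := by
  change rhoMat _ = _
  rw [rhoMat, rhoInt_swaps.2.2]
  ext i j
  fin_cases i <;> fin_cases j <;> simp

theorem rhoHat_eq (θ : Equiv.Perm (Fin 4)) (z : C3) :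
    (rhoHat θ).1 z = ((rho θ).1.map Complex.ofReal).toEuclideanLin
      (if Equiv.Perm.sign θ = 1 then z else conjEquiv z) :=
  semi_apply' _ _ _

theorem eta_swap (z : C3) : (eta (Equiv.swap 0 1)).1 z = conjEquiv z := by
  ext i
  rw [eta_apply, show (((Equiv.swap 0 1 : Equiv.Perm (Fin 3)) 2).val + 1) = 3 by decide, pow_mul,
    omega_pow_three, one_pow, one_mul]
  rfl

theorem eta_finRotate (z : C3) : (eta (finRotate 3)).1 z = omegaDiag.toEuclideanLin z := by
  ext i
  rw [eta_apply, show ((finRotate 3 2).val + 1) = 1 by decide, one_mul]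
  fin_cases i <;> simp [omegaDiag, conjPow, Matrix.mulVec_diagonal]

end CPTwo

end

open CPTwo in
theorem mainTheorem2 :
    ∃ (ρ : Equiv.Perm (Fin 4) →* Matrix.orthogonalGroup (Fin 3) ℝ)
      (ρhat : Equiv.Perm (Fin 4) →* Uhat) (η : Equiv.Perm (Fin 3) →* Uhat),
      -- the representation `ρ` of `S₄` has the prescribed values on the generators
      (ρ (Equiv.swap 0 1)).1 = !![0, 1, 0; 1, 0, 0; 0, 0, 1] ∧
      (ρ (Equiv.swap 1 2)).1 = !![1, 0, 0; 0, 0, 1; 0, 1, 0] ∧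
      (ρ (Equiv.swap 2 3)).1 = !![0, -1, 0; -1, 0, 0; 0, 0, 1] ∧
      -- `ρhat θ` is `ρ θ` for even `θ` and `ρ θ ∘ c` for odd `θ`
      (∀ θ z, (ρhat θ).1 z = ((ρ θ).1.map Complex.ofReal).toEuclideanLin
        (if Equiv.Perm.sign θ = 1 then z else conjEquiv z)) ∧
      -- the representation `η` of `S₃` has the prescribed values on `(12)` and `(123)`
      (∀ z, (η (Equiv.swap 0 1)).1 z = conjEquiv z) ∧
      (∀ z, (η (finRotate 3)).1 z = omegaDiag.toEuclideanLin z) ∧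
      -- the two representations commute modulo `D`
      (∀ θ ϰ, ρhat θ * η ϰ * (ρhat θ)⁻¹ * (η ϰ)⁻¹ ∈ scalars) ∧
      -- hence `R` is a well-defined (and faithful) homomorphism, and it acts by isometries
      ∃ R : Equiv.Perm (Fin 4) × Equiv.Perm (Fin 3) →* PUhat,
        (∀ θ ϰ, R (θ, ϰ) = QuotientGroup.mk (ρhat θ * η ϰ)) ∧
        Function.Injective R ∧
        (∀ h, IsFubiniStudyIsometry (act (R h))) ∧
        (∀ h, ∀ g : Uhat, QuotientGroup.mk g = R h → ∀ z u : C3, z ≠ 0 →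
          fubiniStudyForm (g.1 z) (g.1 u) = fubiniStudyForm z u) ∧
        -- `Sym X` is `S₄ × S₃`, acting on the vertices in the standard way
        ∃ Φ : Equiv.Perm (Fin 4) × Equiv.Perm (Fin 3) ≃* Sym X,
          (∀ h v, (Φ h).1 v = vertexAct h v) ∧
          ∃ f : realization X ≃ₜ CP2,
            -- the explicit formulas on the two simplices, and equivariance
            (∀ p : realization X, (∀ v, p.1 v ≠ 0 → v ∈ Set.range delta₁) →
              ∃ hz : formula₁ (fun i => p.1 (delta₁ i)) ≠ 0, f p = Projectivization.mk ℂ _ hz) ∧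
            (∀ p : realization X, (∀ v, p.1 v ≠ 0 → v ∈ Set.range delta₂) →
              ∃ hz : formula₂ (fun i => p.1 (delta₂ i)) ≠ 0, f p = Projectivization.mk ℂ _ hz) ∧
            (∀ h p, f (realize (Φ h) p) = act (R h) (f p)) ∧
            -- the images of the vertices
            (∀ j, ∀ p : realization X, p.1 (Sum.inl (klein j)) = 1 →
              ∃ hz : EuclideanSpace.single j (1 : ℂ) ≠ 0, f p = Projectivization.mk ℂ _ hz) ∧
            (∀ a b, ∀ p : realization X, p.1 (Sum.inr (a, b)) = 1 →
              ∃ hz : torusPoint a b ≠ 0, f p = Projectivization.mk ℂ _ hz) ∧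
            -- piecewise smoothness
            IsPiecewiseSmooth X f ∧
            -- the triangulation is equilibrium, with the following explicit subcomplexes
            IsEquilibrium X f ∧
            (∀ j, imageOf f (commonStar {j}) = disk j) ∧
            (∀ j, imageOf f (commonStar {j}ᶜ) = solidTorus j) ∧
            imageOf f (commonStar Finset.univ) = torus :=
  ⟨rho, rhoHat, eta, rho_swap_zero_one, rho_swap_one_two, rho_swap_two_three, rhoHat_eq,
    eta_swap, eta_finRotate, comm_mem_scalars, RHom, RHom_apply, RHom_injective,
    fun h => isFubiniStudyIsometry_act (RHom h), fun _ g _ z u _ => fubiniStudyForm_Uhat g z u,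
    symEquiv, fun _ _ => rfl, homeo, toCP2_formula₁, toCP2_formula₂, toCP2_realize, toCP2_klein,
    toCP2_inr, isPiecewiseSmooth_toCP2, isEquilibrium_toCP2, imageOf_star, imageOf_solidTorus,
    imageOf_torus⟩
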